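/- **Setting.** Let $h$ be a homogeneous cubic polynomial with real coefficients in $n$ variables and let $U\subset\mathbb R^n\setminus\{0\}$ be an $\mathbb R^{>0}$-invariant domain (open, connected, non-empty) with $h|_U>0$, such that $g_{\mathcal H}:=-\partial^2h|_{\mathcal H}$ is a Riemannian metric on the hypersurface $\mathcal H:=\{x\in U\mid h(x)=1\}$. Then $(\mathcal H,g_{\mathcal H})$ is called a *projective special real manifold* (of dimension $n-1$). The *supergravity r-map* assigns to it $\bar M:=\mathbb R^n+iU\subset\mathbb C^n$, with holomorphic coordinates $X^\mu=y^\mu+ix^\mu$, and the metric $$\bar g=\sum_{\mu,\nu=1}^n\frac{\partial^2\mathcal K}{\partial X^\mu\partial\bar X^\nu}\,dX^\mu d\bar X^\nu,\qquad \mathcal K:=-\log 8h(x),\quad x=\operatorname{Im}X .$$ This is a *projective special Kähler domain* with the prepotential $F(z^0,\dots,z^n)=h(z^1,\dots,z^n)/z^0$ on $M:=\{z^0\cdot(1,X)\mid z^0\in\mathbb C^*,\ X\in\bar M\}\subset\mathbb C^{n+1}\setminus\{0\}$. This means: $M$ is a $\mathbb C^*$-invariant domain; $F$ is holomorphic and homogeneous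 of degree $2$; with $F_I=\partial F/\partial z^I$, $F_{IJ}=\partial^2F/\partial z^I\partial z^J$, the matrix $N_{IJ}:=2\operatorname{Im}F_{IJ}$ has signature $(1,n)$ and $f:=\sum N_{IJ}z^I\bar z^J>0$ on $M$; and, with $g=\sum N_{IJ}dz^Id\bar z^J$, $\xi$ the position vector field, $\alpha=g(\xi,\cdot)$ and $\pi:M\to\bar M$ the projection $z\mapsto(z^1/z^0,\dots,z^n/z^0)$, one has $\pi^*\bar g=-\frac gf+\frac{\alpha^2+(J^*\alpha)^2}{f^2}$. On $\bar N:=\bar M\times\mathbb R^{>0}\times\mathbb R^{2n+3}$, with coordinates $(X^\mu,\rho,\tilde\phi,\tilde\zeta_I,\zeta^I)$, $I=0,\dots,n$, put $X^0:=1$, $\mathcal K=-\log\sum X^IN_{IJ}(X)\bar X^J$, $d^c\mathcal K=-d\mathcal K\circ J$, let the real matrices $\mathcal R,\mathcal I$ be given by $$\mathcal R_{IJ}+i\mathcal I_{IJ}=\bar F_{IJ}+i\,\frac{\sum_KN_{IK}z^K\sum_LN_{JL}z^L}{\sum_{K,L}N_{KL}z^Kz^L}\Big|_{z=(1,X)},\qquad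 \hat H=\begin{pmatrix}\mathcal I^{-1}&\mathcal I^{-1}\mathcal R\\ \mathcal R\mathcal I^{-1}&\mathcal I+\mathcal R\mathcal I^{-1}\mathcal R\end{pmatrix},$$ and $(p_a)=(\tilde\zeta_I,\zeta^J)$. For $c\ge0$ the *one-loop deformed Ferrara–Sabharwal metric* is $$\begin{aligned}g^c_{FS}={}&\frac{\rho+c}{\rho}\bar g+\frac1{4\rho^2}\frac{\rho+2c}{\rho+c}d\rho^2+\frac1{4\rho^2}\frac{\rho+c}{\rho+2c}\Big(d\tilde\phi+\sum_I(\zeta^Id\tilde\zeta_I-\tilde\zeta_Id\zeta^I)+c\,d^c\mathcal K\Big)^2\\&+\frac1{2\rho}\sum_{a,b}dp_a\hat H^{ab}dp_b+\frac{2c}{\rho^2}e^{\mathcal K}\Big|\sum_I\big(X^Id\tilde\zeta_I+F_I(X)d\zeta^I\big)\Big|^2 .\end{aligned}$$ The *supergravity c-map* assigns to $(\bar M,\bar g)$ the manifold $\bar N$ with the metric $$\begin{aligned}g_{FS}={}&\bar g+\frac1{4\rho^2}d\rho^2+\frac1{4\rho^2}\Big(d\tilde\phi+\sum_I(\zeta^Id\tilde\zeta_I-\tilde\zeta_Id\zeta^I)\Big)^2+\frac1{2\rho}\sum\mathcal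 I_{IJ}d\zeta^Id\zeta^J\\&+\frac1{2\rho}\sum\mathcal I^{IJ}(d\tilde\zeta_I+\mathcal R_{IK}d\zeta^K)(d\tilde\zeta_J+\mathcal R_{JL}d\zeta^L),\end{aligned}$$ where $(\mathcal I^{IJ})=\mathcal I^{-1}$, and the *q-map* is the composition of the r-map and the c-map. A *quaternionic Kähler manifold* is a connected Riemannian manifold of real dimension at least $8$ that has a skew-symmetric quaternionic structure $Q\subset\operatorname{End}TN$ which is parallel for the Levi-Civita connection, and that has nonzero scalar curvature. **Theorem.** Let $(\mathcal H,g_{\mathcal H})$ be a complete projective special real manifold of dimension $n-1$, defined by $(h,U)$. Then the pair $(\bar M,\bar g)$ assigned to it by the supergravity r-map is a projective special Kähler domain with the prepotential $F$ above. For every $c\in\mathbb R^{\ge0}$, $(\bar N,g^c_{FS})$ is a complete quaternionic Kähler manifold. Moreover $g^0_{FS}=g_{FS}$ on $\bar N$, that is, $(\bar N,g^0_{FS})$ is the complete quaternionic Kähler manifold obtained from $(\mathcal H,g_{\mathcal H})$ via the q-map. -/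

import Mathlib

open scoped ContDiff Topology ENNReal

set_option maxSynthPendingDepth 3

noncomputable section

/-! ### Riemannian geometry of subsets of a real vector space

A (pseudo-)Riemannian metric on an open subset, or on a submanifold, of a real normed space `E` is
written as a field `g : E → E →L[ℝ] E →L[ℝ] ℝ` of bilinear forms; only its values at the points of
the subset (and, for a submanifold, on tangent vectors of it) matter. -/

section Riemannian

variable {E : Type*} [NormedAddCommGroup E] [NormedSpace ℝ E]

/-- The length of a curve `γ : [0,1] → E` with respect to `g`. -/
def curveLength (g : E → E →L[ℝ] E →L[ℝ] ℝ) (γ : ℝ → E) : ℝ≥0∞ :=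
  ∫⁻ t in Set.Icc (0 : ℝ) 1, ENNReal.ofReal
    (√(g (γ t) (derivWithin γ (Set.Icc 0 1) t) (derivWithin γ (Set.Icc 0 1) t)))

/-- The Riemannian distance of `(S, g)`: the infimum of the lengths of the `C¹` curves in `S` that
join two points. -/
def riemDist (S : Set E) (g : E → E →L[ℝ] E →L[ℝ] ℝ) (x y : E) : ℝ≥0∞ :=
  ⨅ (γ : ℝ → E) (_ : ContDiffOn ℝ 1 γ (Set.Icc 0 1)) (_ : Set.MapsTo γ (Set.Icc 0 1) S)
    (_ : γ 0 = x) (_ : γ 1 = y), curveLength g γ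

/-- `(S, g)` is complete: every Cauchy sequence of the Riemannian distance converges in `S`. -/
def IsCompleteRiemannian (S : Set E) (g : E → E →L[ℝ] E →L[ℝ] ℝ) : Prop :=
  ∀ u : ℕ → E, (∀ k, u k ∈ S) →
    (∀ ε : ℝ≥0∞, 0 < ε → ∃ k₀, ∀ k ≥ k₀, ∀ l ≥ k₀, riemDist S g (u k) (u l) < ε) →
    ∃ x ∈ S, Filter.Tendsto (fun k => riemDist S g (u k) x) Filter.atTop (𝓝 0)

/-- `g` is a smooth Riemannian metric on the open set `Ω`. -/
structure IsRiemannianMetricOn (Ω : Set E) (g : E → E →L[ℝ] E →L[ℝ] ℝ) : Prop where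
  contDiffOn : ContDiffOn ℝ ∞ g Ω
  symm : ∀ x ∈ Ω, ∀ u v, g x u v = g x v u
  pos : ∀ x ∈ Ω, ∀ v, v ≠ 0 → 0 < g x v v

/-- The bilinear map `(u, v) ↦ (w ↦ ½ (∂_u g(v,w) + ∂_v g(u,w) - ∂_w g(u,v)))` at the point `x`
(Christoffel symbols of the first kind). -/
def koszulForm (g : E → E →L[ℝ] E →L[ℝ] ℝ) (x : E) : E →L[ℝ] E →L[ℝ] E →L[ℝ] ℝ :=
  (1 / 2 : ℝ) • (fderiv ℝ g x + (fderiv ℝ g x).flip -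
    (ContinuousLinearMap.flipₗᵢ ℝ E E ℝ).toContinuousLinearEquiv.toContinuousLinearMap ∘L
      (fderiv ℝ g x).flip)

/-- The Levi-Civita connection of `g` is `∇_u V = ∂_u V + Γ(u, V)`, where `Γ = christoffel g`:
`g(Γ(u,v), w) = ½ (∂_u g(v,w) + ∂_v g(u,w) - ∂_w g(u,v))`. -/
def christoffel (g : E → E →L[ℝ] E →L[ℝ] ℝ) (x : E) : E →L[ℝ] E →L[ℝ] E :=
  (ContinuousLinearMap.compL ℝ E (E →L[ℝ] ℝ) E (g x).inverse) ∘L (koszulForm g x)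

/-- The covariant derivative `∇_v J` at `x` of a field `J` of endomorphisms, with respect to the
Levi-Civita connection of `g`. -/
def covDerivEnd (g : E → E →L[ℝ] E →L[ℝ] ℝ) (J : E → E →L[ℝ] E) (x v : E) : E →L[ℝ] E :=
  fderiv ℝ J x v + christoffel g x v ∘L J x - J x ∘L christoffel g x v

/-- The Riemann curvature tensor `R(u,v)w` of `g` at `x`. -/
def riemannCurvature (g : E → E →L[ℝ] E →L[ℝ] ℝ) (x u v w : E) : E :=
  fderiv ℝ (christoffel g) x u v w - fderiv ℝ (christoffel g) x v u w
    + christoffel g x u (christoffel g x v w) - christoffel g x v (christoffel g x u w)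

/-- The Ricci tensor `Ric(v,w) = tr (u ↦ R(u,v)w)`. -/
def ricciCurvature [FiniteDimensional ℝ E] (g : E → E →L[ℝ] E →L[ℝ] ℝ) (x v w : E) : ℝ :=
  ∑ i, (Module.finBasis ℝ E).coord i (riemannCurvature g x (Module.finBasis ℝ E i) v w)

/-- The scalar curvature: the trace of the Ricci tensor with respect to `g`. -/
def scalarCurvature [FiniteDimensional ℝ E] (g : E → E →L[ℝ] E →L[ℝ] ℝ) (x : E) : ℝ :=
  ∑ i, ∑ j, (Matrix.of fun k l => g x (Module.finBasis ℝ E k) (Module.finBasis ℝ E l))⁻¹ i j *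
    ricciCurvature g x (Module.finBasis ℝ E i) (Module.finBasis ℝ E j)

/-- The field `Q` of subspaces of `End E` is, over `Ω`, a skew-symmetric quaternionic structure
which is parallel for the Levi-Civita connection of `g`: locally, it is spanned by a smooth frame
`(J₁, J₂, J₃ = J₁ J₂)` of `g`-skew almost complex structures satisfying the quaternion relations,
and `∇_v J_a` is a section of `Q` for all `a` and `v`. -/
def IsParallelQuaternionicStructure (Ω : Set E) (g : E → E →L[ℝ] E →L[ℝ] ℝ)
    (Q : E → Submodule ℝ (E →L[ℝ] E)) : Prop :=
  ∀ x ∈ Ω, ∃ V : Set E, IsOpen V ∧ x ∈ V ∧ V ⊆ Ω ∧ ∃ J : Fin 3 → E → E →L[ℝ] E,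
    (∀ a, ContDiffOn ℝ ∞ (J a) V) ∧
    ∀ y ∈ V,
      (∀ a, J a y ∘L J a y = -ContinuousLinearMap.id ℝ E) ∧
      J 0 y ∘L J 1 y = J 2 y ∧
      (∀ a u v, g y (J a y u) v = -g y u (J a y v)) ∧
      Q y = Submodule.span ℝ (Set.range fun a => J a y) ∧
      ∀ a v, covDerivEnd g (J a) y v ∈ Q y

/-- `(Ω, g)` is a quaternionic Kähler manifold: a connected Riemannian manifold of real dimension
at least `8` with a parallel skew-symmetric quaternionic structure and nonzero scalar curvature. -/
structure IsQuaternionicKahler [FiniteDimensional ℝ E] (Ω : Set E)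
    (g : E → E →L[ℝ] E →L[ℝ] ℝ) : Prop where
  isOpen : IsOpen Ω
  isConnected : IsConnected Ω
  metric : IsRiemannianMetricOn Ω g
  eight_le_dim : 8 ≤ Module.finrank ℝ E
  exists_quaternionic : ∃ Q, IsParallelQuaternionicStructure Ω g Q
  scalar_ne_zero : ∀ x ∈ Ω, scalarCurvature g x ≠ 0

/-- The tensor product `α ⊗ β` of two real one-forms. -/
def tensorForm (α β : E →L[ℝ] ℝ) : E →L[ℝ] E →L[ℝ] ℝ := α.smulRight β

/-- The square `α²` of a real one-form. -/
def sqForm (α : E →L[ℝ] ℝ) : E →L[ℝ] E →L[ℝ] ℝ := tensorForm α α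

/-- For complex-valued one-forms `α`, `β`, the real bilinear form `(u, v) ↦ Re (α(u) conj(β(v)))`.
If `(k_{μν})` is Hermitian, then `∑ k_{μν} α_μ \bar α_ν`, with the symmetrized product
`½ (α_μ ⊗ \bar α_ν + \bar α_ν ⊗ α_μ)`, is the sum of the `hermForm (k_{μν} • α_μ) α_ν`. -/
def hermForm (α β : E →L[ℝ] ℂ) : E →L[ℝ] E →L[ℝ] ℝ :=
  tensorForm (Complex.reCLM ∘L α) (Complex.reCLM ∘L β)
    + tensorForm (Complex.imCLM ∘L α) (Complex.imCLM ∘L β)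

/-- The pull-back of a bilinear form along a linear map. -/
def pullbackForm {E' : Type*} [NormedAddCommGroup E'] [NormedSpace ℝ E'] (A : E →L[ℝ] E')
    (B : E' →L[ℝ] E' →L[ℝ] ℝ) : E →L[ℝ] E →L[ℝ] ℝ :=
  B.bilinearComp A A

end Riemannian

/-! ### Complex coordinates -/

section ComplexCoordinates

variable {m : ℕ}

/-- The coordinate one-form `dz^I` on `ℂ^m`. -/
def dZ (I : Fin m) : (Fin m → ℂ) →L[ℝ] ℂ := ContinuousLinearMap.proj I

/-- The complex structure `J` of `ℂ^m`. -/
def stdJ : (Fin m → ℂ) →L[ℝ] (Fin m → ℂ) := Complex.I • ContinuousLinearMap.id ℝ (Fin m → ℂ)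

/-- `∂G/∂X^μ = ½ (∂/∂y^μ - i ∂/∂x^μ) G`, where `X^μ = y^μ + i x^μ`. -/
def wirtinger (μ : Fin m) (G : (Fin m → ℂ) → ℂ) (X : Fin m → ℂ) : ℂ :=
  (1 / 2 : ℂ) * (fderiv ℝ G X (Pi.single μ 1) - Complex.I * fderiv ℝ G X (Pi.single μ Complex.I))

/-- `∂G/∂\bar X^μ = ½ (∂/∂y^μ + i ∂/∂x^μ) G`, where `X^μ = y^μ + i x^μ`. -/
def wirtingerBar (μ : Fin m) (G : (Fin m → ℂ) → ℂ) (X : Fin m → ℂ) : ℂ :=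
  (1 / 2 : ℂ) * (fderiv ℝ G X (Pi.single μ 1) + Complex.I * fderiv ℝ G X (Pi.single μ Complex.I))

/-- The metric `∑ ∂²K/∂X^μ∂\bar X^ν dX^μ d\bar X^ν` with Kähler potential `K`. -/
def kahlerMetric (K : (Fin m → ℂ) → ℝ) (X : Fin m → ℂ) :
    (Fin m → ℂ) →L[ℝ] (Fin m → ℂ) →L[ℝ] ℝ :=
  ∑ μ, ∑ ν, hermForm (wirtinger μ (wirtingerBar ν fun Y => (K Y : ℂ)) X • dZ μ) (dZ ν)

/-- `d^c K = -J^* dK`, that is, `d^c K (v) = -dK (J v)`. -/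
def dC (K : (Fin m → ℂ) → ℝ) (X : Fin m → ℂ) : (Fin m → ℂ) →L[ℝ] ℝ :=
  -(fderiv ℝ K X ∘L stdJ)

/-- The holomorphic partial derivative `F_I = ∂F/∂z^I`. -/
def holDeriv (I : Fin m) (F : (Fin m → ℂ) → ℂ) (z : Fin m → ℂ) : ℂ :=
  fderiv ℂ F z (Pi.single I 1)

end ComplexCoordinates

/-! ### Conical and projective special Kähler domains -/

section SpecialKahler

variable {n : ℕ}

/-- The second derivatives `F_{IJ}` of the prepotential. -/
def hessF (F : (Fin (n + 1) → ℂ) → ℂ) (z : Fin (n + 1) → ℂ) :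
    Matrix (Fin (n + 1)) (Fin (n + 1)) ℂ :=
  Matrix.of fun I J => holDeriv J (holDeriv I F) z

/-- The real matrix `N_{IJ} = 2 Im F_{IJ}`. -/
def matN (F : (Fin (n + 1) → ℂ) → ℂ) (z : Fin (n + 1) → ℂ) :
    Matrix (Fin (n + 1)) (Fin (n + 1)) ℝ :=
  Matrix.of fun I J => 2 * (hessF F z I J).im

/-- The function `f(z) = ∑ N_{IJ} z^I \bar z^J` (which is real because `N` is real symmetric). -/
def affinePotential (F : (Fin (n + 1) → ℂ) → ℂ) (z : Fin (n + 1) → ℂ) : ℝ :=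
  (∑ I, ∑ J, (matN F z I J : ℂ) * z I * (starRingEnd ℂ) (z J)).re

/-- The affine special Kähler metric `g = ∑ N_{IJ} dz^I d\bar z^J`. -/
def affineMetric (F : (Fin (n + 1) → ℂ) → ℂ) (z : Fin (n + 1) → ℂ) :
    (Fin (n + 1) → ℂ) →L[ℝ] (Fin (n + 1) → ℂ) →L[ℝ] ℝ :=
  ∑ I, ∑ J, hermForm ((matN F z I J : ℂ) • dZ I) (dZ J)

/-- A real matrix of size `n + 1` is symmetric of signature `(1, n)`. -/
def HasSignatureOneN (A : Matrix (Fin (n + 1)) (Fin (n + 1)) ℝ) : Prop :=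
  ∃ P : Matrix (Fin (n + 1)) (Fin (n + 1)) ℝ, IsUnit P.det ∧
    P.transpose * A * P = Matrix.diagonal (Fin.cons 1 fun _ : Fin n => -1)

/-- `M ⊆ ℂ^{n+1} ∖ {0}` with the holomorphic prepotential `F` is a conical special Kähler domain. -/
structure IsConicalSpecialKahlerDomain (M : Set (Fin (n + 1) → ℂ)) (F : (Fin (n + 1) → ℂ) → ℂ) :
    Prop where
  isOpen : IsOpen M
  isConnected : IsConnected M
  zero_notMem : (0 : Fin (n + 1) → ℂ) ∉ M
  smul_mem : ∀ z ∈ M, ∀ a : ℂ, a ≠ 0 → a • z ∈ M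
  holomorphic : DifferentiableOn ℂ F M
  homogeneous : ∀ z ∈ M, ∀ a : ℂ, a ≠ 0 → F (a • z) = a ^ 2 * F z
  signature : ∀ z ∈ M, HasSignatureOneN (matN F z)
  potential_pos : ∀ z ∈ M, 0 < affinePotential F z

/-- The degenerate tensor field `-g/f + (α² + (J^*α)²)/f²`, where `α = g(ξ, ·)` and `ξ` is the
position vector field. -/
def horizontalForm (F : (Fin (n + 1) → ℂ) → ℂ) (z : Fin (n + 1) → ℂ) :
    (Fin (n + 1) → ℂ) →L[ℝ] (Fin (n + 1) → ℂ) →L[ℝ] ℝ :=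
  -(affinePotential F z)⁻¹ • affineMetric F z
    + ((affinePotential F z) ^ 2)⁻¹ •
      (sqForm (affineMetric F z z) + sqForm (affineMetric F z z ∘L stdJ))

/-- The projection `π`, `z ↦ (z^1/z^0, …, z^n/z^0)`, in inhomogeneous coordinates. -/
def projInhom (z : Fin (n + 1) → ℂ) : Fin n → ℂ := fun μ => z μ.succ / z 0

/-- `(Mbar, gbar)`, with `Mbar ⊆ ℂ^n ⊆ ℂP^n`, is the projective special Kähler domain of the conical
special Kähler domain `(M, F)`, where `M ⊆ {z^0 ≠ 0}`: `Mbar = π(M)` and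
`π^* gbar = -g/f + (α² + (J^*α)²)/f²`. -/
structure IsProjectiveSpecialKahlerDomain (M : Set (Fin (n + 1) → ℂ))
    (F : (Fin (n + 1) → ℂ) → ℂ) (Mbar : Set (Fin n → ℂ))
    (gbar : (Fin n → ℂ) → (Fin n → ℂ) →L[ℝ] (Fin n → ℂ) →L[ℝ] ℝ) : Prop where
  conical : IsConicalSpecialKahlerDomain M F
  zero_ne : ∀ z ∈ M, z 0 ≠ 0
  image_eq : projInhom '' M = Mbar
  pullback_eq : ∀ z ∈ M,
    pullbackForm (fderiv ℝ projInhom z) (gbar (projInhom z)) = horizontalForm F z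

/-! ### The supergravity c-map and its one-loop deformation -/

/-- The point `(X^0, …, X^n) = (1, X)`. -/
def homCoord (X : Fin n → ℂ) : Fin (n + 1) → ℂ := Fin.cons 1 X

/-- The Kähler potential `𝒦 = -log ∑ X^I N_{IJ}(X) \bar X^J`, with `X^0 = 1`. -/
def kahlerPotential (F : (Fin (n + 1) → ℂ) → ℂ) (X : Fin n → ℂ) : ℝ :=
  -Real.log (affinePotential F (homCoord X))

/-- The matrix `𝒩_{IJ} = \bar F_{IJ} + i (∑ N_{IK} z^K)(∑ N_{JL} z^L) / ∑ N_{KL} z^K z^L`,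
evaluated at `z = (1, X)`. -/
def gaugeMatrix (F : (Fin (n + 1) → ℂ) → ℂ) (X : Fin n → ℂ) :
    Matrix (Fin (n + 1)) (Fin (n + 1)) ℂ :=
  Matrix.of fun I J =>
    (starRingEnd ℂ) (hessF F (homCoord X) I J) +
      Complex.I * ((∑ K, (matN F (homCoord X) I K : ℂ) * homCoord X K) *
        (∑ L, (matN F (homCoord X) J L : ℂ) * homCoord X L)) /
        (∑ K, ∑ L, (matN F (homCoord X) K L : ℂ) * homCoord X K * homCoord X L)

/-- `ℛ = Re 𝒩`. -/
def gaugeR (F : (Fin (n + 1) → ℂ) → ℂ) (X : Fin n → ℂ) : Matrix (Fin (n + 1)) (Fin (n + 1)) ℝ :=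
  (gaugeMatrix F X).map Complex.re

/-- `ℐ = Im 𝒩`. -/
def gaugeI (F : (Fin (n + 1) → ℂ) → ℂ) (X : Fin n → ℂ) : Matrix (Fin (n + 1)) (Fin (n + 1)) ℝ :=
  (gaugeMatrix F X).map Complex.im

/-- The matrix `Ĥ^{ab}`. -/
def matH (F : (Fin (n + 1) → ℂ) → ℂ) (X : Fin n → ℂ) :
    Matrix (Fin (n + 1) ⊕ Fin (n + 1)) (Fin (n + 1) ⊕ Fin (n + 1)) ℝ :=
  Matrix.fromBlocks (gaugeI F X)⁻¹ ((gaugeI F X)⁻¹ * gaugeR F X)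
    (gaugeR F X * (gaugeI F X)⁻¹) (gaugeI F X + gaugeR F X * (gaugeI F X)⁻¹ * gaugeR F X)

variable (n) in
/-- The coordinate space of `(X^μ, ρ, \tilde φ, \tilde ζ_I, ζ^I)`. -/
abbrev CMapSpace : Type := (Fin n → ℂ) × ℝ × ℝ × (Fin (n + 1) → ℝ) × (Fin (n + 1) → ℝ)

/-- `Nbar = Mbar × ℝ_{>0} × ℝ^{2n+3}`. -/
def cMapDomain (Mbar : Set (Fin n → ℂ)) : Set (CMapSpace n) := {p | p.1 ∈ Mbar ∧ 0 < p.2.1}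

/-- The differential of `X = (X^1, …, X^n)`. -/
def dX : CMapSpace n →L[ℝ] (Fin n → ℂ) := ContinuousLinearMap.fst ℝ _ _

/-- The one-form `dρ`. -/
def dRho : CMapSpace n →L[ℝ] ℝ :=
  ContinuousLinearMap.fst ℝ _ _ ∘L ContinuousLinearMap.snd ℝ _ _

/-- The one-form `d\tilde φ`. -/
def dPhi : CMapSpace n →L[ℝ] ℝ :=
  ContinuousLinearMap.fst ℝ _ _ ∘L ContinuousLinearMap.snd ℝ _ _ ∘L ContinuousLinearMap.snd ℝ _ _

/-- The one-form `d\tilde ζ_I`. -/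
def dZetaT (I : Fin (n + 1)) : CMapSpace n →L[ℝ] ℝ :=
  ContinuousLinearMap.proj I ∘L ContinuousLinearMap.fst ℝ _ _ ∘L ContinuousLinearMap.snd ℝ _ _ ∘L
    ContinuousLinearMap.snd ℝ _ _ ∘L ContinuousLinearMap.snd ℝ _ _

/-- The one-form `dζ^I`. -/
def dZeta (I : Fin (n + 1)) : CMapSpace n →L[ℝ] ℝ :=
  ContinuousLinearMap.proj I ∘L ContinuousLinearMap.snd ℝ _ _ ∘L ContinuousLinearMap.snd ℝ _ _ ∘L
    ContinuousLinearMap.snd ℝ _ _ ∘L ContinuousLinearMap.snd ℝ _ _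

/-- The one-forms `(dp_a) = (d\tilde ζ_I, dζ^J)`. -/
def dP : Fin (n + 1) ⊕ Fin (n + 1) → CMapSpace n →L[ℝ] ℝ := Sum.elim dZetaT dZeta

/-- The one-form `d\tilde φ + ∑ (ζ^I d\tilde ζ_I - \tilde ζ_I dζ^I)`. -/
def contactForm (p : CMapSpace n) : CMapSpace n →L[ℝ] ℝ :=
  dPhi + ∑ I, (p.2.2.2.2 I • dZetaT I - p.2.2.2.1 I • dZeta I)

/-- The supergravity c-map: the Ferrara-Sabharwal metric `g_FS` on `Nbar` of the projective special
Kähler domain with metric `gbar` and holomorphic prepotential `F`. -/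
def cMapMetric (gbar : (Fin n → ℂ) → (Fin n → ℂ) →L[ℝ] (Fin n → ℂ) →L[ℝ] ℝ)
    (F : (Fin (n + 1) → ℂ) → ℂ) (p : CMapSpace n) : CMapSpace n →L[ℝ] CMapSpace n →L[ℝ] ℝ :=
  let X := p.1
  let ρ := p.2.1
  pullbackForm dX (gbar X)
    + (1 / (4 * ρ ^ 2)) • sqForm dRho
    + (1 / (4 * ρ ^ 2)) • sqForm (contactForm p)
    + (1 / (2 * ρ)) • ∑ I, ∑ J, gaugeI F X I J • tensorForm (dZeta I) (dZeta J)
    + (1 / (2 * ρ)) • ∑ I, ∑ J, (gaugeI F X)⁻¹ I J •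
        tensorForm (dZetaT I + ∑ K, gaugeR F X I K • dZeta K)
          (dZetaT J + ∑ L, gaugeR F X J L • dZeta L)

/-- The complex-valued one-form `∑ (X^I d\tilde ζ_I + F_I(X) dζ^I)`. -/
def periodForm (F : (Fin (n + 1) → ℂ) → ℂ) (X : Fin n → ℂ) : CMapSpace n →L[ℝ] ℂ :=
  ∑ I, (homCoord X I • (Complex.ofRealCLM ∘L dZetaT I)
    + holDeriv I F (homCoord X) • (Complex.ofRealCLM ∘L dZeta I))

/-- The one-loop deformed Ferrara-Sabharwal metric `g_FS^c` of the projective special Kähler domain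
with metric `gbar` and holomorphic prepotential `F`. -/
def oneLoopMetric (gbar : (Fin n → ℂ) → (Fin n → ℂ) →L[ℝ] (Fin n → ℂ) →L[ℝ] ℝ)
    (F : (Fin (n + 1) → ℂ) → ℂ) (c : ℝ) (p : CMapSpace n) :
    CMapSpace n →L[ℝ] CMapSpace n →L[ℝ] ℝ :=
  let X := p.1
  let ρ := p.2.1
  ((ρ + c) / ρ) • pullbackForm dX (gbar X)
    + (1 / (4 * ρ ^ 2) * ((ρ + 2 * c) / (ρ + c))) • sqForm dRho
    + (1 / (4 * ρ ^ 2) * ((ρ + c) / (ρ + 2 * c))) •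
        sqForm (contactForm p + c • (dC (kahlerPotential F) X ∘L dX))
    + (1 / (2 * ρ)) • ∑ a, ∑ b, matH F X a b • tensorForm (dP a) (dP b)
    + (2 * c / ρ ^ 2 * Real.exp (kahlerPotential F X)) •
        hermForm (periodForm F X) (periodForm F X)

end SpecialKahler

/-! ### Projective special real manifolds, the supergravity r-map and the q-map -/

section SpecialReal

variable {n : ℕ}

/-- The differential `dh_x(v) = ∑ h_μ(x) v^μ`. -/
def dPoly (h : MvPolynomial (Fin n) ℝ) (x v : Fin n → ℝ) : ℝ :=
  ∑ μ, MvPolynomial.eval x (MvPolynomial.pderiv μ h) * v μ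

/-- The field of bilinear forms `-∂²h = -∑ h_{μν} dx^μ dx^ν`, which restricts to `g_ℋ`. -/
def psrMetric (h : MvPolynomial (Fin n) ℝ) (x : Fin n → ℝ) :
    (Fin n → ℝ) →L[ℝ] (Fin n → ℝ) →L[ℝ] ℝ :=
  -∑ μ, ∑ ν, MvPolynomial.eval x (MvPolynomial.pderiv μ (MvPolynomial.pderiv ν h)) •
    tensorForm (ContinuousLinearMap.proj μ) (ContinuousLinearMap.proj ν)

/-- The hypersurface `ℋ = {x ∈ U | h(x) = 1}`. -/
def psrHypersurface (h : MvPolynomial (Fin n) ℝ) (U : Set (Fin n → ℝ)) : Set (Fin n → ℝ) :=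
  {x ∈ U | MvPolynomial.eval x h = 1}

/-- The homogeneous cubic polynomial `h` and the `ℝ_{>0}`-invariant domain `U ⊆ ℝ^n ∖ {0}` define a
projective special real manifold `(ℋ, g_ℋ)` of dimension `n - 1`: `h > 0` on `U`, and `-∂²h` is
positive definite on the tangent spaces `ker dh_x` of `ℋ`. -/
structure IsProjectiveSpecialReal (h : MvPolynomial (Fin n) ℝ) (U : Set (Fin n → ℝ)) : Prop where
  cubic : h.IsHomogeneous 3
  isOpen : IsOpen U
  isConnected : IsConnected U
  zero_notMem : (0 : Fin n → ℝ) ∉ U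
  smul_mem : ∀ x ∈ U, ∀ r : ℝ, 0 < r → r • x ∈ U
  pos : ∀ x ∈ U, 0 < MvPolynomial.eval x h
  metric_pos : ∀ x ∈ psrHypersurface h U, ∀ v : Fin n → ℝ, dPoly h x v = 0 → v ≠ 0 →
    0 < psrMetric h x v v

/-- `Mbar = ℝ^n + i U ⊆ ℂ^n`. -/
def rMapDomain (U : Set (Fin n → ℝ)) : Set (Fin n → ℂ) := {X | (fun μ => (X μ).im) ∈ U}

/-- The Kähler potential `-log (8 h(x))`, `x = Im X`. -/
def rMapPotential (h : MvPolynomial (Fin n) ℝ) (X : Fin n → ℂ) : ℝ :=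
  -Real.log (8 * MvPolynomial.eval (fun μ => (X μ).im) h)

/-- The supergravity r-map: the Kähler metric `gbar` on `Mbar = ℝ^n + i U`. -/
def rMapMetric (h : MvPolynomial (Fin n) ℝ) :
    (Fin n → ℂ) → (Fin n → ℂ) →L[ℝ] (Fin n → ℂ) →L[ℝ] ℝ :=
  kahlerMetric (rMapPotential h)

/-- The cone `M = {z^0 (1, X) | z^0 ∈ ℂ^*, X ∈ Mbar}` over `Mbar = ℝ^n + i U`. -/
def rMapCone (U : Set (Fin n → ℝ)) : Set (Fin (n + 1) → ℂ) :=
  {z | ∃ a : ℂ, a ≠ 0 ∧ ∃ X ∈ rMapDomain U, z = a • homCoord X}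

/-- The holomorphic prepotential `F(z) = h(z^1, …, z^n) / z^0`. -/
def rMapPrepotential (h : MvPolynomial (Fin n) ℝ) (z : Fin (n + 1) → ℂ) : ℂ :=
  MvPolynomial.aeval (fun μ : Fin n => z μ.succ) h / z 0

/-- The q-map, the composition of the r-map and the c-map: the metric that it assigns to the
projective special real manifold of `(h, U)`, on the manifold `cMapDomain (rMapDomain U)`. -/
def qMapMetric (h : MvPolynomial (Fin n) ℝ) :
    CMapSpace n → CMapSpace n →L[ℝ] CMapSpace n →L[ℝ] ℝ :=
  cMapMetric (rMapMetric h) (rMapPrepotential h)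

end SpecialReal

end

/-! Everything built from h is written with the symmetric trilinear form `tri`, normalised by tri(x,
x, x) = 6 h(x). At each point x of U the form tri(x, ·, ·) is positive on x and negative definite on
the complement tri(x, x, ·) = 0 (`IsHyperbolicPoint`). Hence N has signature (1, n), -¼ ∂² log h is
positive definite, and a polynomial identity between N and this Hessian (`logHess_eq`) gives the
projective special Kähler domain.

The quaternionic Kähler property comes from a criterion that avoids computing the Levi-Civita
connection. Suppose that, up to a factor ν ≠ 0, the forms g(J_a ·, ·) are the curvature forms dθ_a +
θ_{a+1} ∧ θ_{a+2} of three one-forms (`IsQuaternionicFrame`). The Bianchi identity of this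
so(3)-curvature says that the derivatives ∇J_a, corrected by θ, have vanishing cyclic sums. An
algebraic lemma (`quaternionic_torsion_zero`), in the spirit of Hitchin's argument that closed ω_a
are parallel, shows that they vanish, so the span of the J_a is parallel. Commuting second
derivatives of J_a then computes [R, J_a]. Traces of this commutator, with the first Bianchi
identity, give Ric = -(dim/4 + 2) ν g, so the scalar curvature is a nonzero constant.

For the one-loop metric take θ₀ = ½ d^c𝒦 + (dφ̃ + ∑ (ζ dζ̃ - ζ̃ dζ) + c d^c𝒦) / (2ρ) and θ₁ + iθ₂ =
2 √(ρ + c)/ρ · e^{𝒦/2} ∑ (X^I dζ̃_I + F_I dζ^I). The fibre metric is diagonalised by passing from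
the covector dζ̃ + F dζ to its N-dual vector (`matH_eq`). In the resulting unitary coframe with
values in ℂ^{n+1} × ℂ^{n+1}, the curvature forms are twice the standard Kähler form and twice the
standard complex symplectic form (`curvForm_zero`, `curvForm_plus`), so the criterion applies with ν
= 2.

For completeness, a Cauchy sequence is confined, together with all short curves that start late on
it, to smaller and smaller sets (`IsTrap`). As c ≥ 0, the metric dominates -¼ ∂² log h on dX and
dρ²/(4ρ²). The radial projection from U to ℋ at most doubles lengths, so completeness of ℋ confines
the projection of Im X to a compact set. The functions log h and log ρ are Lipschitz and confine Im
X and ρ. Over a compact part of the base the metric is uniformly comparable with the Euclidean one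
after Heisenberg translations, which are isometries. So the sequence converges in the coordinate
space, to a point of the domain. -/

noncomputable section

/-! ### Quaternion algebra behind the parallelism criterion -/

section QuaternionicCriterion

variable {E : Type*} [NormedAddCommGroup E] [NormedSpace ℝ E]

/-- The exterior derivative of a one-form. -/
def extD (θ : E → E →L[ℝ] ℝ) (x u v : E) : ℝ := fderiv ℝ θ x u v - fderiv ℝ θ x v u

/-- The curvature forms `dθ_a + θ_{a+1} ∧ θ_{a+2}` of a triple of one-forms. -/
def curvForm (θ : Fin 3 → E → E →L[ℝ] ℝ) (a : Fin 3) (x u v : E) : ℝ :=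
  extD (θ a) x u v + (θ (a + 1) x u * θ (a + 2) x v - θ (a + 1) x v * θ (a + 2) x u)

theorem koszulForm_apply (g : E → E →L[ℝ] E →L[ℝ] ℝ) (x u v w : E) :
    koszulForm g x u v w = (1 / 2) * (fderiv ℝ g x u v w + fderiv ℝ g x v u w
      - fderiv ℝ g x w u v) := by
  simp [koszulForm]

/-- Expanding (J₀J₁)² = -1 gives J₁J₀ = -J₀J₁, and the other two products follow by multiplying J₀J₁
= J₂ by J₀ or J₁. Later arguments can then be cyclic in the index. -/
theorem quaternion_cyclic {R : Type*} [Ring R] {J : Fin 3 → R} (hsq : ∀ a, J a * J a = -1)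
    (h : J 0 * J 1 = J 2) (a : Fin 3) : J a * J (a + 1) = J (a + 2) := by
  have e : J 1 * J 0 = - (J 0 * J 1) := by
    have h2 := hsq 2
    rw [← h] at h2
    calc J 1 * J 0 = (J 0 * J 0) * (J 1 * J 0) * (J 1 * J 1) := by rw [hsq, hsq]; noncomm_ring
      _ = J 0 * (J 0 * J 1 * (J 0 * J 1)) * J 1 := by noncomm_ring
      _ = _ := by rw [h2]; noncomm_ring
  fin_cases a
  · exact h
  · change J 1 * J 2 = J 0
    rw [← h, ← mul_assoc, e, neg_mul, mul_assoc, hsq]; noncomm_ring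
  · change J 2 * J 0 = J 1
    rw [← h, mul_assoc, e, mul_neg, ← mul_assoc, hsq]; noncomm_ring

theorem quaternion_cyclic' {R : Type*} [Ring R] {J : Fin 3 → R} (hsq : ∀ a, J a * J a = -1)
    (h : J 0 * J 1 = J 2) (a : Fin 3) : J (a + 1) * J a = - J (a + 2) := by
  have h1 := quaternion_cyclic hsq h a
  have h2 := quaternion_cyclic hsq h (a + 1)
  have e1 : a + 1 + 1 = a + 2 := by fin_cases a <;> rfl
  have e2 : a + 1 + 2 = a := by fin_cases a <;> rfl
  rw [e1, e2] at h2
  rw [← h2, ← mul_assoc, hsq]; simp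

/-- The algebraic core of the parallelism of a quaternionic structure: a derivation `T` of the
quaternions `J₁, J₂, J₃` with vanishing cyclic sums is zero. -/
theorem quaternionic_torsion_zero (b : E →L[ℝ] E →L[ℝ] ℝ) (J₁ J₂ J₃ : E →L[ℝ] E)
    (T₁ T₂ T₃ : E → E →L[ℝ] E) (hsymm : ∀ x y, b x y = b y x)
    (hsq₁ : ∀ x, J₁ (J₁ x) = -x) (hsq₃ : ∀ x, J₃ (J₃ x) = -x)
    (hJ31 : ∀ x, J₂ (J₁ x) = - J₃ x) (hJ12 : ∀ x, J₁ (J₂ x) = J₃ x)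
    (hskew₁ : ∀ x y, b (J₁ x) y = - b x (J₁ y)) (hskew₃ : ∀ x y, b (J₃ x) y = - b x (J₃ y))
    (hTskew₁ : ∀ u x y, b (T₁ u x) y = - b x (T₁ u y))
    (hTskew₂ : ∀ u x y, b (T₂ u x) y = - b x (T₂ u y))
    (hTskew₃ : ∀ u x y, b (T₃ u x) y = - b x (T₃ u y))
    (hT₁ : ∀ u x, T₁ u (J₁ x) = - J₁ (T₁ u x))
    (hT : ∀ u x, T₃ u x = - T₂ u (J₁ x) - J₂ (T₁ u x))
    (hc₁ : ∀ x y z, b (T₁ x y) z + b (T₁ y z) x + b (T₁ z x) y = 0)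
    (hc₂ : ∀ x y z, b (T₂ x y) z + b (T₂ y z) x + b (T₂ z x) y = 0)
    (hc₃ : ∀ x y z, b (T₃ x y) z + b (T₃ y z) x + b (T₃ z x) y = 0)
    (u v w : E) : b (T₁ u v) w = 0 := by
  have hT3J : ∀ u x, T₃ u (J₁ x) = T₂ u x - J₃ (T₁ u x) := by
    intro u x
    rw [hT, hsq₁, hT₁, map_neg, map_neg, hJ31]; abel
  have hJT3 : ∀ u x, J₁ (T₃ u x) = - J₁ (T₂ u (J₁ x)) - J₃ (T₁ u x) := by
    intro u x
    rw [hT, map_sub, map_neg, hJ12]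
  -- Think of T₂ + iT₃ as the covariant derivative of the form ω₂ + iω₃, of type (2,0) for J₁. The
  -- left side is the real part of its derivative along w on the (0,1)-vectors y + iJ₁y and z +
  -- iJ₁z. It vanishes because the form kills each (0,1)-vector.
  have third : ∀ w y z, b (T₂ w y) z - b (T₂ w (J₁ y)) (J₁ z) - b (T₃ w (J₁ y)) z
      - b (T₃ w y) (J₁ z) = 0 := by
    intro w y z
    have e1 : b (T₃ w y) (J₁ z) = - b (J₁ (T₃ w y)) z := by rw [hskew₁]; ring
    have e2 : b (T₂ w (J₁ y)) (J₁ z) = - b (J₁ (T₂ w (J₁ y))) z := by rw [hskew₁]; ring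
    rw [e1, e2, hT3J, hJT3]
    simp only [map_sub, map_neg, sub_apply, neg_apply]
    ring
  -- Now the derivative is taken along y + iJ₁y and evaluated on z + iJ₁z and w. What survives is
  -- the failure of (0,1)-vectors to be parallel, an expression in T₁ alone.
  have first : ∀ y z w, b (T₂ y z) w - b (T₂ (J₁ y) (J₁ z)) w - b (T₃ (J₁ y) z) w
      - b (T₃ y (J₁ z)) w = b (J₃ (T₁ y z - T₁ (J₁ y) (J₁ z))) w := by
    intro y z w
    have e1 : T₃ (J₁ y) z = - T₂ (J₁ y) (J₁ z) + J₃ (T₁ (J₁ y) (J₁ z)) := by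
      have := hT3J (J₁ y) (J₁ z)
      rw [hsq₁, map_neg] at this
      rw [← neg_neg (T₃ (J₁ y) z), this]; abel
    rw [e1, hT3J]
    simp only [map_sub, map_neg, map_add, sub_apply, neg_apply, add_apply]
    ring
  -- The cyclic sums of T₂ and T₃ on y + iJ₁y, z + iJ₁z, w reduce, by `third` and `first`, to the
  -- vanishing of the Nijenhuis tensor of J₁.
  have nij : ∀ y z, ∀ w, b (T₁ y z - T₁ (J₁ y) (J₁ z)) w = b (T₁ z y - T₁ (J₁ z) (J₁ y)) w := by
    intro y z w
    have key : ∀ w, b (J₃ (T₁ y z - T₁ (J₁ y) (J₁ z))) w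
        = b (J₃ (T₁ z y - T₁ (J₁ z) (J₁ y))) w := by
      intro w
      rw [← first, ← first]
      have c1 := hc₂ y z w
      have c2 := hc₂ (J₁ y) (J₁ z) w
      have c3 := hc₃ (J₁ y) z w
      have c4 := hc₃ y (J₁ z) w
      have t := third w y z
      have s1 : b (T₂ z w) y = - b (T₂ z y) w := by rw [hTskew₂, hsymm]
      have s2 : b (T₂ (J₁ z) w) (J₁ y) = - b (T₂ (J₁ z) (J₁ y)) w := by rw [hTskew₂, hsymm]
      have s3 : b (T₃ z w) (J₁ y) = - b (T₃ z (J₁ y)) w := by rw [hTskew₃, hsymm]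
      have s4 : b (T₃ (J₁ z) w) y = - b (T₃ (J₁ z) y) w := by rw [hTskew₃, hsymm]
      linarith
    have := key (J₃ w)
    rw [hskew₃, hskew₃, hsq₃] at this
    simpa only [map_neg, neg_neg, neg_inj] using this
  have t2 : ∀ x y z, b (T₁ x (J₁ y)) (J₁ z) = - b (T₁ x y) z := by
    intro x y z
    rw [hT₁, map_neg, neg_apply, hskew₁, hsq₁, map_neg]; ring
  -- In the difference of these two cyclic sums, `t2` doubles the wanted term and `nij` cancels the
  -- remaining four.
  have c1 := hc₁ u v w
  have c2 := hc₁ u (J₁ v) (J₁ w)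
  have n := nij v w u
  have s1 : b (T₁ w u) v = - b (T₁ w v) u := by rw [hTskew₁, hsymm]
  have s2 : b (T₁ (J₁ w) u) (J₁ v) = - b (T₁ (J₁ w) (J₁ v)) u := by rw [hTskew₁, hsymm]
  have s3 := t2 u v w
  simp only [map_sub, sub_apply] at n
  linarith

end QuaternionicCriterion

/-! ### The Levi-Civita connection and the symmetries of its curvature -/

section LeviCivita

variable {E : Type*} [NormedAddCommGroup E] [NormedSpace ℝ E]

theorem fderiv_clm_apply_apply {F G : Type*} [NormedAddCommGroup F] [NormedSpace ℝ F]
    [NormedAddCommGroup G] [NormedSpace ℝ G] {A : E → F →L[ℝ] G} {B : E → F} {x : E}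
    (hA : DifferentiableAt ℝ A x) (hB : DifferentiableAt ℝ B x) (w : E) :
    fderiv ℝ (fun y => A y (B y)) x w = fderiv ℝ A x w (B x) + A x (fderiv ℝ B x w) := by
  rw [fderiv_clm_apply hA hB]
  simp [add_comm]

theorem fderiv_clm_const_apply {F G : Type*} [NormedAddCommGroup F] [NormedSpace ℝ F]
    [NormedAddCommGroup G] [NormedSpace ℝ G] {A : E → F →L[ℝ] G} {x : E}
    (hA : DifferentiableAt ℝ A x) (u : F) (w : E) :
    fderiv ℝ (fun y => A y u) x w = fderiv ℝ A x w u := by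
  rw [fderiv_clm_apply_apply hA (differentiableAt_const u)]
  simp

theorem IsRiemannianMetricOn.differentiableAt {Ω : Set E} (hΩ : IsOpen Ω)
    {g : E → E →L[ℝ] E →L[ℝ] ℝ} (hg : IsRiemannianMetricOn Ω g) {x : E} (hx : x ∈ Ω) :
    DifferentiableAt ℝ g x :=
  (hg.contDiffOn.contDiffAt (hΩ.mem_nhds hx)).differentiableAt (by simp)

theorem IsRiemannianMetricOn.fderiv_symm {Ω : Set E} (hΩ : IsOpen Ω)
    {g : E → E →L[ℝ] E →L[ℝ] ℝ} (hg : IsRiemannianMetricOn Ω g) {x : E} (hx : x ∈ Ω) (w u v : E) :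
    fderiv ℝ g x w u v = fderiv ℝ g x w v u := by
  have hd := hg.differentiableAt hΩ hx
  have key : ∀ u v, fderiv ℝ g x w u v = fderiv ℝ (fun y => g y u v) x w := by
    intro u v
    have h1 : DifferentiableAt ℝ (fun y => g y u) x := hd.clm_apply (differentiableAt_const u)
    rw [fderiv_clm_const_apply h1, fderiv_clm_const_apply hd]
  rw [key, key]
  have : (fun y => g y u v) =ᶠ[𝓝 x] fun y => g y v u := by
    filter_upwards [hΩ.mem_nhds hx] with y hy using hg.symm y hy u v
  rw [this.fderiv_eq]

theorem second_fderiv_symm {F : Type*} [NormedAddCommGroup F] [NormedSpace ℝ F] {Ω : Set E}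
    (hΩ : IsOpen Ω) {f : E → F} (hf : ContDiffOn ℝ ∞ f Ω) {x : E} (hx : x ∈ Ω) (u v : E) :
    fderiv ℝ (fderiv ℝ f) x u v = fderiv ℝ (fderiv ℝ f) x v u :=
  ((hf.contDiffAt (hΩ.mem_nhds hx)).isSymmSndFDerivAt
    (by simpa using (WithTop.coe_le_coe.2 le_top : ((2 : ℕ∞) : ℕ∞ω) ≤ (∞ : ℕ∞ω)))).eq u v

theorem riemann_antisymm (g : E → E →L[ℝ] E →L[ℝ] ℝ) (x u v w : E) :
    riemannCurvature g x u v w = - riemannCurvature g x v u w := by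
  simp only [riemannCurvature]; abel

theorem contDiffOn_koszulForm {Ω : Set E} (hΩ : IsOpen Ω)
    {g : E → E →L[ℝ] E →L[ℝ] ℝ} (hg : IsRiemannianMetricOn Ω g) :
    ContDiffOn ℝ ∞ (koszulForm g) Ω := by
  have hd : ContDiffOn ℝ ∞ (fderiv ℝ g) Ω := hg.contDiffOn.fderiv_of_isOpen hΩ (by simp)
  have hflip : ContDiffOn ℝ ∞ (fun x => (fderiv ℝ g x).flip) Ω :=
    (ContinuousLinearMap.flipₗᵢ ℝ E E (E →L[ℝ] ℝ)).contDiff.comp_contDiffOn hd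
  exact (contDiffOn_const (c := (1 / 2 : ℝ))).smul ((hd.add hflip).sub (contDiffOn_const.clm_comp hflip))

variable [FiniteDimensional ℝ E]

/-- Positivity makes g_x an injection into the dual space, which has the same dimension. -/
theorem IsRiemannianMetricOn.isInvertible {Ω : Set E}
    {g : E → E →L[ℝ] E →L[ℝ] ℝ} (hg : IsRiemannianMetricOn Ω g) {x : E} (hx : x ∈ Ω) :
    (g x).IsInvertible := by
  have hinj : Function.Injective (g x : E →ₗ[ℝ] (E →L[ℝ] ℝ)) := by
    rw [← LinearMap.ker_eq_bot, LinearMap.ker_eq_bot']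
    intro v hv
    by_contra hne
    have := hg.pos x hx v hne
    have h0 : g x v = 0 := hv
    simp [h0] at this
  have hdim : Module.finrank ℝ E = Module.finrank ℝ (E →L[ℝ] ℝ) := by
    rw [← (LinearMap.toContinuousLinearMap (𝕜 := ℝ) (E := E) (F' := ℝ)).finrank_eq]
    exact (Subspace.dual_finrank_eq (K := ℝ) (V := E)).symm
  exact ⟨(LinearEquiv.ofInjectiveOfFinrankEq (g x : E →ₗ[ℝ] (E →L[ℝ] ℝ)) hinj hdim).toContinuousLinearEquiv,
    by ext; rfl⟩

theorem apply_christoffel {Ω : Set E}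
    {g : E → E →L[ℝ] E →L[ℝ] ℝ} (hg : IsRiemannianMetricOn Ω g) {x : E} (hx : x ∈ Ω) (u v : E) :
    g x (christoffel g x u v) = koszulForm g x u v := by
  have := (hg.isInvertible hx).self_apply_inverse (koszulForm g x u v)
  simpa [christoffel] using this

theorem eq_of_metric {Ω : Set E} {g : E → E →L[ℝ] E →L[ℝ] ℝ} (hg : IsRiemannianMetricOn Ω g)
    {x : E} (hx : x ∈ Ω) {u v : E} (h : ∀ w, g x u w = g x v w) : u = v :=
  (hg.isInvertible hx).injective (by ext w; exact h w)

theorem christoffel_symm {Ω : Set E} (hΩ : IsOpen Ω)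
    {g : E → E →L[ℝ] E →L[ℝ] ℝ} (hg : IsRiemannianMetricOn Ω g) {x : E} (hx : x ∈ Ω) (u v : E) :
    christoffel g x u v = christoffel g x v u := by
  apply eq_of_metric hg hx
  intro w
  rw [apply_christoffel hg hx, apply_christoffel hg hx, koszulForm_apply, koszulForm_apply,
    hg.fderiv_symm hΩ hx w u v]
  ring

theorem christoffel_metric {Ω : Set E} (hΩ : IsOpen Ω)
    {g : E → E →L[ℝ] E →L[ℝ] ℝ} (hg : IsRiemannianMetricOn Ω g) {x : E} (hx : x ∈ Ω) (u v w : E) :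
    fderiv ℝ g x u v w = g x (christoffel g x u v) w + g x v (christoffel g x u w) := by
  rw [hg.symm x hx v, apply_christoffel hg hx, apply_christoffel hg hx, koszulForm_apply,
    koszulForm_apply, hg.fderiv_symm hΩ hx u w v]
  ring

theorem contDiffOn_inverse {Ω : Set E}
    {g : E → E →L[ℝ] E →L[ℝ] ℝ} (hg : IsRiemannianMetricOn Ω g) :
    ContDiffOn ℝ ∞ (fun x => (g x).inverse) Ω := fun x hx =>
  (hg.isInvertible hx).contDiffAt_map_inverse.comp_contDiffWithinAt x (hg.contDiffOn x hx)

theorem contDiffOn_christoffel {Ω : Set E} (hΩ : IsOpen Ω)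
    {g : E → E →L[ℝ] E →L[ℝ] ℝ} (hg : IsRiemannianMetricOn Ω g) :
    ContDiffOn ℝ ∞ (christoffel g) Ω := by
  have h1 := (ContinuousLinearMap.compL ℝ E (E →L[ℝ] ℝ) E).contDiff (n := ∞).comp_contDiffOn
    (contDiffOn_inverse hg)
  exact h1.clm_comp (contDiffOn_koszulForm hΩ hg)

theorem riemann_bianchi {Ω : Set E} (hΩ : IsOpen Ω)
    {g : E → E →L[ℝ] E →L[ℝ] ℝ} (hg : IsRiemannianMetricOn Ω g) {x : E} (hx : x ∈ Ω) (u v w : E) :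
    riemannCurvature g x u v w + riemannCurvature g x v w u + riemannCurvature g x w u v = 0 := by
  have hΓ : DifferentiableAt ℝ (christoffel g) x :=
    ((contDiffOn_christoffel hΩ hg).contDiffAt (hΩ.mem_nhds hx)).differentiableAt (by simp)
  have key : ∀ a b c, fderiv ℝ (christoffel g) x a b c = fderiv ℝ (christoffel g) x a c b := by
    intro a b c
    have k : ∀ b c, fderiv ℝ (christoffel g) x a b c
        = fderiv ℝ (fun y => christoffel g y b c) x a := by
      intro b c
      rw [fderiv_clm_const_apply (hΓ.clm_apply (differentiableAt_const b)),
        fderiv_clm_const_apply hΓ]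
    rw [k, k]
    have : (fun y => christoffel g y b c) =ᶠ[𝓝 x] fun y => christoffel g y c b := by
      filter_upwards [hΩ.mem_nhds hx] with y hy using christoffel_symm hΩ hg hy b c
    rw [this.fderiv_eq]
  simp only [riemannCurvature]
  rw [key u v w, key v u w, key w u v, christoffel_symm hΩ hg hx v w,
    christoffel_symm hΩ hg hx u w, christoffel_symm hΩ hg hx u v]
  abel

/-- Second derivatives of g commute. Differentiating the metric compatibility of Γ once more and
antisymmetrising leaves exactly the curvature terms. -/
theorem riemann_skew {Ω : Set E} (hΩ : IsOpen Ω)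
    {g : E → E →L[ℝ] E →L[ℝ] ℝ} (hg : IsRiemannianMetricOn Ω g) {x : E} (hx : x ∈ Ω)
    (u v a b : E) :
    g x (riemannCurvature g x u v a) b + g x a (riemannCurvature g x u v b) = 0 := by
  have hΓ : DifferentiableAt ℝ (christoffel g) x :=
    ((contDiffOn_christoffel hΩ hg).contDiffAt (hΩ.mem_nhds hx)).differentiableAt (by simp)
  have hd := hg.differentiableAt hΩ hx
  have hdd : DifferentiableAt ℝ (fderiv ℝ g) x :=
    ((hg.contDiffOn.fderiv_of_isOpen hΩ (m := ∞) (by simp)).contDiffAt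
      (hΩ.mem_nhds hx)).differentiableAt (by simp)
  have key : ∀ u v, fderiv ℝ (fderiv ℝ g) x v u a b =
      fderiv ℝ g x v (christoffel g x u a) b + g x (fderiv ℝ (christoffel g) x v u a) b
      + (fderiv ℝ g x v a (christoffel g x u b) + g x a (fderiv ℝ (christoffel g) x v u b)) := by
    intro u v
    have e1 : fderiv ℝ (fderiv ℝ g) x v u a b = fderiv ℝ (fun y => fderiv ℝ g y u a b) x v := by
      have h1 : DifferentiableAt ℝ (fun y => fderiv ℝ g y u) x :=
        hdd.clm_apply (differentiableAt_const u)
      have h2 : DifferentiableAt ℝ (fun y => fderiv ℝ g y u a) x :=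
        h1.clm_apply (differentiableAt_const a)
      rw [fderiv_clm_const_apply h2, fderiv_clm_const_apply h1, fderiv_clm_const_apply hdd]
    have hev : (fun y => fderiv ℝ g y u a b) =ᶠ[𝓝 x] fun y =>
        g y (christoffel g y u a) b + g y a (christoffel g y u b) := by
      filter_upwards [hΩ.mem_nhds hx] with y hy using christoffel_metric hΩ hg hy u a b
    have hΓ' : ∀ c, DifferentiableAt ℝ (fun y => christoffel g y u c) x := fun c =>
      (hΓ.clm_apply (differentiableAt_const u)).clm_apply (differentiableAt_const c)
    have hΓf : ∀ c, fderiv ℝ (fun y => christoffel g y u c) x v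
        = fderiv ℝ (christoffel g) x v u c := by
      intro c
      rw [fderiv_clm_const_apply (hΓ.clm_apply (differentiableAt_const u)),
        fderiv_clm_const_apply hΓ]
    have h1 : DifferentiableAt ℝ (fun y => g y (christoffel g y u a)) x := hd.clm_apply (hΓ' a)
    have h2 : DifferentiableAt ℝ (fun y => g y a) x := hd.clm_apply (differentiableAt_const a)
    rw [e1, hev.fderiv_eq, fderiv_fun_add (h1.clm_apply (differentiableAt_const b))
      (h2.clm_apply (hΓ' b)), add_apply, fderiv_clm_const_apply h1,
      fderiv_clm_apply_apply hd (hΓ' a), fderiv_clm_apply_apply h2 (hΓ' b),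
      fderiv_clm_const_apply hd, hΓf, hΓf, add_apply]
  have k1 := key u v
  have k2 := key v u
  have s := second_fderiv_symm hΩ hg.contDiffOn hx u v
  rw [s] at k2
  rw [k1] at k2
  simp only [christoffel_metric hΩ hg hx] at k2
  simp only [riemannCurvature, map_add, map_sub, add_apply, sub_apply]
  linarith

/-- The pair symmetry of the Riemann curvature tensor. -/
theorem riemann_pair {Ω : Set E} (hΩ : IsOpen Ω)
    {g : E → E →L[ℝ] E →L[ℝ] ℝ} (hg : IsRiemannianMetricOn Ω g) {x : E} (hx : x ∈ Ω)
    (u v a b : E) :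
    g x (riemannCurvature g x u v a) b = g x (riemannCurvature g x a b u) v := by
  have B : ∀ u v w z, g x (riemannCurvature g x u v w) z + g x (riemannCurvature g x v w u) z
      + g x (riemannCurvature g x w u v) z = 0 := by
    intro u v w z
    have := congrArg (fun y => g x y z) (riemann_bianchi hΩ hg hx u v w)
    simpa using this
  have A : ∀ u v w z, g x (riemannCurvature g x u v w) z
      = - g x (riemannCurvature g x v u w) z := by
    intro u v w z
    rw [riemann_antisymm, map_neg, neg_apply]
  have S : ∀ u v w z, g x (riemannCurvature g x u v w) z
      = - g x (riemannCurvature g x u v z) w := by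
    intro u v w z
    have := riemann_skew hΩ hg hx u v w z
    rw [hg.symm x hx w] at this
    linarith
  -- The octahedron argument: four Bianchi identities are combined, and the two skew symmetries
  -- match up all the terms except the wanted pair.
  have b1 := B u v a b
  have b2 := B v a b u
  have b3 := B a b u v
  have b4 := B b u v a
  have := S v a b u
  have := S a b v u
  have := S b v a u
  have := S b u a v
  have := S u a b v
  have := S u v b a
  have := S v b u a
  have := A v a u b
  have := A u a v b
  have := A b u v a
  have := A b v a u
  have := A b v u a
  have := A a u v b
  have := A u b v a
  have := A u b a v
  linarith

end LeviCivita

/-! ### From curvature forms to a parallel quaternionic structure -/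

section QuaternionicFrame

variable {E : Type*} [NormedAddCommGroup E] [NormedSpace ℝ E]

/-- The forms `ω_a = g(J_a ·, ·)` of an almost quaternionic Hermitian structure are, up to the
factor `ν ≠ 0`, the curvature forms of a triple of one-forms. -/
structure IsQuaternionicFrame (Ω : Set E) (g : E → E →L[ℝ] E →L[ℝ] ℝ)
    (θ : Fin 3 → E → E →L[ℝ] ℝ) (J : Fin 3 → E → E →L[ℝ] E) (ν : ℝ) : Prop where
  isOpen : IsOpen Ω
  metric : IsRiemannianMetricOn Ω g
  ne_zero : ν ≠ 0
  smooth : ∀ a, ContDiffOn ℝ ∞ (θ a) Ω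
  sq : ∀ x ∈ Ω, ∀ a, J a x * J a x = -1
  mul : ∀ x ∈ Ω, J 0 x * J 1 x = J 2 x
  curv : ∀ x ∈ Ω, ∀ a u v, ν * g x (J a x u) v = curvForm θ a x u v

theorem fin3_add11 (a : Fin 3) : a + 1 + 1 = a + 2 := by fin_cases a <;> rfl
theorem fin3_add12 (a : Fin 3) : a + 1 + 2 = a := by fin_cases a <;> rfl
theorem fin3_add21 (a : Fin 3) : a + 2 + 1 = a := by fin_cases a <;> rfl
theorem fin3_add22 (a : Fin 3) : a + 2 + 2 = a + 1 := by fin_cases a <;> rfl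

theorem curvForm_antisymm (θ : Fin 3 → E → E →L[ℝ] ℝ) (a : Fin 3) (x u v : E) :
    curvForm θ a x u v = - curvForm θ a x v u := by
  simp only [curvForm, extD]; ring

/-- The covariant derivative of `J_a`, corrected by the connection forms `θ`. -/
def frameTorsion (g : E → E →L[ℝ] E →L[ℝ] ℝ)
    (θ : Fin 3 → E → E →L[ℝ] ℝ) (J : Fin 3 → E → E →L[ℝ] E) (a : Fin 3) (x u : E) : E →L[ℝ] E :=
  covDerivEnd g (J a) x u - (θ (a + 2) x u • J (a + 1) x - θ (a + 1) x u • J (a + 2) x)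

theorem covDerivEnd_mul (g : E → E →L[ℝ] E →L[ℝ] ℝ) {A B C : E → E →L[ℝ] E} {x : E}
    (hA : DifferentiableAt ℝ A x) (hB : DifferentiableAt ℝ B x)
    (hC : C =ᶠ[𝓝 x] fun y => A y * B y) (u : E) :
    covDerivEnd g C x u = covDerivEnd g A x u * B x + A x * covDerivEnd g B x u := by
  have h : fderiv ℝ C x u = A x * fderiv ℝ B x u + fderiv ℝ A x u * B x := by
    rw [hC.fderiv_eq]
    have := (hA.hasFDerivAt.clm_comp hB.hasFDerivAt).fderiv
    rw [show (fun y => A y * B y) = fun y => (A y).comp (B y) from rfl, this]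
    ext w; simp
  simp only [covDerivEnd, h, hC.eq_of_nhds]
  simp only [← ContinuousLinearMap.mul_def]
  noncomm_ring

theorem covDerivEnd_neg (g : E → E →L[ℝ] E →L[ℝ] ℝ) {A C : E → E →L[ℝ] E} {x : E}
    (hC : C =ᶠ[𝓝 x] fun y => - A y) (u : E) :
    covDerivEnd g C x u = - covDerivEnd g A x u := by
  have h : fderiv ℝ C x u = - fderiv ℝ A x u := by
    rw [hC.fderiv_eq, show (fun y => - A y) = -A from rfl, fderiv_neg]; rfl
  simp only [covDerivEnd, h, hC.eq_of_nhds]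
  simp only [← ContinuousLinearMap.mul_def]
  noncomm_ring

theorem covDerivEnd_neg_one (g : E → E →L[ℝ] E →L[ℝ] ℝ) (x u : E) :
    covDerivEnd g (fun _ => -1) x u = 0 := by
  simp only [covDerivEnd]
  rw [fderiv_const_apply]
  simp only [← ContinuousLinearMap.mul_def]
  simp

/-- The curvature tensor as an endomorphism. -/
def riemannEnd (g : E → E →L[ℝ] E →L[ℝ] ℝ) (x u v : E) : E →L[ℝ] E :=
  fderiv ℝ (christoffel g) x u v - fderiv ℝ (christoffel g) x v u
    + christoffel g x u * christoffel g x v - christoffel g x v * christoffel g x u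

theorem riemannEnd_apply (g : E → E →L[ℝ] E →L[ℝ] ℝ) (x u v w : E) :
    riemannEnd g x u v w = riemannCurvature g x u v w := by
  simp [riemannEnd, riemannCurvature]

namespace IsQuaternionicFrame

variable {Ω : Set E} {g : E → E →L[ℝ] E →L[ℝ] ℝ} {θ : Fin 3 → E → E →L[ℝ] ℝ}
  {J : Fin 3 → E → E →L[ℝ] E} {ν : ℝ}

theorem mul_succ (H : IsQuaternionicFrame Ω g θ J ν) {x : E} (hx : x ∈ Ω) (a : Fin 3) :
    J a x * J (a + 1) x = J (a + 2) x :=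
  quaternion_cyclic (J := fun a => J a x) (H.sq x hx) (H.mul x hx) a

theorem succ_mul (H : IsQuaternionicFrame Ω g θ J ν) {x : E} (hx : x ∈ Ω) (a : Fin 3) :
    J (a + 1) x * J a x = - J (a + 2) x :=
  quaternion_cyclic' (J := fun a => J a x) (H.sq x hx) (H.mul x hx) a

/-- Curvature forms are alternating, so skewness need not be part of the structure. -/
theorem skew (H : IsQuaternionicFrame Ω g θ J ν) {x : E} (hx : x ∈ Ω) (a : Fin 3) (u v : E) :
    g x (J a x u) v = - g x u (J a x v) := by
  have h1 := H.curv x hx a u v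
  have h2 := H.curv x hx a v u
  rw [curvForm_antisymm, ← h2, H.metric.symm x hx (J a x v)] at h1
  apply mul_left_cancel₀ H.ne_zero
  rw [h1]; ring

theorem differentiableAt_form (H : IsQuaternionicFrame Ω g θ J ν) {x : E} (hx : x ∈ Ω)
    (a : Fin 3) : DifferentiableAt ℝ (θ a) x :=
  ((H.smooth a).contDiffAt (H.isOpen.mem_nhds hx)).differentiableAt (by simp)

theorem differentiableAt_fderiv_form (H : IsQuaternionicFrame Ω g θ J ν) {x : E} (hx : x ∈ Ω)
    (a : Fin 3) : DifferentiableAt ℝ (fderiv ℝ (θ a)) x :=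
  (((H.smooth a).fderiv_of_isOpen H.isOpen (m := ∞) (by simp)).contDiffAt
      (H.isOpen.mem_nhds hx)).differentiableAt (by simp)

theorem fderiv_curvForm (H : IsQuaternionicFrame Ω g θ J ν) {x : E} (hx : x ∈ Ω)
    (a : Fin 3) (w u v : E) :
    fderiv ℝ (fun y => curvForm θ a y u v) x w =
      fderiv ℝ (fderiv ℝ (θ a)) x w u v - fderiv ℝ (fderiv ℝ (θ a)) x w v u
      + (fderiv ℝ (θ (a + 1)) x w u * θ (a + 2) x v + θ (a + 1) x u * fderiv ℝ (θ (a + 2)) x w v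
        - (fderiv ℝ (θ (a + 1)) x w v * θ (a + 2) x u
          + θ (a + 1) x v * fderiv ℝ (θ (a + 2)) x w u)) := by
  have hd := H.differentiableAt_fderiv_form hx a
  have h1 : ∀ u, DifferentiableAt ℝ (fun y => fderiv ℝ (θ a) y u) x :=
    fun u => hd.clm_apply (differentiableAt_const u)
  have h2 : ∀ u v, DifferentiableAt ℝ (fun y => fderiv ℝ (θ a) y u v) x :=
    fun u v => (h1 u).clm_apply (differentiableAt_const v)
  have h3 : ∀ b u, DifferentiableAt ℝ (fun y => θ b y u) x :=
    fun b u => (H.differentiableAt_form hx b).clm_apply (differentiableAt_const u)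
  simp only [curvForm, extD]
  rw [fderiv_fun_add ((h2 u v).fun_sub (h2 v u)) (((h3 _ _).fun_mul (h3 _ _)).fun_sub ((h3 _ _).fun_mul (h3 _ _))),
    fderiv_fun_sub (h2 u v) (h2 v u), fderiv_fun_sub ((h3 _ _).fun_mul (h3 _ _)) ((h3 _ _).fun_mul (h3 _ _)),
    fderiv_fun_mul (h3 _ _) (h3 _ _), fderiv_fun_mul (h3 _ _) (h3 _ _)]
  simp only [add_apply, sub_apply, smul_apply, smul_eq_mul]
  rw [fderiv_clm_const_apply (h1 u), fderiv_clm_const_apply hd,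
    fderiv_clm_const_apply (h1 v), fderiv_clm_const_apply hd]
  simp only [fderiv_clm_const_apply (H.differentiableAt_form hx _)]
  ring

variable [FiniteDimensional ℝ E]

/-- J_a is ν⁻¹ g⁻¹ applied to a smooth two-form. Because smoothness is automatic, J may later be
chosen point by point. -/
theorem contDiffOn (H : IsQuaternionicFrame Ω g θ J ν) (a : Fin 3) : ContDiffOn ℝ ∞ (J a) Ω := by
  have hd : ContDiffOn ℝ ∞ (fderiv ℝ (θ a)) Ω := (H.smooth a).fderiv_of_isOpen H.isOpen (by simp)
  have hflip : ContDiffOn ℝ ∞ (fun x => (fderiv ℝ (θ a) x).flip) Ω :=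
    (ContinuousLinearMap.flipₗᵢ ℝ E E ℝ).contDiff.comp_contDiffOn hd
  have hw : ∀ b c, ContDiffOn ℝ ∞ (fun x => (θ b x).smulRight (θ c x)) Ω := fun b c =>
    (ContinuousLinearMap.smulRightL ℝ E (E →L[ℝ] ℝ)).isBoundedBilinearMap.contDiff.comp₂_contDiffOn
      (H.smooth b) (H.smooth c)
  have hB := ((hd.sub hflip).add ((hw (a + 1) (a + 2)).sub (hw (a + 2) (a + 1))))
  have hJ := (contDiffOn_const (c := ν⁻¹)).smul ((contDiffOn_inverse H.metric).clm_comp hB)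
  refine hJ.congr fun x hx => ?_
  ext u
  apply eq_of_metric H.metric hx
  intro v
  have h1 := H.curv x hx a u v
  simp only [Pi.smul_apply', smul_apply, ContinuousLinearMap.coe_comp, Function.comp_apply, map_smul,
    (H.metric.isInvertible hx).self_apply_inverse]
  apply mul_left_cancel₀ H.ne_zero
  rw [h1, smul_eq_mul, mul_inv_cancel_left₀ H.ne_zero]
  simp [curvForm, extD, mul_comm]

theorem differentiableAt (H : IsQuaternionicFrame Ω g θ J ν) {x : E} (hx : x ∈ Ω)
    (a : Fin 3) : DifferentiableAt ℝ (J a) x :=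
  ((H.contDiffOn a).contDiffAt (H.isOpen.mem_nhds hx)).differentiableAt (by simp)

theorem metric_fderiv (H : IsQuaternionicFrame Ω g θ J ν) {x : E} (hx : x ∈ Ω)
    (a : Fin 3) (w u v : E) :
    ν * (fderiv ℝ g x w (J a x u) v + g x (fderiv ℝ (J a) x w u) v) =
      fderiv ℝ (fun y => curvForm θ a y u v) x w := by
  have hg := H.metric.differentiableAt H.isOpen hx
  have hJu : DifferentiableAt ℝ (fun y => J a y u) x :=
    (H.differentiableAt hx a).clm_apply (differentiableAt_const u)
  have h1 : DifferentiableAt ℝ (fun y => g y (J a y u)) x := hg.clm_apply hJu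
  have hev : (fun y => curvForm θ a y u v) =ᶠ[𝓝 x] fun y => ν * g y (J a y u) v := by
    filter_upwards [H.isOpen.mem_nhds hx] with y hy using (H.curv y hy a u v).symm
  rw [hev.fderiv_eq, fderiv_const_mul (h1.clm_apply (differentiableAt_const v)), smul_apply,
    fderiv_clm_const_apply h1, fderiv_clm_apply_apply hg hJu,
    fderiv_clm_const_apply (H.differentiableAt hx a), smul_eq_mul, add_apply]

/-- Since ν g(J_a ·, ·) is a curvature form, ∇J_a turns into the covariant derivative of that form,
with θ acting on the index a as an so(3)-connection. -/
theorem metric_torsion (H : IsQuaternionicFrame Ω g θ J ν) {x : E} (hx : x ∈ Ω)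
    (a : Fin 3) (u v w : E) : ν * g x (frameTorsion g θ J a x u v) w =
      fderiv ℝ (fun y => curvForm θ a y v w) x u - curvForm θ a x v (christoffel g x u w)
        - curvForm θ a x (christoffel g x u v) w
        - (θ (a + 2) x u * curvForm θ (a + 1) x v w
          - θ (a + 1) x u * curvForm θ (a + 2) x v w) := by
  rw [← H.metric_fderiv hx a, ← H.curv x hx, ← H.curv x hx, ← H.curv x hx, ← H.curv x hx,
    christoffel_metric H.isOpen H.metric hx]
  simp only [frameTorsion, covDerivEnd, add_apply, sub_apply, smul_apply, map_add, map_sub,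
    map_smul, smul_eq_mul, ContinuousLinearMap.coe_comp, Function.comp_apply]
  ring

/-- This is the Bianchi identity for the curvature of θ: ddθ_a = 0, the terms quadratic and cubic in
θ cancel against the correction, and the Christoffel terms drop out because Γ is symmetric. -/
theorem torsion_cyclic (H : IsQuaternionicFrame Ω g θ J ν) {x : E} (hx : x ∈ Ω)
    (a : Fin 3) (u v w : E) :
    g x (frameTorsion g θ J a x u v) w + g x (frameTorsion g θ J a x v w) u
      + g x (frameTorsion g θ J a x w u) v = 0 := by
  apply mul_left_cancel₀ H.ne_zero
  rw [mul_add, mul_add, H.metric_torsion hx, H.metric_torsion hx, H.metric_torsion hx,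
    H.fderiv_curvForm hx, H.fderiv_curvForm hx,
    H.fderiv_curvForm hx, christoffel_symm H.isOpen H.metric hx w u,
    christoffel_symm H.isOpen H.metric hx w v, christoffel_symm H.isOpen H.metric hx v u,
    curvForm_antisymm θ a x w, curvForm_antisymm θ a x u, curvForm_antisymm θ a x v,
    second_fderiv_symm H.isOpen (H.smooth a) hx v u, second_fderiv_symm H.isOpen (H.smooth a) hx w u,
    second_fderiv_symm H.isOpen (H.smooth a) hx w v]
  simp only [curvForm, extD, fin3_add11, fin3_add12, fin3_add21, fin3_add22]
  ring

theorem torsion_skew (H : IsQuaternionicFrame Ω g θ J ν) {x : E} (hx : x ∈ Ω)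
    (a : Fin 3) (u v w : E) :
    g x (frameTorsion g θ J a x u v) w = - g x v (frameTorsion g θ J a x u w) := by
  rw [H.metric.symm x hx v]
  apply mul_left_cancel₀ H.ne_zero
  rw [mul_neg, H.metric_torsion hx, H.metric_torsion hx, H.fderiv_curvForm hx,
    H.fderiv_curvForm hx, curvForm_antisymm θ a x v, curvForm_antisymm θ a x _ w,
    curvForm_antisymm θ (a + 1) x v w, curvForm_antisymm θ (a + 2) x v w]
  ring

/-- Differentiate J_a² = -1. The θ-correction lies in the span of J_{a+1} and J_{a+2}, which
anticommute with J_a. -/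
theorem torsion_anticomm (H : IsQuaternionicFrame Ω g θ J ν) {x : E} (hx : x ∈ Ω)
    (a : Fin 3) (u : E) :
    frameTorsion g θ J a x u * J a x = - (J a x * frameTorsion g θ J a x u) := by
  have h := covDerivEnd_mul g (H.differentiableAt hx a) (H.differentiableAt hx a)
    (C := fun _ => -1)
    (by filter_upwards [H.isOpen.mem_nhds hx] with y hy using (H.sq y hy a).symm) u
  rw [covDerivEnd_neg_one] at h
  have e1 := H.mul_succ hx a
  have e2 := H.succ_mul hx a
  have e3 := H.mul_succ hx (a + 2)
  have e4 := H.succ_mul hx (a + 2)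
  rw [fin3_add21, fin3_add22] at e3 e4
  have h' := eq_neg_of_add_eq_zero_left h.symm
  simp only [frameTorsion, sub_mul, mul_sub, smul_mul_assoc, mul_smul_comm, e1, e2, e3, e4, h',
    smul_neg]
  abel

/-- Differentiate J_{a+2} = -J_{a+1}J_a. The θ-correction is itself a derivation of the quaternions,
so it obeys the same product rule. -/
theorem torsion_add_two (H : IsQuaternionicFrame Ω g θ J ν) {x : E} (hx : x ∈ Ω)
    (a : Fin 3) (u : E) :
    frameTorsion g θ J (a + 2) x u =
      - (frameTorsion g θ J (a + 1) x u * J a x) - J (a + 1) x * frameTorsion g θ J a x u := by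
  have h := covDerivEnd_mul g (H.differentiableAt hx (a + 1)) (H.differentiableAt hx a)
    (C := fun y => J (a + 1) y * J a y) Filter.EventuallyEq.rfl u
  have h2 := covDerivEnd_neg g (A := fun y => J (a + 1) y * J a y) (C := J (a + 2)) (x := x)
    (by filter_upwards [H.isOpen.mem_nhds hx] with y hy using by rw [H.succ_mul hy, neg_neg]) u
  rw [h] at h2
  have e3 := H.mul_succ hx (a + 2)
  have e5 := H.mul_succ hx (a + 1)
  rw [fin3_add21, fin3_add22] at e3
  rw [fin3_add11, fin3_add12] at e5
  simp only [frameTorsion, sub_mul, mul_sub, smul_mul_assoc, mul_smul_comm, h2, e3, e5, H.sq x hx,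
    smul_neg, fin3_add11, fin3_add12, fin3_add21, fin3_add22]
  abel

theorem torsion_eq_zero (H : IsQuaternionicFrame Ω g θ J ν) {x : E} (hx : x ∈ Ω)
    (a : Fin 3) (u : E) : frameTorsion g θ J a x u = 0 := by
  ext v
  apply eq_of_metric H.metric hx
  intro w
  have ap : ∀ {A B : E →L[ℝ] E}, A = B → ∀ v, A v = B v := fun h v => by rw [h]
  rw [quaternionic_torsion_zero (g x) (J a x) (J (a + 1) x) (J (a + 2) x)
    (frameTorsion g θ J a x) (frameTorsion g θ J (a + 1) x) (frameTorsion g θ J (a + 2) x)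
    (H.metric.symm x hx) (ap (H.sq x hx a)) (ap (H.sq x hx (a + 2))) (ap (H.succ_mul hx a))
    (ap (H.mul_succ hx a)) (H.skew hx a) (H.skew hx (a + 2)) (H.torsion_skew hx a)
    (H.torsion_skew hx _) (H.torsion_skew hx _) (fun u => ap (H.torsion_anticomm hx a u))
    (fun u => ap (H.torsion_add_two hx a u)) (H.torsion_cyclic hx a) (H.torsion_cyclic hx _)
    (H.torsion_cyclic hx _) u v w]
  simp

theorem covDeriv_eq (H : IsQuaternionicFrame Ω g θ J ν) {x : E} (hx : x ∈ Ω)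
    (a : Fin 3) (u : E) : covDerivEnd g (J a) x u
      = θ (a + 2) x u • J (a + 1) x - θ (a + 1) x u • J (a + 2) x :=
  sub_eq_zero.1 (H.torsion_eq_zero hx a u)

theorem isParallelQuaternionicStructure (H : IsQuaternionicFrame Ω g θ J ν) :
    IsParallelQuaternionicStructure Ω g fun y => Submodule.span ℝ (Set.range fun a => J a y) := by
  intro x hx
  refine ⟨Ω, H.isOpen, hx, subset_rfl, J, H.contDiffOn, fun y hy =>
    ⟨H.sq y hy, H.mul y hy, H.skew hy, rfl, fun a v => ?_⟩⟩
  rw [H.covDeriv_eq hy]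
  exact sub_mem (Submodule.smul_mem _ _ (Submodule.subset_span ⟨_, rfl⟩))
    (Submodule.smul_mem _ _ (Submodule.subset_span ⟨_, rfl⟩))

/-- Equate the two orders of differentiating J_a twice and insert `covDeriv_eq` for each first
derivative. The Christoffel terms assemble into [R, J_a] and the θ-terms into curvature forms. -/
theorem riemann_commutator (H : IsQuaternionicFrame Ω g θ J ν) {x : E} (hx : x ∈ Ω)
    (a : Fin 3) (u v : E) :
    riemannEnd g x u v * J a x - J a x * riemannEnd g x u v =
      curvForm θ (a + 2) x u v • J (a + 1) x - curvForm θ (a + 1) x u v • J (a + 2) x := by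
  have hΓ : DifferentiableAt ℝ (christoffel g) x :=
    ((contDiffOn_christoffel H.isOpen H.metric).contDiffAt
      (H.isOpen.mem_nhds hx)).differentiableAt (by simp)
  have hD : ∀ b u, fderiv ℝ (J b) x u = J b x * christoffel g x u - christoffel g x u * J b x
      + (θ (b + 2) x u • J (b + 1) x - θ (b + 1) x u • J (b + 2) x) := by
    intro b u
    rw [← H.covDeriv_eq hx]
    simp only [covDerivEnd, ← ContinuousLinearMap.mul_def]
    abel
  have hdJ : DifferentiableAt ℝ (fderiv ℝ (J a)) x :=
    (((H.contDiffOn a).fderiv_of_isOpen H.isOpen (m := ∞) (by simp)).contDiffAt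
      (H.isOpen.mem_nhds hx)).differentiableAt (by simp)
  have key : ∀ u v, fderiv ℝ (fderiv ℝ (J a)) x v u =
      (fderiv ℝ (J a) x v * christoffel g x u + J a x * fderiv ℝ (christoffel g) x v u)
      - (fderiv ℝ (christoffel g) x v u * J a x + christoffel g x u * fderiv ℝ (J a) x v)
      + ((fderiv ℝ (θ (a + 2)) x v u • J (a + 1) x + θ (a + 2) x u • fderiv ℝ (J (a + 1)) x v)
        - (fderiv ℝ (θ (a + 1)) x v u • J (a + 2) x
          + θ (a + 1) x u • fderiv ℝ (J (a + 2)) x v)) := by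
    intro u v
    have hev : (fun y => fderiv ℝ (J a) y u) =ᶠ[𝓝 x] fun y =>
        ((J a y).comp (christoffel g y u) - (christoffel g y u).comp (J a y))
        + (θ (a + 2) y u • J (a + 1) y - θ (a + 1) y u • J (a + 2) y) := by
      filter_upwards [H.isOpen.mem_nhds hx] with y hy
      rw [← H.covDeriv_eq hy]
      simp only [covDerivEnd]
      abel
    have hΓu : DifferentiableAt ℝ (fun y => christoffel g y u) x :=
      hΓ.clm_apply (differentiableAt_const u)
    have hJ := fun b => (H.differentiableAt hx b).hasFDerivAt
    have hθ : ∀ b, DifferentiableAt ℝ (fun y => θ b y u) x :=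
      fun b => (H.differentiableAt_form hx b).clm_apply (differentiableAt_const u)
    have hd := (((hJ a).clm_comp hΓu.hasFDerivAt).fun_sub (hΓu.hasFDerivAt.clm_comp (hJ a))).fun_add
      (((hθ (a + 2)).hasFDerivAt.fun_smul (hJ (a + 1))).fun_sub
        ((hθ (a + 1)).hasFDerivAt.fun_smul (hJ (a + 2))))
    rw [← fderiv_clm_const_apply hdJ u v, hev.fderiv_eq, hd.fderiv]
    ext w
    simp [fderiv_clm_const_apply hΓ, fderiv_clm_const_apply (H.differentiableAt_form hx _)]
    abel
  have k := key u v
  rw [second_fderiv_symm H.isOpen (H.contDiffOn a) hx, key v u] at k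
  simp only [hD, fin3_add11, fin3_add12, fin3_add21, fin3_add22, mul_add, mul_sub, add_mul,
    sub_mul, smul_mul_assoc, mul_smul_comm, smul_add, smul_sub, smul_smul, mul_assoc] at k
  simp only [riemannEnd, curvForm, extD, mul_add, mul_sub, add_mul, sub_mul, mul_assoc,
    fin3_add11, fin3_add12, fin3_add21, fin3_add22]
  rw [← sub_eq_zero] at k ⊢
  apply neg_injective
  rw [neg_zero, ← k]
  module

end IsQuaternionicFrame

end QuaternionicFrame

/-! ### The Einstein condition and the scalar curvature -/

section QuaternionicRicci

variable {E : Type*} [NormedAddCommGroup E] [NormedSpace ℝ E]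

/-- The endomorphism `u ↦ R(u,v)w`, whose trace is the Ricci tensor. -/
def riemannLeft (g : E → E →L[ℝ] E →L[ℝ] ℝ) (x v w : E) : E →ₗ[ℝ] E where
  toFun u := riemannCurvature g x u v w
  map_add' a b := by simp only [riemannCurvature, map_add, add_apply]; abel
  map_smul' r a := by
    simp only [riemannCurvature, map_smul, smul_apply, RingHom.id_apply, smul_sub, smul_add]

theorem riemannLeft_apply (g : E → E →L[ℝ] E →L[ℝ] ℝ) (x v w u : E) :
    riemannLeft g x v w u = riemannCurvature g x u v w := rfl

variable [FiniteDimensional ℝ E]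

theorem ricciCurvature_eq_trace (g : E → E →L[ℝ] E →L[ℝ] ℝ) (x v w : E) :
    ricciCurvature g x v w = LinearMap.trace ℝ E (riemannLeft g x v w) := by
  rw [LinearMap.trace_eq_matrix_trace ℝ (Module.finBasis ℝ E), Matrix.trace]
  simp [ricciCurvature, LinearMap.toMatrix_apply, riemannLeft_apply]

/-- Conjugating A by g, seen as an isomorphism onto the dual space, gives the transpose of B. -/
theorem trace_eq_of_adjoint {Ω : Set E} {g : E → E →L[ℝ] E →L[ℝ] ℝ}
    (hg : IsRiemannianMetricOn Ω g) {x : E} (hx : x ∈ Ω) (A B : E →ₗ[ℝ] E)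
    (h : ∀ u v, g x (A u) v = g x u (B v)) : LinearMap.trace ℝ E A = LinearMap.trace ℝ E B := by
  obtain ⟨e, he⟩ := hg.isInvertible hx
  let G : E ≃ₗ[ℝ] Module.Dual ℝ E :=
    e.toLinearEquiv.trans (LinearMap.toContinuousLinearMap (𝕜 := ℝ) (E := E) (F' := ℝ)).symm
  have hG : ∀ u v, G u v = g x u v := by
    intro u v
    rw [← he]; rfl
  rw [← LinearMap.trace_transpose' B, ← LinearMap.trace_conj' A G]
  congr 1
  ext φ v
  obtain ⟨u, rfl⟩ := G.surjective φ
  simp [LinearEquiv.conj_apply, hG, h, Module.Dual.transpose_apply]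

namespace IsQuaternionicFrame

variable {Ω : Set E} {g : E → E →L[ℝ] E →L[ℝ] ℝ} {θ : Fin 3 → E → E →L[ℝ] ℝ}
  {J : Fin 3 → E → E →L[ℝ] E} {ν : ℝ}

theorem trace_eq_zero (H : IsQuaternionicFrame Ω g θ J ν) {x : E} (hx : x ∈ Ω) (a : Fin 3) :
    LinearMap.trace ℝ E (J a x : E →ₗ[ℝ] E) = 0 := by
  have := trace_eq_of_adjoint H.metric hx (J a x : E →ₗ[ℝ] E) (-(J a x : E →ₗ[ℝ] E))
    (fun u v => by simp [H.skew hx])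
  rw [map_neg] at this
  linarith

/-- Multiply [R, J_{a+1}] by J_{a+2} and take traces. Cyclicity makes one side 2 tr(J_a R); on the
other side J_{a+1} is traceless and only a multiple of the identity contributes. -/
theorem two_mul_trace (H : IsQuaternionicFrame Ω g θ J ν) {x : E} (hx : x ∈ Ω) (a : Fin 3)
    (v w : E) :
    2 * LinearMap.trace ℝ E ((J a x * riemannEnd g x v w : E →L[ℝ] E) : E →ₗ[ℝ] E) =
      - (Module.finrank ℝ E) * curvForm θ a x v w := by
  set R := riemannEnd g x v w
  let tr : (E →L[ℝ] E) →ₗ[ℝ] ℝ := LinearMap.trace ℝ E ∘ₗ ContinuousLinearMap.coeLM ℝ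
  have htr : ∀ A B : E →L[ℝ] E, tr (A * B) = tr (B * A) := fun A B =>
    LinearMap.trace_mul_comm ℝ (A : E →ₗ[ℝ] E) (B : E →ₗ[ℝ] E)
  have hJ : ∀ b, tr (J b x) = 0 := H.trace_eq_zero hx
  have h1 : tr 1 = Module.finrank ℝ E := LinearMap.trace_one ℝ E
  change 2 * tr (J a x * R) = _
  have c := H.riemann_commutator hx (a + 1) v w
  rw [fin3_add12, fin3_add11] at c
  have e1 := H.succ_mul hx a
  have e2 := H.mul_succ hx (a + 2)
  have e3 := H.mul_succ hx (a + 1)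
  rw [fin3_add21, fin3_add22] at e2
  rw [fin3_add11, fin3_add12] at e3
  have k1 : J (a + 2) x * (R * J (a + 1) x - J (a + 1) x * R)
      = - (curvForm θ a x v w • 1) - curvForm θ (a + 2) x v w • J (a + 1) x := by
    rw [c, mul_sub, mul_smul_comm, mul_smul_comm, H.sq x hx, e2, smul_neg]
  have k2 : tr (J (a + 2) x * (R * J (a + 1) x - J (a + 1) x * R)) = 2 * tr (J a x * R) := by
    have s1 : J (a + 2) x * J (a + 1) x = - J a x := by
      have := H.succ_mul hx (a + 1); rwa [fin3_add11, fin3_add12] at this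
    rw [mul_sub, map_sub, ← mul_assoc, htr, ← mul_assoc, e3, ← mul_assoc, s1, neg_mul, map_neg]
    ring
  rw [← k2, k1, map_sub, map_neg, map_smul, map_smul, hJ, h1]
  simp; ring

/-- A quaternionic frame is Einstein. -/
theorem ricci_eq (H : IsQuaternionicFrame Ω g θ J ν) {x : E} (hx : x ∈ Ω) (v w : E) :
    ricciCurvature g x v w = - (Module.finrank ℝ E / 4 + 2) * ν * g x v w := by
  rw [ricciCurvature_eq_trace]
  set J1 := J 0 x with hJ1
  have hsq : ∀ u, J1 (J1 u) = -u := fun u => by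
    have := H.sq x hx 0
    exact congrArg (fun A : E →L[ℝ] E => A u) this
  have comm : ∀ u v w, riemannCurvature g x u v (J1 w) = J1 (riemannCurvature g x u v w)
      + curvForm θ 2 x u v • J 1 x w - curvForm θ 1 x u v • J 2 x w := by
    intro u v w
    have := congrArg (fun A : E →L[ℝ] E => A w) (H.riemann_commutator hx 0 u v)
    simp only [sub_apply, mul_apply_eq_comp, riemannEnd_apply, smul_apply, zero_add]
      at this
    rw [sub_eq_iff_eq_add] at this
    rw [hJ1, this]; abel
  have m12 : ∀ u, J1 (J 1 x u) = J 2 x u := fun u =>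
    congrArg (fun A : E →L[ℝ] E => A u) (H.mul x hx)
  have m13 : ∀ u, J1 (J 2 x u) = - J 1 x u := fun u => by rw [← m12, hsq]
  have sq1 : ∀ u, J 1 x (J 1 x u) = -u := fun u =>
    congrArg (fun A : E →L[ℝ] E => A u) (H.sq x hx 1)
  have sq2 : ∀ u, J 2 x (J 2 x u) = -u := fun u =>
    congrArg (fun A : E →L[ℝ] E => A u) (H.sq x hx 2)
  -- `J₁ ∘ (u ↦ R(u,v)J₁w)`
  have t1 : LinearMap.trace ℝ E ((J1 : E →ₗ[ℝ] E) * riemannLeft g x v (J1 w)) =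
      - LinearMap.trace ℝ E (riemannLeft g x v w) - 2 * ν * g x v w := by
    let f : Fin 3 → E →ₗ[ℝ] ℝ := fun a => ν • (((g x).flip v ∘L J a x : E →L[ℝ] ℝ) : E →ₗ[ℝ] ℝ)
    have hf : ∀ a u, f a u = curvForm θ a x u v := fun a u => by
      rw [← H.curv x hx]; simp [f]
    have : (J1 : E →ₗ[ℝ] E) * riemannLeft g x v (J1 w) =
        - riemannLeft g x v w + ((f 2).smulRight (J 2 x w) + (f 1).smulRight (J 1 x w)) := by
      ext u
      simp only [Module.End.mul_apply, riemannLeft_apply, comm, LinearMap.add_apply,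
        LinearMap.neg_apply, LinearMap.smulRight_apply, hf, ContinuousLinearMap.coe_coe,
        map_add, map_sub, map_smul, hsq, m12, m13]
      module
    rw [this, map_add, map_add, map_neg, LinearMap.trace_smulRight, LinearMap.trace_smulRight,
      hf, hf, ← H.curv x hx, ← H.curv x hx, sq1, sq2, H.metric.symm x hx v w]
    simp; ring
  -- After a cyclic reordering of the trace, pair symmetry exhibits the two maps as adjoint to each
  -- other up to sign.
  have t2 : LinearMap.trace ℝ E ((J1 : E →ₗ[ℝ] E) * riemannLeft g x (J1 w) v) =
      - LinearMap.trace ℝ E ((J1 : E →ₗ[ℝ] E) * riemannLeft g x v (J1 w)) := by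
    rw [LinearMap.trace_mul_comm ℝ (J1 : E →ₗ[ℝ] E) (riemannLeft g x v (J1 w)), ← map_neg]
    apply trace_eq_of_adjoint H.metric hx
    intro u z
    simp only [Module.End.mul_apply, riemannLeft_apply, LinearMap.neg_apply,
      ContinuousLinearMap.coe_coe]
    rw [H.skew hx, riemann_pair H.isOpen H.metric hx, riemann_antisymm,
      H.metric.symm x hx u]
    have := riemann_skew H.isOpen H.metric hx (J1 z) v u (J1 w)
    rw [H.metric.symm x hx u] at this
    simp only [map_neg, neg_apply]
    linarith
  have t3 := H.two_mul_trace hx 0 v (J1 w)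
  -- By the first Bianchi identity J₁R(v, J₁w) is the difference of the two maps just traced, so its
  -- trace is 2 Ric(v, w) + 4ν g(v, w). Comparing with `t3`, where the curvature form on (v, J₁w) is
  -- ν g(v, w), gives the Einstein constant.
  have t4 : ((J 0 x * riemannEnd g x v (J1 w) : E →L[ℝ] E) : E →ₗ[ℝ] E) =
      (J1 : E →ₗ[ℝ] E) * riemannLeft g x (J1 w) v
        - (J1 : E →ₗ[ℝ] E) * riemannLeft g x v (J1 w) := by
    rw [← mul_sub]
    ext u
    have b := riemann_bianchi H.isOpen H.metric hx v (J1 w) u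
    simp only [Module.End.mul_apply, ContinuousLinearMap.coe_coe, mul_apply_eq_comp,
      LinearMap.sub_apply, riemannLeft_apply, riemannEnd_apply]
    congr 1
    rw [riemann_antisymm g x (J1 w) u v] at b
    rw [← sub_eq_zero, ← b]
    abel
  rw [t4, map_sub, t2, t1, ← H.curv x hx, H.skew hx, hsq] at t3
  simp only [map_neg] at t3
  linarith

theorem scalarCurvature_eq (H : IsQuaternionicFrame Ω g θ J ν) {x : E} (hx : x ∈ Ω) :
    scalarCurvature g x =
      - (Module.finrank ℝ E / 4 + 2) * ν * Module.finrank ℝ E := by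
  set b := Module.finBasis ℝ E
  set G : Matrix _ _ ℝ := Matrix.of fun k l => g x (b k) (b l) with hG
  have hdet : IsUnit G.det := by
    rw [isUnit_iff_ne_zero]
    intro h0
    obtain ⟨v, hv0, hv⟩ := Matrix.exists_mulVec_eq_zero_iff.2 h0
    have hne : ∑ i, v i • b i ≠ 0 := by
      intro h
      exact hv0 (funext fun i => by
        have := Fintype.linearIndependent_iff.1 b.linearIndependent v h i; simpa using this)
    have := H.metric.pos x hx _ hne
    have e : g x (∑ i, v i • b i) (∑ i, v i • b i) = v ⬝ᵥ (G.mulVec v) := by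
      simp only [map_sum, map_smul, sum_apply, smul_apply, smul_eq_mul,
        dotProduct, Matrix.mulVec, hG, Matrix.of_apply, Finset.mul_sum]
      rw [Finset.sum_comm]
      refine Finset.sum_congr rfl fun i _ => Finset.sum_congr rfl fun j _ => ?_
      ring
    rw [e, hv] at this
    simp at this
  have key : scalarCurvature g x =
      - (Module.finrank ℝ E / 4 + 2) * ν * (G⁻¹ * G).trace := by
    simp only [scalarCurvature, H.ricci_eq hx, Matrix.trace, Matrix.diag, Matrix.mul_apply,
      Finset.mul_sum]
    refine Finset.sum_congr rfl fun i _ => Finset.sum_congr rfl fun j _ => ?_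
    rw [hG]
    simp only [Matrix.of_apply]
    rw [H.metric.symm x hx (b j) (b i)]
    ring
  rw [key, Matrix.nonsing_inv_mul G hdet, Matrix.trace_one, Fintype.card_fin]

theorem isQuaternionicKahler (H : IsQuaternionicFrame Ω g θ J ν) (hconn : IsConnected Ω)
    (hdim : 8 ≤ Module.finrank ℝ E) : IsQuaternionicKahler Ω g where
  isOpen := H.isOpen
  isConnected := hconn
  metric := H.metric
  eight_le_dim := hdim
  exists_quaternionic := ⟨_, H.isParallelQuaternionicStructure⟩
  scalar_ne_zero x hx := by
    rw [H.scalarCurvature_eq hx]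
    have hd : (0 : ℝ) < Module.finrank ℝ E := by exact_mod_cast (by omega)
    refine mul_ne_zero (mul_ne_zero (by linarith) H.ne_zero) hd.ne'

end IsQuaternionicFrame

end QuaternionicRicci

/-! ### Cubic polynomials as symmetric trilinear forms -/

section CubicForm

variable {n : ℕ}

/-- The commutator of two derivations is a derivation, and this one kills every variable. -/
theorem pderiv_pderiv_comm (h : MvPolynomial (Fin n) ℝ) (i j : Fin n) :
    MvPolynomial.pderiv i (MvPolynomial.pderiv j h)
      = MvPolynomial.pderiv j (MvPolynomial.pderiv i h) := by
  have : ⁅(MvPolynomial.pderiv i : Derivation ℝ (MvPolynomial (Fin n) ℝ) (MvPolynomial (Fin n) ℝ)),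
      (MvPolynomial.pderiv j : Derivation ℝ (MvPolynomial (Fin n) ℝ) (MvPolynomial (Fin n) ℝ))⁆ = 0 := by
    apply MvPolynomial.derivation_ext
    intro k
    simp only [Derivation.commutator_apply, MvPolynomial.pderiv_X, Derivation.zero_apply]
    rcases eq_or_ne k j with rfl | hkj <;> rcases eq_or_ne k i with rfl | hki <;>
      simp [*]
  have := congrArg (fun D => D h) this
  simpa [Derivation.commutator_apply, sub_eq_zero] using this

/-- The third derivatives of a cubic polynomial. -/
def cubicCoeff (h : MvPolynomial (Fin n) ℝ) (i j k : Fin n) : ℝ :=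
  MvPolynomial.coeff 0 (MvPolynomial.pderiv i (MvPolynomial.pderiv j (MvPolynomial.pderiv k h)))

theorem cubicCoeff_comm₁₂ (h : MvPolynomial (Fin n) ℝ) (i j k : Fin n) :
    cubicCoeff h i j k = cubicCoeff h j i k := by
  rw [cubicCoeff, pderiv_pderiv_comm, cubicCoeff]

theorem cubicCoeff_comm₂₃ (h : MvPolynomial (Fin n) ℝ) (i j k : Fin n) :
    cubicCoeff h i j k = cubicCoeff h i k j := by
  rw [cubicCoeff, pderiv_pderiv_comm h j k, cubicCoeff]

variable {A : Type*} [CommRing A] [Algebra ℝ A]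

/-- The symmetric trilinear form `∑ h_{ijk} x^i y^j z^k` of a cubic polynomial. -/
def tri (h : MvPolynomial (Fin n) ℝ) (x y z : Fin n → A) : A :=
  ∑ i, ∑ j, ∑ k, algebraMap ℝ A (cubicCoeff h i j k) * (x i * y j * z k)

variable (h : MvPolynomial (Fin n) ℝ)

theorem tri_comm₁₂ (x y z : Fin n → A) : tri h x y z = tri h y x z := by
  rw [tri, Finset.sum_comm]
  refine Finset.sum_congr rfl fun i _ => Finset.sum_congr rfl fun j _ =>
    Finset.sum_congr rfl fun k _ => ?_
  rw [cubicCoeff_comm₁₂, mul_comm (x j)]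

theorem tri_comm₂₃ (x y z : Fin n → A) : tri h x y z = tri h x z y := by
  simp only [tri]
  refine Finset.sum_congr rfl fun i _ => ?_
  rw [Finset.sum_comm]
  refine Finset.sum_congr rfl fun j _ => Finset.sum_congr rfl fun k _ => ?_
  rw [cubicCoeff_comm₂₃, mul_right_comm]

theorem tri_add₃ (x y z z' : Fin n → A) : tri h x y (z + z') = tri h x y z + tri h x y z' := by
  simp only [tri, ← Finset.sum_add_distrib, Pi.add_apply, mul_add]

theorem tri_smul₃ (x y z : Fin n → A) (a : A) : tri h x y (a • z) = a * tri h x y z := by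
  simp only [tri, Finset.mul_sum, Pi.smul_apply, smul_eq_mul]
  refine Finset.sum_congr rfl fun i _ => Finset.sum_congr rfl fun j _ =>
    Finset.sum_congr rfl fun k _ => ?_
  ring

theorem tri_add₂ (x y y' z : Fin n → A) : tri h x (y + y') z = tri h x y z + tri h x y' z := by
  rw [tri_comm₂₃, tri_add₃, tri_comm₂₃ h x z, tri_comm₂₃ h x z]

theorem tri_smul₂ (x y z : Fin n → A) (a : A) : tri h x (a • y) z = a * tri h x y z := by
  rw [tri_comm₂₃, tri_smul₃, tri_comm₂₃]

theorem tri_add₁ (x x' y z : Fin n → A) : tri h (x + x') y z = tri h x y z + tri h x' y z := by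
  rw [tri_comm₁₂, tri_add₂, tri_comm₁₂ h y, tri_comm₁₂ h y]

theorem tri_smul₁ (x y z : Fin n → A) (a : A) : tri h (a • x) y z = a * tri h x y z := by
  rw [tri_comm₁₂, tri_smul₂, tri_comm₁₂]

theorem tri_neg₃ (x y z : Fin n → A) : tri h x y (-z) = - tri h x y z := by
  rw [← neg_one_smul A, tri_smul₃, neg_one_mul]

theorem tri_neg₂ (x y z : Fin n → A) : tri h x (-y) z = - tri h x y z := by
  rw [← neg_one_smul A, tri_smul₂, neg_one_mul]

theorem tri_neg₁ (x y z : Fin n → A) : tri h (-x) y z = - tri h x y z := by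
  rw [← neg_one_smul A, tri_smul₁, neg_one_mul]

theorem tri_sub₃ (x y z z' : Fin n → A) : tri h x y (z - z') = tri h x y z - tri h x y z' := by
  rw [sub_eq_add_neg, tri_add₃, tri_neg₃, sub_eq_add_neg]

theorem tri_sub₂ (x y y' z : Fin n → A) : tri h x (y - y') z = tri h x y z - tri h x y' z := by
  rw [sub_eq_add_neg, tri_add₂, tri_neg₂, sub_eq_add_neg]

theorem tri_sub₁ (x x' y z : Fin n → A) : tri h (x - x') y z = tri h x y z - tri h x' y z := by
  rw [sub_eq_add_neg, tri_add₁, tri_neg₁, sub_eq_add_neg]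

theorem map_tri {B : Type*} [CommRing B] [Algebra ℝ B] (f : A →ₐ[ℝ] B) (x y z : Fin n → A) :
    f (tri h x y z) = tri h (fun i => f (x i)) (fun i => f (y i)) (fun i => f (z i)) := by
  simp [tri]

variable {h}

/-- Euler's formula for the linear polynomial h_{ij}, whose derivatives are constants. Two further
uses of Euler's formula reach the first derivatives and h itself. -/
theorem aeval_pderiv_pderiv (hh : h.IsHomogeneous 3) (x : Fin n → A) (i j : Fin n) :
    MvPolynomial.aeval x (MvPolynomial.pderiv i (MvPolynomial.pderiv j h))
      = tri h x (Pi.single i 1) (Pi.single j 1) := by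
  have h1 : (MvPolynomial.pderiv i (MvPolynomial.pderiv j h)).IsHomogeneous 1 :=
    (hh.pderiv (i := j)).pderiv (i := i)
  have e := h1.sum_X_mul_pderiv
  have h0 : ∀ k, MvPolynomial.pderiv k (MvPolynomial.pderiv i (MvPolynomial.pderiv j h))
      = MvPolynomial.C (cubicCoeff h k i j) := fun k => by
    have := h1.pderiv (i := k)
    rwa [← MvPolynomial.totalDegree_zero_iff_isHomogeneous,
      MvPolynomial.totalDegree_eq_zero_iff_eq_C] at this
  rw [one_smul] at e
  rw [← e]
  simp only [h0, map_sum, map_mul, MvPolynomial.aeval_X, MvPolynomial.aeval_C, tri]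
  refine Finset.sum_congr rfl fun k _ => ?_
  rw [Finset.sum_eq_single i (by intro b _ hb; simp [hb]) (by simp),
    Finset.sum_eq_single j (by intro b _ hb; simp [hb]) (by simp)]
  simp [mul_comm]

theorem sum_mul_tri_single₃ (x y v : Fin n → A) :
    ∑ i, v i * tri h x y (Pi.single i 1) = tri h x y v := by
  have : v = ∑ i, v i • (Pi.single i 1 : Fin n → A) := by
    ext j; simp [Finset.sum_apply, Pi.single_apply]
  conv_rhs => rw [this]
  rw [show tri h x y (∑ i, v i • (Pi.single i 1 : Fin n → A))
      = (AddMonoidHom.mk' (tri h x y) (tri_add₃ h x y)) (∑ i, v i • (Pi.single i 1 : Fin n → A))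
    from rfl, map_sum]
  simp [tri_smul₃]

theorem sum_mul_tri_single₂ (x y v : Fin n → A) :
    ∑ i, v i * tri h x (Pi.single i 1) y = tri h x v y := by
  simp only [tri_comm₂₃ h x _ y, sum_mul_tri_single₃]

theorem two_mul_aeval_pderiv (hh : h.IsHomogeneous 3) (x : Fin n → A) (j : Fin n) :
    2 * MvPolynomial.aeval x (MvPolynomial.pderiv j h) = tri h x x (Pi.single j 1) := by
  have h1 : (MvPolynomial.pderiv j h).IsHomogeneous 2 := hh.pderiv (i := j)
  have e := congrArg (MvPolynomial.aeval x) h1.sum_X_mul_pderiv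
  simp only [map_sum, map_mul, MvPolynomial.aeval_X, aeval_pderiv_pderiv hh,
    sum_mul_tri_single₂, nsmul_eq_mul, map_natCast] at e
  exact_mod_cast e.symm

theorem six_mul_aeval (hh : h.IsHomogeneous 3) (x : Fin n → A) :
    6 * MvPolynomial.aeval x h = tri h x x x := by
  have e := congrArg (MvPolynomial.aeval x) hh.sum_X_mul_pderiv
  simp only [map_sum, map_mul, MvPolynomial.aeval_X, nsmul_eq_mul, map_natCast] at e
  have e2 : ∑ i, x i * (2 * MvPolynomial.aeval x (MvPolynomial.pderiv i h)) = tri h x x x := by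
    simp only [two_mul_aeval_pderiv hh, sum_mul_tri_single₃]
  rw [← e2]
  calc _ = 2 * ((3 : ℕ) * MvPolynomial.aeval x h) := by push_cast; ring
    _ = _ := by
      rw [← e, Finset.mul_sum]
      exact Finset.sum_congr rfl fun i _ => by ring

theorem eval_eq_tri (hh : h.IsHomogeneous 3) (x : Fin n → ℝ) :
    MvPolynomial.eval x h = tri h x x x / 6 := by
  have := six_mul_aeval hh x
  rw [← MvPolynomial.coe_aeval_eq_eval]
  exact (eq_div_iff (by norm_num)).2 (by rw [mul_comm]; exact this)

theorem dPoly_eq_tri (hh : h.IsHomogeneous 3) (x v : Fin n → ℝ) :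
    dPoly h x v = tri h x x v / 2 := by
  rw [eq_div_iff (by norm_num), dPoly, ← sum_mul_tri_single₃, Finset.sum_mul]
  refine Finset.sum_congr rfl fun i _ => ?_
  rw [← two_mul_aeval_pderiv hh, ← MvPolynomial.coe_aeval_eq_eval]
  simp only [RingHom.coe_coe]
  ring

theorem psrMetric_apply (hh : h.IsHomogeneous 3) (x u v : Fin n → ℝ) :
    psrMetric h x u v = - tri h x u v := by
  simp only [psrMetric, neg_apply, sum_apply, smul_apply, tensorForm,
    ContinuousLinearMap.smulRight_apply, ContinuousLinearMap.proj_apply, smul_eq_mul]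
  congr 1
  rw [← sum_mul_tri_single₂]
  refine Finset.sum_congr rfl fun i _ => ?_
  rw [← sum_mul_tri_single₃, Finset.mul_sum]
  refine Finset.sum_congr rfl fun j _ => ?_
  rw [← aeval_pderiv_pderiv hh, ← MvPolynomial.coe_aeval_eq_eval]
  simp only [RingHom.coe_coe]
  ring

theorem contDiffOn_tri {𝕜 : Type*} [RCLike 𝕜] {E : Type*}
    [NormedAddCommGroup E] [NormedSpace ℝ E] {f g k : E → Fin n → 𝕜} {s : Set E} {m : ℕ∞ω}
    (hf : ContDiffOn ℝ m f s) (hg : ContDiffOn ℝ m g s) (hk : ContDiffOn ℝ m k s) :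
    ContDiffOn ℝ m (fun p => tri h (f p) (g p) (k p)) s := by
  unfold tri
  refine ContDiffOn.sum fun i _ => ContDiffOn.sum fun j _ => ContDiffOn.sum fun l _ => ?_
  exact contDiffOn_const.mul (((contDiffOn_pi.1 hf i).mul (contDiffOn_pi.1 hg j)).mul
    (contDiffOn_pi.1 hk l))

theorem hasDerivAt_tri {𝕜 B : Type*} [NontriviallyNormedField 𝕜] [NormedCommRing B]
    [NormedAlgebra 𝕜 B] [Algebra ℝ B] {x y z : 𝕜 → Fin n → B} {x' y' z' : Fin n → B} {t : 𝕜}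
    (hx : HasDerivAt x x' t) (hy : HasDerivAt y y' t) (hz : HasDerivAt z z' t) :
    HasDerivAt (fun s => tri h (x s) (y s) (z s))
      (tri h x' (y t) (z t) + tri h (x t) y' (z t) + tri h (x t) (y t) z') t := by
  have e : tri h x' (y t) (z t) + tri h (x t) y' (z t) + tri h (x t) (y t) z' =
      ∑ i, ∑ j, ∑ k, algebraMap ℝ B (cubicCoeff h i j k) *
        ((x' i * y t j + x t i * y' j) * z t k + x t i * y t j * z' k) := by
    simp only [tri, ← Finset.sum_add_distrib]
    refine Finset.sum_congr rfl fun i _ => Finset.sum_congr rfl fun j _ =>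
      Finset.sum_congr rfl fun k _ => ?_
    ring
  rw [e]
  unfold tri
  refine HasDerivAt.fun_sum fun i _ => HasDerivAt.fun_sum fun j _ => HasDerivAt.fun_sum fun k _ => ?_
  exact (((hasDerivAt_pi.1 hx i).mul (hasDerivAt_pi.1 hy j)).mul
    (hasDerivAt_pi.1 hz k)).const_mul _

theorem hasDerivAt_line {𝕜 B : Type*} [NontriviallyNormedField 𝕜] [NormedAddCommGroup B]
    [NormedSpace 𝕜 B] (x v : B) : HasDerivAt (fun t : 𝕜 => x + t • v) v 0 := by
  simpa using ((hasDerivAt_id (0 : 𝕜)).smul_const v).const_add x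

/-- Reduces the Fréchet derivatives below to derivatives along lines, which `hasDerivAt_tri`
computes. -/
theorem fderiv_eq_of_line {𝕜 E F : Type*} [NontriviallyNormedField 𝕜] [NormedAddCommGroup E]
    [NormedSpace 𝕜 E] [NormedAddCommGroup F] [NormedSpace 𝕜 F] {f : E → F} {x v : E} {d : F}
    (hf : DifferentiableAt 𝕜 f x) (hd : HasDerivAt (fun t : 𝕜 => f (x + t • v)) d 0) :
    fderiv 𝕜 f x v = d :=
  (hf.hasFDerivAt.hasLineDerivAt v).unique hd

end CubicForm

/-! ### First and second derivatives of the prepotential -/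

section Prepotential

variable {n : ℕ} {h : MvPolynomial (Fin n) ℝ}

theorem rMapPrepotential_eq (hh : h.IsHomogeneous 3) (z : Fin (n + 1) → ℂ) :
    rMapPrepotential h z = tri h (Fin.tail z) (Fin.tail z) (Fin.tail z) / (6 * z 0) := by
  rw [← six_mul_aeval hh, mul_div_mul_left _ _ (by norm_num)]
  rfl

variable (h) in
/-- The differential of the prepotential `h(z¹, …, zⁿ) / z⁰`. -/
def gradF (z v : Fin (n + 1) → ℂ) : ℂ :=
  tri h (Fin.tail z) (Fin.tail z) (Fin.tail v) / (2 * z 0)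
    - tri h (Fin.tail z) (Fin.tail z) (Fin.tail z) * v 0 / (6 * z 0 ^ 2)

variable (h) in
/-- The second differential of the prepotential `h(z¹, …, zⁿ) / z⁰`. -/
def hessB (z u v : Fin (n + 1) → ℂ) : ℂ :=
  tri h (Fin.tail z) (Fin.tail u) (Fin.tail v) / z 0
    - tri h (Fin.tail z) (Fin.tail z) (Fin.tail u) * v 0 / (2 * z 0 ^ 2)
    - tri h (Fin.tail z) (Fin.tail z) (Fin.tail v) * u 0 / (2 * z 0 ^ 2)
    + tri h (Fin.tail z) (Fin.tail z) (Fin.tail z) * u 0 * v 0 / (3 * z 0 ^ 3)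

theorem differentiable_tri_tail (y w : Fin n → ℂ) :
    Differentiable ℂ (fun z : Fin (n + 1) → ℂ => tri h (Fin.tail z) (Fin.tail z) (Fin.tail z)) ∧
    Differentiable ℂ (fun z : Fin (n + 1) → ℂ => tri h (Fin.tail z) (Fin.tail z) y) ∧
    Differentiable ℂ (fun z : Fin (n + 1) → ℂ => tri h (Fin.tail z) w y) := by
  unfold tri Fin.tail
  refine ⟨?_, ?_, ?_⟩ <;> fun_prop

theorem hasDerivAt_tail (z v : Fin (n + 1) → ℂ) :
    HasDerivAt (fun t : ℂ => Fin.tail (z + t • v) : ℂ → Fin n → ℂ) (Fin.tail v) 0 :=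
  hasDerivAt_line (𝕜 := ℂ) (Fin.tail z : Fin n → ℂ) (Fin.tail v)

theorem hasDerivAt_zero_coord (z v : Fin (n + 1) → ℂ) :
    HasDerivAt (fun t : ℂ => (z + t • v) 0) (v 0) 0 :=
  hasDerivAt_line (𝕜 := ℂ) (z 0) (v 0)

theorem differentiableAt_prepotential (hh : h.IsHomogeneous 3) {z : Fin (n + 1) → ℂ}
    (hz : z 0 ≠ 0) : DifferentiableAt ℂ (rMapPrepotential h) z := by
  rw [funext (rMapPrepotential_eq hh)]
  simp only [div_eq_mul_inv]
  exact ((differentiable_tri_tail 0 0).1 z).fun_mul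
    (DifferentiableAt.fun_inv (by fun_prop) (by simpa using hz))

theorem fderiv_prepotential (hh : h.IsHomogeneous 3) {z : Fin (n + 1) → ℂ} (hz : z 0 ≠ 0)
    (v : Fin (n + 1) → ℂ) : fderiv ℂ (rMapPrepotential h) z v = gradF h z v := by
  apply fderiv_eq_of_line (differentiableAt_prepotential hh hz)
  rw [funext (rMapPrepotential_eq hh)]
  have ht := hasDerivAt_tail z v
  have h1 := (hasDerivAt_tri (h := h) ht ht ht).fun_div
    ((hasDerivAt_zero_coord z v).const_mul 6) (by simpa using hz)
  refine h1.congr_deriv ?_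
  simp only [zero_smul, add_zero]
  rw [gradF, tri_comm₁₂ h (Fin.tail v), tri_comm₂₃ h (Fin.tail z) (Fin.tail v)]
  field_simp
  ring

theorem holDeriv_prepotential (hh : h.IsHomogeneous 3) {z : Fin (n + 1) → ℂ} (hz : z 0 ≠ 0)
    (I : Fin (n + 1)) : holDeriv I (rMapPrepotential h) z = gradF h z (Pi.single I 1) :=
  fderiv_prepotential hh hz _

theorem hessF_prepotential (hh : h.IsHomogeneous 3) {z : Fin (n + 1) → ℂ} (hz : z 0 ≠ 0)
    (I J : Fin (n + 1)) :
    hessF (rMapPrepotential h) z I J = hessB h z (Pi.single I 1) (Pi.single J 1) := by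
  rw [hessF, Matrix.of_apply, holDeriv]
  have hopen : ∀ᶠ w in 𝓝 z, w 0 ≠ 0 :=
    (continuous_apply (0 : Fin (n + 1))).continuousAt.eventually_ne hz
  have hev : holDeriv I (rMapPrepotential h) =ᶠ[𝓝 z] fun w => gradF h w (Pi.single I 1) := by
    filter_upwards [hopen] with w hw using holDeriv_prepotential hh hw I
  rw [hev.fderiv_eq]
  set u : Fin (n + 1) → ℂ := Pi.single I 1
  set v : Fin (n + 1) → ℂ := Pi.single J 1
  have hd : DifferentiableAt ℂ (fun w => gradF h w u) z := by
    unfold gradF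
    simp only [div_eq_mul_inv]
    exact (((differentiable_tri_tail _ 0).2.1 z).fun_mul
      (DifferentiableAt.fun_inv (by fun_prop) (by simpa using hz))).fun_sub
      ((((differentiable_tri_tail 0 0).1 z).mul_const _).fun_mul
        (DifferentiableAt.fun_inv (by fun_prop) (by simpa using hz)))
  apply fderiv_eq_of_line hd
  have ht := hasDerivAt_tail z v
  have h0 := hasDerivAt_zero_coord z v
  have h1 := ((hasDerivAt_tri (h := h) ht ht (hasDerivAt_const (0 : ℂ) (Fin.tail u))).fun_div
    (h0.const_mul 2) (by simpa using hz)).fun_sub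
    (((hasDerivAt_tri (h := h) ht ht ht).mul_const (u 0)).fun_div ((h0.fun_pow 2).const_mul 6)
      (by simpa using hz))
  unfold gradF
  refine h1.congr_deriv ?_
  simp only [zero_smul, add_zero]
  rw [hessB, tri_comm₁₂ h (Fin.tail v), tri_comm₁₂ h (Fin.tail v),
    tri_comm₂₃ h (Fin.tail z) (Fin.tail v) (Fin.tail z), show tri h (Fin.tail z) (Fin.tail z) 0 = 0 by
      simpa using tri_smul₃ h (Fin.tail z) (Fin.tail z) 0 (0 : ℂ),
    tri_comm₂₃ h (Fin.tail z) (Fin.tail u) (Fin.tail v)]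
  field_simp
  ring

theorem tail_sum_smul_single (v : Fin (n + 1) → ℂ) : ∑ I, v I • (Pi.single I 1 : Fin (n + 1) → ℂ) = v := by
  ext j; simp [Finset.sum_apply, Pi.single_apply]

theorem gradF_sum (z v : Fin (n + 1) → ℂ) :
    ∑ I, gradF h z (Pi.single I 1) * v I = gradF h z v := by
  let f : (Fin (n + 1) → ℂ) →ₗ[ℂ] ℂ :=
    { toFun := gradF h z
      map_add' := fun a b => by
        simp only [gradF, show Fin.tail (a + b) = (Fin.tail a + Fin.tail b : Fin n → ℂ) from rfl,
          tri_add₃, Pi.add_apply]; ring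
      map_smul' := fun r a => by
        simp only [gradF, show Fin.tail (r • a) = (r • Fin.tail a : Fin n → ℂ) from rfl,
          tri_smul₃, Pi.smul_apply, smul_eq_mul, RingHom.id_apply]; ring }
  change _ = f v
  conv_rhs => rw [← tail_sum_smul_single v, map_sum]
  simp only [map_smul, smul_eq_mul]
  exact Finset.sum_congr rfl fun I _ => mul_comm _ _

theorem hessB_comm (z u v : Fin (n + 1) → ℂ) : hessB h z u v = hessB h z v u := by
  rw [hessB, hessB, tri_comm₂₃ h (Fin.tail z) (Fin.tail u) (Fin.tail v)]
  ring

theorem hessB_sum_right (z u v : Fin (n + 1) → ℂ) :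
    ∑ J, hessB h z u (Pi.single J 1) * v J = hessB h z u v := by
  let f : (Fin (n + 1) → ℂ) →ₗ[ℂ] ℂ :=
    { toFun := hessB h z u
      map_add' := fun a b => by
        simp only [hessB, show Fin.tail (a + b) = (Fin.tail a + Fin.tail b : Fin n → ℂ) from rfl,
          tri_add₃, Pi.add_apply]; ring
      map_smul' := fun r a => by
        simp only [hessB, show Fin.tail (r • a) = (r • Fin.tail a : Fin n → ℂ) from rfl,
          tri_smul₃, Pi.smul_apply, smul_eq_mul, RingHom.id_apply]; ring }
  change _ = f v
  conv_rhs => rw [← tail_sum_smul_single v, map_sum]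
  simp only [map_smul, smul_eq_mul]
  exact Finset.sum_congr rfl fun I _ => mul_comm _ _

theorem hessF_sum (hh : h.IsHomogeneous 3) {z : Fin (n + 1) → ℂ} (hz : z 0 ≠ 0)
    (u v : Fin (n + 1) → ℂ) :
    ∑ I, ∑ J, hessF (rMapPrepotential h) z I J * u I * v J = hessB h z u v := by
  simp only [hessF_prepotential hh hz]
  rw [hessB_comm, ← hessB_sum_right]
  refine Finset.sum_congr rfl fun I _ => ?_
  rw [hessB_comm, ← hessB_sum_right, Finset.sum_mul]
  exact Finset.sum_congr rfl fun J _ => by ring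

theorem hessF_symm (hh : h.IsHomogeneous 3) {z : Fin (n + 1) → ℂ} (hz : z 0 ≠ 0)
    (I J : Fin (n + 1)) :
    hessF (rMapPrepotential h) z I J = hessF (rMapPrepotential h) z J I := by
  rw [hessF_prepotential hh hz, hessF_prepotential hh hz, hessB_comm]

end Prepotential

/-! ### A criterion for signature (1, n) -/

section Signature

variable {n : ℕ}

open scoped MatrixOrder ComplexOrder Matrix.Norms.L2Operator in
theorem posDef_exists_factor {𝕜 ι : Type*} [RCLike 𝕜] [Fintype ι] [DecidableEq ι]
    {B : Matrix ι ι 𝕜} (hB : B.PosDef) :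
    ∃ Q : Matrix ι ι 𝕜, IsUnit Q.det ∧ B = Q.conjTranspose * Q := by
  obtain ⟨Q, hQ⟩ := CStarAlgebra.nonneg_iff_eq_star_mul_self.mp hB.posSemidef.nonneg
  refine ⟨Q, ?_, hQ⟩
  have h := (Matrix.isUnit_iff_isUnit_det B).1 hB.isUnit
  rw [hQ, Matrix.det_mul] at h
  exact isUnit_of_mul_isUnit_right h

theorem exists_orthogonal_first_column (u : Fin (n + 1) → ℝ) (hu : u ⬝ᵥ u = 1) :
    ∃ O : Matrix (Fin (n + 1)) (Fin (n + 1)) ℝ, O.transpose * O = 1 ∧ ∀ i, O i 0 = u i := by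
  let w : EuclideanSpace ℝ (Fin (n + 1)) := WithLp.toLp 2 u
  have hw : ‖w‖ = 1 := by
    rw [EuclideanSpace.norm_eq, Real.sqrt_eq_one]
    simpa [w, dotProduct, sq] using hu
  obtain ⟨b, hb⟩ := Orthonormal.exists_orthonormalBasis_extension_of_card_eq
    (𝕜 := ℝ) (E := EuclideanSpace ℝ (Fin (n + 1))) (ι := Fin (n + 1)) (by simp)
    (v := fun _ => w) (s := {0}) (by
      rw [orthonormal_iff_ite]
      rintro ⟨i, hi⟩ ⟨j, hj⟩
      obtain rfl : i = 0 := hi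
      obtain rfl : j = 0 := hj
      simp [hw])
  refine ⟨Matrix.of fun i j => b j i, ?_, fun i => ?_⟩
  · ext i j
    have := orthonormal_iff_ite.1 b.orthonormal i j
    rw [Matrix.mul_apply, Matrix.one_apply, ← this, PiLp.inner_apply]
    simp [mul_comm]
  · simp [hb 0 rfl, w]

/-- A symmetric matrix that is positive on a vector and negative definite on its orthogonal
complement has signature `(1, n)`. -/
theorem hasSignatureOneN_of_neg {A : Matrix (Fin (n + 1)) (Fin (n + 1)) ℝ}
    (hA : A.transpose = A) (v : Fin (n + 1) → ℝ) (hv : 0 < v ⬝ᵥ A.mulVec v)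
    (hneg : ∀ w, w ≠ 0 → w ⬝ᵥ A.mulVec v = 0 → w ⬝ᵥ A.mulVec w < 0) :
    HasSignatureOneN A := by
  set q := v ⬝ᵥ A.mulVec v with hq
  set a := A.mulVec v with ha
  have hAs : ∀ x y, x ⬝ᵥ A.mulVec y = y ⬝ᵥ A.mulVec x := by
    intro x y
    conv_lhs => rw [← hA, Matrix.mulVec_transpose, dotProduct_comm, ← Matrix.dotProduct_mulVec]
  -- B agrees with A on the line of v and with -A on its A-orthogonal complement, hence is positive
  -- definite.
  let B : Matrix (Fin (n + 1)) (Fin (n + 1)) ℝ := (2 / q) • Matrix.vecMulVec a a - A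
  have hBv : ∀ x, B.mulVec x = (2 / q * (a ⬝ᵥ x)) • a - A.mulVec x := by
    intro x
    simp only [B, Matrix.sub_mulVec, Matrix.smul_mulVec, Matrix.vecMulVec_mulVec]
    ext i; simp; ring
  have hB : B.PosDef := by
    refine Matrix.PosDef.of_dotProduct_mulVec_pos ?_ fun x hx => ?_
    · change B.conjTranspose = B
      simp [B, Matrix.conjTranspose_eq_transpose_of_trivial, hA, Matrix.transpose_vecMulVec]
    · rw [star_trivial, hBv, dotProduct_sub, dotProduct_smul, smul_eq_mul, dotProduct_comm a x]
      set l := (x ⬝ᵥ a) / q with hl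
      set w := x - l • v with hw
      have hxw : x = l • v + w := by rw [hw]; abel
      have hwa : w ⬝ᵥ a = 0 := by
        rw [hw, sub_dotProduct, smul_dotProduct, ← hq, hl, smul_eq_mul]
        field_simp; ring
      have hexp : x ⬝ᵥ A.mulVec x = l ^ 2 * q + w ⬝ᵥ A.mulVec w := by
        rw [hxw, Matrix.mulVec_add, Matrix.mulVec_smul, add_dotProduct, dotProduct_add,
          dotProduct_add, dotProduct_smul, dotProduct_smul, smul_dotProduct, smul_dotProduct,
          hAs v w, ← ha, hwa, ← hq]
        simp; ring
      have hxa : x ⬝ᵥ a = l * q := by rw [hl]; field_simp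
      rw [hexp, hxa]
      have e : 2 / q * (l * q) * (l * q) - (l ^ 2 * q + w ⬝ᵥ A.mulVec w)
          = l ^ 2 * q - w ⬝ᵥ A.mulVec w := by field_simp; ring
      rw [e]
      by_cases hw0 : w = 0
      · have hl0 : l ≠ 0 := by
          rintro h0
          rw [hw0, h0] at hxw
          simp at hxw; exact hx hxw
        simp only [hw0, zero_dotProduct, sub_zero]
        positivity
      · have := hneg w hw0 hwa
        nlinarith [sq_nonneg l, mul_nonneg (sq_nonneg l) hv.le]
  obtain ⟨Q, hQdet, hQ⟩ := posDef_exists_factor hB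
  have hQt : Q.conjTranspose = Q.transpose := by ext; simp
  rw [hQt] at hQ
  have hBvv : B.mulVec v = a := by
    rw [hBv, dotProduct_comm, ← hq, div_mul_cancel₀ _ hv.ne', ← ha, two_smul]; abel
  have hQv : Q.mulVec v ⬝ᵥ Q.mulVec v = q := by
    rw [Matrix.dotProduct_mulVec, ← Matrix.mulVec_transpose, Matrix.mulVec_mulVec, ← hQ, hBvv,
      dotProduct_comm]
  -- In the coordinates given by Q the form B is Euclidean and v/√q is a unit vector. An orthogonal
  -- matrix sending the first basis vector there keeps B Euclidean and makes A = (2/q) a aᵀ - B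
  -- diagonal.
  obtain ⟨O, hO, hO0⟩ := exists_orthogonal_first_column ((√q)⁻¹ • Q.mulVec v) (by
    rw [smul_dotProduct, dotProduct_smul, hQv, smul_eq_mul, smul_eq_mul, ← mul_assoc, ← mul_inv,
      Real.mul_self_sqrt hv.le, inv_mul_cancel₀ hv.ne'])
  have hOdet : IsUnit O.det := by
    have := congrArg Matrix.det hO
    rw [Matrix.det_mul, Matrix.det_one] at this
    exact IsUnit.of_mul_eq_one_right _ this
  refine ⟨Q⁻¹ * O, ?_, ?_⟩
  · rw [Matrix.det_mul]
    exact (Matrix.isUnit_nonsing_inv_det Q hQdet).mul hOdet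
  · have hAB : A = (2 / q) • Matrix.vecMulVec a a - B := by simp [B]
    have hQP : Q * (Q⁻¹ * O) = O := Matrix.mul_nonsing_inv_cancel_left Q O hQdet
    have hPB : (Q⁻¹ * O).transpose * B * (Q⁻¹ * O) = 1 := by
      rw [hQ, ← Matrix.mul_assoc (Q⁻¹ * O).transpose, ← Matrix.transpose_mul, hQP, Matrix.mul_assoc,
        hQP, hO]
    have hPa : (Q⁻¹ * O).transpose.mulVec a = √q • Pi.single 0 1 := by
      rw [← hBvv, hQ, ← Matrix.mulVec_mulVec, Matrix.mulVec_mulVec, ← Matrix.transpose_mul, hQP]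
      have e : Q.mulVec v = √q • O.mulVec (Pi.single 0 1) := by
        ext i
        rw [Matrix.mulVec_single_one, Pi.smul_apply, Matrix.col_apply, hO0, Pi.smul_apply,
          smul_eq_mul, smul_eq_mul, mul_inv_cancel_left₀ (Real.sqrt_pos.2 hv).ne']
      rw [e, Matrix.mulVec_smul, Matrix.mulVec_mulVec, hO, Matrix.one_mulVec]
    have hPa' : Matrix.vecMul a (Q⁻¹ * O) = √q • Pi.single 0 1 := by
      rw [← Matrix.mulVec_transpose, hPa]
    rw [hAB, Matrix.mul_sub, Matrix.sub_mul, hPB, Matrix.mul_smul, Matrix.smul_mul,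
      Matrix.mul_vecMulVec, Matrix.vecMulVec_mul, hPa, hPa']
    ext i j
    have hs : √q * √q = q := Real.mul_self_sqrt hv.le
    refine Fin.cases ?_ (fun i => ?_) i <;> refine Fin.cases ?_ (fun j => ?_) j
    · simp [Matrix.vecMulVec_apply, hs]; field_simp; norm_num
    · simp [Matrix.vecMulVec_apply, (Fin.succ_ne_zero j).symm]
    · simp [Matrix.vecMulVec_apply]
    · simp [Matrix.vecMulVec_apply, Matrix.diagonal_apply, Matrix.one_apply]
      split_ifs <;> simp

theorem HasSignatureOneN.isUnit_det {A : Matrix (Fin (n + 1)) (Fin (n + 1)) ℝ}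
    (hA : HasSignatureOneN A) : IsUnit A.det := by
  obtain ⟨P, hP, h⟩ := hA
  have := congrArg Matrix.det h
  rw [Matrix.det_mul, Matrix.det_mul, Matrix.det_diagonal, Fin.prod_univ_succ] at this
  simp at this
  rw [isUnit_iff_ne_zero]
  rintro h0
  rw [h0] at this
  simp at this
  exact pow_ne_zero n (by norm_num) this.symm

end Signature

/-! ### The cubic form over the cone U, and the matrix N -/

section ConePoint

variable {n : ℕ} {h : MvPolynomial (Fin n) ℝ}

/-- A real vector as a complex vector. -/
def cx (v : Fin n → ℝ) : Fin n → ℂ := fun μ => (v μ : ℂ)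

/-- The imaginary part of a complex vector. -/
def imR (v : Fin n → ℂ) : Fin n → ℝ := fun μ => (v μ).im

/-- The real part of a complex vector. -/
def reR (v : Fin n → ℂ) : Fin n → ℝ := fun μ => (v μ).re

theorem cx_re_add_im (v : Fin n → ℂ) : v = cx (reR v) + Complex.I • cx (imR v) := by
  ext μ
  simp only [cx, reR, imR, Pi.add_apply, Pi.smul_apply, smul_eq_mul]
  rw [mul_comm, Complex.re_add_im]

theorem star_eq_re_sub_im (v : Fin n → ℂ) : star v = cx (reR v) - Complex.I • cx (imR v) := by
  ext μ
  apply Complex.ext <;> simp [cx, reR, imR]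

theorem tri_cx (x y z : Fin n → ℝ) : tri h (cx x) (cx y) (cx z) = ((tri h x y z : ℝ) : ℂ) := by
  have := map_tri h Complex.ofRealAm x y z
  exact this.symm

theorem star_tri (x y z : Fin n → ℂ) :
    (starRingEnd ℂ) (tri h x y z) = tri h (star x) (star y) (star z) :=
  map_tri h (Complex.conjAe : ℂ →ₐ[ℝ] ℂ) x y z

variable (h) in
/-- At `x`, the cubic form is positive and its Hessian is Lorentzian, with `x` timelike. -/
structure IsHyperbolicPoint (x : Fin n → ℝ) : Prop where
  pos : 0 < tri h x x x
  neg : ∀ v, v ≠ 0 → tri h x x v = 0 → tri h x v v < 0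

/-- The positivity hypothesis lives on h = 1 only. Scaling x by h(x)^{-1/3} reaches that level, and
tangency and sign are both unaffected by positive scaling. -/
theorem IsProjectiveSpecialReal.isHyperbolicPoint {U : Set (Fin n → ℝ)}
    (hpsr : IsProjectiveSpecialReal h U) {x : Fin n → ℝ} (hx : x ∈ U) : IsHyperbolicPoint h x := by
  have hpos := hpsr.pos x hx
  have hpos' : 0 < tri h x x x := by rw [eval_eq_tri hpsr.cubic] at hpos; linarith
  refine ⟨hpos', fun v hv hv0 => ?_⟩
  set r := (MvPolynomial.eval x h) ^ (-(1 / 3) : ℝ) with hr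
  have hr0 : 0 < r := Real.rpow_pos_of_pos hpos _
  have hr3 : r ^ 3 * MvPolynomial.eval x h = 1 := by
    rw [hr, ← Real.rpow_natCast, ← Real.rpow_mul hpos.le]
    norm_num
    rw [Real.rpow_neg_one, inv_mul_cancel₀ hpos.ne']
  have hmem : r • x ∈ psrHypersurface h U := by
    refine ⟨hpsr.smul_mem x hx r hr0, ?_⟩
    rw [eval_eq_tri hpsr.cubic] at hr3 ⊢
    rw [tri_smul₁, tri_smul₂, tri_smul₃, ← hr3]; ring
  have := hpsr.metric_pos _ hmem v
    (by rw [dPoly_eq_tri hpsr.cubic, tri_smul₁, tri_smul₂, hv0]; simp) hv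
  rw [psrMetric_apply hpsr.cubic, tri_smul₁] at this
  nlinarith

/-- Orthogonal decomposition of v along x and its complement for the Lorentzian form tri(x, ·, ·).
The later sign and length estimates are read off from l and w. -/
theorem IsHyperbolicPoint.decomp {x : Fin n → ℝ} (hx : IsHyperbolicPoint h x) (v : Fin n → ℝ) :
    ∃ (l : ℝ) (w : Fin n → ℝ), v = l • x + w ∧ tri h x x w = 0 ∧ tri h x x v = l * tri h x x x ∧
      tri h x v v = l ^ 2 * tri h x x x + tri h x w w ∧ tri h x w w ≤ 0 ∧
      (tri h x w w = 0 → w = 0) := by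
  have hw : tri h x x (v - (tri h x x v / tri h x x x) • x) = 0 := by
    rw [tri_sub₃, tri_smul₃, div_mul_cancel₀ _ hx.pos.ne', sub_self]
  refine ⟨tri h x x v / tri h x x x, v - (tri h x x v / tri h x x x) • x, by abel, hw,
    (div_mul_cancel₀ _ hx.pos.ne').symm, ?_, ?_, ?_⟩
  · set w := v - (tri h x x v / tri h x x x) • x with hwd
    set l := tri h x x v / tri h x x x
    have hv : v = l • x + w := by rw [hwd]; abel
    rw [hv, tri_add₂, tri_add₃, tri_add₃, tri_smul₂, tri_smul₂, tri_smul₃, tri_smul₃,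
      tri_comm₂₃ h x w x, hw]
    ring
  · by_cases h0 : v - (tri h x x v / tri h x x x) • x = 0
    · rw [h0, ← zero_smul ℝ (0 : Fin n → ℝ), tri_smul₂]; simp
    · exact (hx.neg _ h0 hw).le
  · intro h0
    by_contra hne
    exact (hx.neg _ hne hw).ne h0

theorem tail_homCoord (X : Fin n → ℂ) : Fin.tail (homCoord X) = X := Fin.tail_cons _ _

theorem homCoord_zero (X : Fin n → ℂ) : homCoord X 0 = 1 := rfl

theorem homCoord_ne (X : Fin n → ℂ) : homCoord X 0 ≠ 0 := by simp [homCoord_zero]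

theorem homCoord_star (X : Fin n → ℂ) : star (homCoord X) = homCoord (star X) := by
  ext i
  refine Fin.cases ?_ (fun i => ?_) i <;> simp [homCoord]

/-- 2 Im F_{IJ} = -i(F_{IJ} - F̄_{IJ}), and as h is real, conjugating F_{IJ} amounts to conjugating
X. -/
theorem matN_sum_hess (hh : h.IsHomogeneous 3) (X : Fin n → ℂ) (u v : Fin (n + 1) → ℂ) :
    ∑ I, ∑ J, (matN (rMapPrepotential h) (homCoord X) I J : ℂ) * u I * v J =
      -Complex.I * (hessB h (homCoord X) u v - hessB h (homCoord (star X)) u v) := by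
  rw [← hessF_sum hh (homCoord_ne X), ← hessF_sum hh (homCoord_ne (star X)),
    ← Finset.sum_sub_distrib, Finset.mul_sum]
  refine Finset.sum_congr rfl fun I _ => ?_
  rw [← Finset.sum_sub_distrib, Finset.mul_sum]
  refine Finset.sum_congr rfl fun J _ => ?_
  have hc : hessF (rMapPrepotential h) (homCoord (star X)) I J
      = (starRingEnd ℂ) (hessF (rMapPrepotential h) (homCoord X) I J) := by
    have hs : ∀ K : Fin (n + 1), star (Fin.tail (Pi.single K 1 : Fin (n + 1) → ℂ))
        = Fin.tail (Pi.single K 1 : Fin (n + 1) → ℂ) := by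
      intro K; ext μ
      simp only [Fin.tail, Pi.star_apply, Pi.single_apply]
      split_ifs <;> simp
    have hs0 : ∀ K : Fin (n + 1), (starRingEnd ℂ) ((Pi.single K 1 : Fin (n + 1) → ℂ) 0)
        = (Pi.single K 1 : Fin (n + 1) → ℂ) 0 := by
      intro K
      simp only [Pi.single_apply]
      split_ifs <;> simp
    rw [hessF_prepotential hh (homCoord_ne _), hessF_prepotential hh (homCoord_ne _)]
    simp only [hessB, tail_homCoord, homCoord_zero, map_add, map_sub, map_mul, map_div₀, star_tri,
      hs, hs0, map_pow, map_one, map_ofNat]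
  have e2 : (matN (rMapPrepotential h) (homCoord X) I J : ℂ) = -Complex.I *
      (hessF (rMapPrepotential h) (homCoord X) I J
        - hessF (rMapPrepotential h) (homCoord (star X)) I J) := by
    rw [hc, Complex.sub_conj, matN, Matrix.of_apply]
    push_cast
    linear_combination (2 * ((hessF (rMapPrepotential h) (homCoord X) I J).im : ℂ)) * Complex.I_sq
  rw [e2]; ring

/-- The vertical part of a vector at `y + i x`: the component orthogonal to `(1, y)`. -/
def vert (X : Fin n → ℂ) (u : Fin (n + 1) → ℂ) : Fin n → ℂ := Fin.tail u - u 0 • cx (reR X)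

/-- With y = Re X, splitting off the component along (1, y) makes N block diagonal, with blocks that
involve only x = Im X. Signature, potential and gauge matrix are all read off from this form. -/
theorem matN_sum (hh : h.IsHomogeneous 3) (X : Fin n → ℂ) (u v : Fin (n + 1) → ℂ) :
    ∑ I, ∑ J, (matN (rMapPrepotential h) (homCoord X) I J : ℂ) * u I * v J =
      -(2 / 3) * (tri h (imR X) (imR X) (imR X) : ℝ) * u 0 * v 0
        + 2 * tri h (cx (imR X)) (vert X u) (vert X v) := by
  rw [matN_sum_hess hh]
  have hu : Fin.tail u = u 0 • cx (reR X) + vert X u := by rw [vert]; abel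
  have hv : Fin.tail v = v 0 • cx (reR X) + vert X v := by rw [vert]; abel
  simp only [hessB, tail_homCoord, homCoord_zero]
  rw [hu, hv, ← tri_cx]
  set y := cx (reR X) with hy
  set x := cx (imR X) with hx
  rw [star_eq_re_sub_im, ← hy, ← hx]
  have hX : X = y + Complex.I • x := cx_re_add_im X
  generalize vert X u = a
  generalize vert X v = b
  conv_lhs => rw [hX]
  generalize u 0 = u0
  generalize v 0 = v0
  clear_value x y
  simp only [tri_add₁, tri_add₂, tri_add₃, tri_sub₁, tri_sub₂, tri_sub₃, tri_smul₁, tri_smul₂,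
    tri_smul₃]
  simp only [tri_comm₁₂ h x y, tri_comm₂₃ h _ x y, tri_comm₂₃ h _ a y]
  have hI : Complex.I ^ 4 = 1 := Complex.I_pow_four
  ring_nf
  simp only [hI, Complex.I_sq]
  ring

end ConePoint

/-! ### The conical special Kähler domain -/

section ConicalDomain

variable {n : ℕ} {h : MvPolynomial (Fin n) ℝ} {U : Set (Fin n → ℝ)}

/-- The complex bilinear form of a real matrix. -/
def bilC {m : ℕ} (N : Matrix (Fin m) (Fin m) ℝ) (u v : Fin m → ℂ) : ℂ :=
  ∑ I, ∑ J, (N I J : ℂ) * u I * v J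

variable (h) in
/-- The matrix `N` at the point `(1, X)`. -/
abbrev matNX (X : Fin n → ℂ) : Matrix (Fin (n + 1)) (Fin (n + 1)) ℝ :=
  matN (rMapPrepotential h) (homCoord X)

theorem bilC_matNX (hh : h.IsHomogeneous 3) (X : Fin n → ℂ) (u v : Fin (n + 1) → ℂ) :
    bilC (matNX h X) u v = -(2 / 3) * (tri h (imR X) (imR X) (imR X) : ℝ) * u 0 * v 0
        + 2 * tri h (cx (imR X)) (vert X u) (vert X v) := matN_sum hh X u v

theorem vert_homCoord (X : Fin n → ℂ) : vert X (homCoord X) = Complex.I • cx (imR X) := by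
  rw [vert, tail_homCoord, homCoord_zero, one_smul]
  conv_lhs => rw [cx_re_add_im X]
  ext μ; simp [cx, reR, imR]

theorem vert_star_homCoord (X : Fin n → ℂ) :
    vert X (star (homCoord X)) = -(Complex.I • cx (imR X)) := by
  rw [homCoord_star, vert, tail_homCoord, homCoord_zero, one_smul, star_eq_re_sub_im]
  abel

theorem star_homCoord_zero (X : Fin n → ℂ) : star (homCoord X) 0 = 1 := by
  simp [homCoord_zero]

/-- The value is 8 h(x), which is why the Kähler potential of the c-map coincides with that of the
r-map. -/
theorem affinePotential_homCoord (hh : h.IsHomogeneous 3) (X : Fin n → ℂ) :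
    affinePotential (rMapPrepotential h) (homCoord X)
      = 4 / 3 * tri h (imR X) (imR X) (imR X) := by
  have e : affinePotential (rMapPrepotential h) (homCoord X)
    = (bilC (matNX h X) (homCoord X) (star (homCoord X))).re := rfl
  rw [e, bilC_matNX hh, vert_homCoord, vert_star_homCoord, star_homCoord_zero, homCoord_zero,
    tri_neg₃, tri_smul₂, tri_smul₃, tri_cx, ← mul_assoc, Complex.I_mul_I]
  rw [show (-(2 / 3) * (tri h (imR X) (imR X) (imR X) : ℝ) * 1 * 1
    + 2 * -(-1 * ((tri h (imR X) (imR X) (imR X) : ℝ) : ℂ)) : ℂ)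
    = ((4 / 3 * tri h (imR X) (imR X) (imR X) : ℝ) : ℂ) by push_cast; ring]
  exact Complex.ofReal_re _

theorem hessF_smul (hh : h.IsHomogeneous 3) {z : Fin (n + 1) → ℂ} (hz : z 0 ≠ 0) {a : ℂ}
    (ha : a ≠ 0) :
    hessF (rMapPrepotential h) (a • z) = hessF (rMapPrepotential h) z := by
  ext I J
  have haz : (a • z) 0 ≠ 0 := mul_ne_zero ha hz
  rw [hessF_prepotential hh haz, hessF_prepotential hh hz]
  simp only [hessB, show Fin.tail (a • z) = (a • Fin.tail z : Fin n → ℂ) from rfl, tri_smul₁,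
    tri_smul₂, tri_smul₃, Pi.smul_apply, smul_eq_mul]
  field_simp

theorem matN_smul (hh : h.IsHomogeneous 3) {z : Fin (n + 1) → ℂ} (hz : z 0 ≠ 0) {a : ℂ}
    (ha : a ≠ 0) : matN (rMapPrepotential h) (a • z) = matN (rMapPrepotential h) z := by
  rw [matN, matN, hessF_smul hh hz ha]

theorem matNX_transpose (hh : h.IsHomogeneous 3) (X : Fin n → ℂ) :
    (matNX h X).transpose = matNX h X := by
  ext I J
  simp only [matNX, matN, Matrix.transpose_apply, Matrix.of_apply]
  rw [hessF_symm hh (homCoord_ne X)]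

theorem ofReal_dotProduct_mulVec {m : ℕ} (N : Matrix (Fin m) (Fin m) ℝ) (u v : Fin m → ℝ) :
    ((u ⬝ᵥ N.mulVec v : ℝ) : ℂ) = bilC N (fun i => (u i : ℂ)) (fun i => (v i : ℂ)) := by
  simp only [dotProduct, Matrix.mulVec, bilC, Complex.ofReal_sum, Complex.ofReal_mul,
    Finset.mul_sum]
  refine Finset.sum_congr rfl fun i _ => Finset.sum_congr rfl fun j _ => ?_
  ring

theorem dotProduct_matNX (hh : h.IsHomogeneous 3) (X : Fin n → ℂ) (u v : Fin (n + 1) → ℝ) :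
    u ⬝ᵥ (matNX h X).mulVec v = -(2 / 3) * tri h (imR X) (imR X) (imR X) * u 0 * v 0
      + 2 * tri h (imR X) (Fin.tail u - u 0 • reR X) (Fin.tail v - v 0 • reR X) := by
  have e := ofReal_dotProduct_mulVec (matNX h X) u v
  have hv : ∀ u : Fin (n + 1) → ℝ, vert X (fun i => (u i : ℂ)) = cx (Fin.tail u - u 0 • reR X) := by
    intro u; ext μ; simp [vert, cx, Fin.tail]
  rw [bilC_matNX hh, hv, hv, tri_cx] at e
  apply Complex.ofReal_injective
  rw [e]
  push_cast
  ring

/-- The positive direction is (0, x). On its complement N is the sum of -4h(x)(w⁰)² and twice the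
form tri(x, ·, ·) on vectors orthogonal to x, where it is negative definite. -/
theorem hasSignatureOneN_matNX (hh : h.IsHomogeneous 3) {X : Fin n → ℂ}
    (hX : IsHyperbolicPoint h (imR X)) : HasSignatureOneN (matNX h X) := by
  have hT := hX.pos
  apply hasSignatureOneN_of_neg (matNX_transpose hh X) (Fin.cons 0 (imR X))
  · rw [dotProduct_matNX hh]
    simp only [Fin.cons_zero, Fin.tail_cons, zero_smul, sub_zero]
    linarith
  · intro w hw hw0
    rw [dotProduct_matNX hh] at hw0 ⊢
    simp only [Fin.cons_zero, Fin.tail_cons, zero_smul, sub_zero] at hw0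
    have h0 : tri h (imR X) (imR X) (Fin.tail w - w 0 • reR X) = 0 := by
      rw [tri_comm₂₃]; linarith
    by_cases hb : Fin.tail w - w 0 • reR X = 0
    · rw [hb]
      have hw00 : w 0 ≠ 0 := by
        intro h00
        apply hw
        rw [h00, zero_smul, sub_zero] at hb
        ext i
        refine Fin.cases h00 (fun i => ?_) i
        exact congrFun hb i
      have : tri h (imR X) (0 : Fin n → ℝ) 0 = 0 := by
        rw [← zero_smul ℝ (0 : Fin n → ℝ), tri_smul₂, zero_mul]
      rw [this]
      have := mul_pos hT (mul_self_pos.2 hw00)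
      nlinarith
    · have := hX.neg _ hb h0
      have := mul_nonneg hT.le (mul_self_nonneg (w 0))
      nlinarith

theorem mem_rMapCone_iff {z : Fin (n + 1) → ℂ} :
    z ∈ rMapCone U ↔ z 0 ≠ 0 ∧ projInhom z ∈ rMapDomain U := by
  constructor
  · rintro ⟨a, ha, X, hX, rfl⟩
    refine ⟨by simpa [homCoord] using ha, ?_⟩
    have : projInhom (a • homCoord X) = X := by
      ext μ; simp [projInhom, homCoord]; field_simp
    rwa [this]
  · rintro ⟨h0, hX⟩
    refine ⟨z 0, h0, projInhom z, hX, ?_⟩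
    ext i
    refine Fin.cases ?_ (fun μ => ?_) i
    · simp [homCoord]
    · simp [homCoord, projInhom]; field_simp

theorem isOpen_rMapDomain (hU : IsOpen U) : IsOpen (rMapDomain U) :=
  hU.preimage (by fun_prop : Continuous fun X : Fin n → ℂ => fun μ => (X μ).im)

theorem isConnected_rMapDomain (hU : IsConnected U) : IsConnected (rMapDomain U) := by
  have : rMapDomain U = (fun p : (Fin n → ℝ) × (Fin n → ℝ) => cx p.1 + Complex.I • cx p.2) ''
      (Set.univ ×ˢ U) := by
    ext X
    constructor
    · intro hX
      exact ⟨(reR X, imR X), ⟨trivial, hX⟩, (cx_re_add_im X).symm⟩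
    · rintro ⟨⟨y, x⟩, ⟨-, hx⟩, rfl⟩
      change (fun μ => _) ∈ U
      convert hx using 1
      ext μ; simp [cx]
  rw [this]
  apply (isConnected_univ.prod hU).image
  unfold cx
  fun_prop

theorem isConicalSpecialKahlerDomain (hpsr : IsProjectiveSpecialReal h U) :
    IsConicalSpecialKahlerDomain (rMapCone U) (rMapPrepotential h) where
  isOpen := by
    have : rMapCone U = {z : Fin (n + 1) → ℂ | z 0 ≠ 0} ∩ projInhom ⁻¹' (rMapDomain U) := by
      ext z; exact mem_rMapCone_iff
    rw [this]
    apply ContinuousOn.isOpen_inter_preimage _ _ (isOpen_rMapDomain hpsr.isOpen)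
    · unfold projInhom
      refine continuousOn_pi.2 fun μ => ?_
      exact ContinuousOn.div (by fun_prop) (by fun_prop) fun z hz => hz
    · exact isOpen_ne_fun (by fun_prop) (by fun_prop)
  isConnected := by
    have : rMapCone U = (fun p : ℂ × (Fin n → ℂ) => p.1 • homCoord p.2) ''
        ({0}ᶜ ×ˢ rMapDomain U) := by
      ext z
      constructor
      · rintro ⟨a, ha, X, hX, rfl⟩
        exact ⟨(a, X), ⟨ha, hX⟩, rfl⟩
      · rintro ⟨⟨a, X⟩, ⟨ha, hX⟩, rfl⟩
        exact ⟨a, ha, X, hX, rfl⟩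
    rw [this]
    refine IsConnected.image (IsConnected.prod ?_ (isConnected_rMapDomain hpsr.isConnected)) _ ?_
    · exact isConnected_compl_singleton_of_one_lt_rank (by simp) 0
    · apply Continuous.continuousOn
      refine continuous_fst.smul ?_
      refine continuous_pi fun i => ?_
      refine Fin.cases ?_ (fun μ => ?_) i
      · simp only [homCoord_zero]; fun_prop
      · change Continuous fun p : ℂ × (Fin n → ℂ) => p.2 μ
        fun_prop
  zero_notMem hz := (mem_rMapCone_iff.1 hz).1 rfl
  smul_mem := by
    rintro z ⟨a, ha, X, hX, rfl⟩ b hb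
    exact ⟨b * a, mul_ne_zero hb ha, X, hX, by rw [mul_smul]⟩
  holomorphic z hz :=
    (differentiableAt_prepotential hpsr.cubic (mem_rMapCone_iff.1 hz).1).differentiableWithinAt
  homogeneous z hz a ha := by
    have h0 := (mem_rMapCone_iff.1 hz).1
    rw [rMapPrepotential_eq hpsr.cubic, rMapPrepotential_eq hpsr.cubic,
      show Fin.tail (a • z) = (a • Fin.tail z : Fin n → ℂ) from rfl, tri_smul₁, tri_smul₂,
      tri_smul₃, Pi.smul_apply, smul_eq_mul]
    field_simp
  signature := by
    rintro z ⟨a, ha, X, hX, rfl⟩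
    rw [matN_smul hpsr.cubic (homCoord_ne X) ha]
    exact hasSignatureOneN_matNX hpsr.cubic (hpsr.isHyperbolicPoint hX)
  potential_pos := by
    rintro z ⟨a, ha, X, hX, rfl⟩
    have e : affinePotential (rMapPrepotential h) (a • homCoord X)
        = Complex.normSq a * affinePotential (rMapPrepotential h) (homCoord X) := by
      rw [affinePotential, affinePotential, matN_smul hpsr.cubic (homCoord_ne X) ha,
        ← Complex.re_ofReal_mul, Complex.normSq_eq_conj_mul_self, Finset.mul_sum]
      congr 1
      refine Finset.sum_congr rfl fun I _ => ?_
      rw [Finset.mul_sum]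
      refine Finset.sum_congr rfl fun J _ => ?_
      simp only [Pi.smul_apply, smul_eq_mul, map_mul]
      ring
    rw [e, affinePotential_homCoord hpsr.cubic]
    have := (hpsr.isHyperbolicPoint hX).pos
    have h2 : 0 < tri h (imR X) (imR X) (imR X) := this
    have := Complex.normSq_pos.2 ha
    positivity

end ConicalDomain

/-! ### The Kähler metric of the r-map -/

section KahlerMetric

variable {n : ℕ} {h : MvPolynomial (Fin n) ℝ} {U : Set (Fin n → ℝ)}

theorem hermForm_apply {E : Type*} [NormedAddCommGroup E] [NormedSpace ℝ E] (α β : E →L[ℝ] ℂ)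
    (u v : E) : hermForm α β u v = (α u * (starRingEnd ℂ) (β v)).re := by
  simp [hermForm, tensorForm]

theorem kahlerMetric_apply {m : ℕ} (K : (Fin m → ℂ) → ℝ) (X u v : Fin m → ℂ) :
    kahlerMetric K X u v = (∑ μ, ∑ ν, wirtinger μ (wirtingerBar ν fun Y => (K Y : ℂ)) X *
      (u μ * star v ν)).re := by
  simp only [kahlerMetric, sum_apply, hermForm_apply, Complex.re_sum, dZ, smul_apply,
    ContinuousLinearMap.proj_apply, smul_eq_mul, Pi.star_apply, mul_assoc]
  rfl

theorem imR_add_smul (X v : Fin n → ℂ) (t : ℝ) : imR (X + t • v) = imR X + t • imR v := by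
  ext μ; simp [imR]

theorem contDiff_imR {m : ℕ∞ω} : ContDiff ℝ m (imR : (Fin n → ℂ) → Fin n → ℝ) :=
  contDiff_pi.2 fun μ => Complex.imCLM.contDiff.comp (contDiff_apply ℝ ℂ μ)

theorem contDiffAt_tri_imR {m : ℕ∞ω} (X : Fin n → ℂ) :
    ContDiffAt ℝ m (fun Y : Fin n → ℂ => tri h (imR Y) (imR Y) (imR Y)) X :=
  (contDiffOn_tri contDiff_imR.contDiffOn contDiff_imR.contDiffOn
    contDiff_imR.contDiffOn).contDiffAt Filter.univ_mem

theorem contDiffAt_tri_imR' {m : ℕ∞ω} (X : Fin n → ℂ) (e : Fin n → ℝ) :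
    ContDiffAt ℝ m (fun Y : Fin n → ℂ => tri h (imR Y) (imR Y) e) X :=
  (contDiffOn_tri contDiff_imR.contDiffOn contDiff_imR.contDiffOn
    contDiffOn_const).contDiffAt Filter.univ_mem

theorem rMapPotential_eq (hh : h.IsHomogeneous 3) (X : Fin n → ℂ) :
    rMapPotential h X = -Real.log (4 / 3 * tri h (imR X) (imR X) (imR X)) := by
  rw [rMapPotential, eval_eq_tri hh]
  change -Real.log (8 * (tri h (imR X) (imR X) (imR X) / 6)) = _
  congr 2; ring

theorem hasDerivAt_imR_line (X v : Fin n → ℂ) :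
    HasDerivAt (fun t : ℝ => imR (X + t • v)) (imR v) 0 := by
  simp only [imR_add_smul]
  exact hasDerivAt_line _ _

theorem differentiableAt_rMapPotential (hh : h.IsHomogeneous 3) {X : Fin n → ℂ}
    (hX : 0 < tri h (imR X) (imR X) (imR X)) : DifferentiableAt ℝ (rMapPotential h) X := by
  rw [funext (rMapPotential_eq hh)]
  have h1 : DifferentiableAt ℝ (fun Y : Fin n → ℂ => tri h (imR Y) (imR Y) (imR Y)) X :=
    (contDiffAt_tri_imR (m := 1) X).differentiableAt (by simp)
  exact ((h1.const_mul _).log (by positivity)).neg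

theorem fderiv_rMapPotential (hh : h.IsHomogeneous 3) {X : Fin n → ℂ}
    (hX : 0 < tri h (imR X) (imR X) (imR X)) (v : Fin n → ℂ) :
    fderiv ℝ (rMapPotential h) X v
      = -(3 * tri h (imR X) (imR X) (imR v) / tri h (imR X) (imR X) (imR X)) := by
  apply fderiv_eq_of_line (differentiableAt_rMapPotential hh hX)
  rw [funext (rMapPotential_eq hh)]
  have hl := hasDerivAt_imR_line X v
  have h1 := (((hasDerivAt_tri (h := h) hl hl hl).const_mul (4 / 3)).log
    (by simpa using hX.ne')).fun_neg
  refine h1.congr_deriv ?_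
  simp only [zero_smul, add_zero]
  rw [tri_comm₁₂ h (imR v), tri_comm₂₃ h (imR X) (imR v)]
  field_simp
  ring

theorem imR_single_one (ν : Fin n) : imR (Pi.single ν 1) = 0 := by
  ext μ; simp only [imR, Pi.single_apply]; split_ifs <;> simp

theorem imR_single_I (ν : Fin n) : imR (Pi.single ν Complex.I) = Pi.single ν 1 := by
  ext μ; simp only [imR, Pi.single_apply]; split_ifs <;> simp

theorem tri_zero₃ {A : Type*} [CommRing A] [Algebra ℝ A] (x y : Fin n → A) : tri h x y 0 = 0 := by
  simpa using tri_smul₃ h x y 0 (0 : A)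

theorem tri_zero₂ (x y : Fin n → ℝ) : tri h x 0 y = 0 := by rw [tri_comm₂₃, tri_zero₃]

theorem wirtingerBar_rMapPotential (hh : h.IsHomogeneous 3) {X : Fin n → ℂ}
    (hX : 0 < tri h (imR X) (imR X) (imR X)) (ν : Fin n) :
    wirtingerBar ν (fun Y => (rMapPotential h Y : ℂ)) X = -(3 / 2) * Complex.I *
      ((tri h (imR X) (imR X) (Pi.single ν 1) / tri h (imR X) (imR X) (imR X) : ℝ) : ℂ) := by
  have hd : ∀ v, fderiv ℝ (fun Y => (rMapPotential h Y : ℂ)) X v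
      = ((fderiv ℝ (rMapPotential h) X v : ℝ) : ℂ) := fun v => by
    have := (Complex.ofRealCLM.hasFDerivAt.comp X
      (differentiableAt_rMapPotential hh hX).hasFDerivAt).fderiv
    have e : (fun Y => (rMapPotential h Y : ℂ)) = Complex.ofRealCLM ∘ rMapPotential h := rfl
    rw [e, this]; rfl
  rw [wirtingerBar, hd, hd, fderiv_rMapPotential hh hX, fderiv_rMapPotential hh hX,
    imR_single_one, imR_single_I, tri_zero₃]
  push_cast
  ring

/-- The potential depends on x = Im X only, so ∂²/∂X^μ∂X̄^ν acts as ¼ ∂²/∂x^μ∂x^ν. -/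
theorem wirtinger_wirtingerBar_rMapPotential (hh : h.IsHomogeneous 3) {X : Fin n → ℂ}
    (hX : 0 < tri h (imR X) (imR X) (imR X)) (μ ν : Fin n) :
    wirtinger μ (wirtingerBar ν (fun Y => (rMapPotential h Y : ℂ))) X =
      (((-6 * tri h (imR X) (Pi.single μ 1) (Pi.single ν 1) / tri h (imR X) (imR X) (imR X)
        + 9 * tri h (imR X) (imR X) (Pi.single μ 1) * tri h (imR X) (imR X) (Pi.single ν 1)
          / tri h (imR X) (imR X) (imR X) ^ 2) / 4 : ℝ) : ℂ) := by
  have hev : wirtingerBar ν (fun Y => (rMapPotential h Y : ℂ)) =ᶠ[𝓝 X] fun X =>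
      -(3 / 2) * Complex.I *
      ((tri h (imR X) (imR X) (Pi.single ν 1) / tri h (imR X) (imR X) (imR X) : ℝ) : ℂ) := by
    filter_upwards [(contDiffAt_tri_imR (h := h) (m := 0) X).continuousAt.tendsto.eventually
      (lt_mem_nhds hX)] with Y hY using wirtingerBar_rMapPotential hh hY ν
  rw [wirtinger, hev.fderiv_eq]
  have hq : DifferentiableAt ℝ (fun Y : Fin n → ℂ => tri h (imR Y) (imR Y) (Pi.single ν 1)
      / tri h (imR Y) (imR Y) (imR Y)) X :=
    ((contDiffAt_tri_imR' (m := 1) X _).div (contDiffAt_tri_imR X) hX.ne').differentiableAt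
      (by simp)
  have hd : ∀ v, fderiv ℝ (fun X : Fin n → ℂ => -(3 / 2) * Complex.I *
      ((tri h (imR X) (imR X) (Pi.single ν 1) / tri h (imR X) (imR X) (imR X) : ℝ) : ℂ)) X v
      = -(3 / 2) * Complex.I * (((2 * tri h (imR X) (imR v) (Pi.single ν 1)
          / tri h (imR X) (imR X) (imR X)
        - 3 * tri h (imR X) (imR X) (imR v) * tri h (imR X) (imR X) (Pi.single ν 1)
          / tri h (imR X) (imR X) (imR X) ^ 2 : ℝ)) : ℂ) := by
    intro v
    have hl := hasDerivAt_imR_line X v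
    apply fderiv_eq_of_line
    · exact (Complex.ofRealCLM.differentiableAt.comp X hq).const_mul _
    · have h1 := ((hasDerivAt_tri (h := h) hl hl
        (hasDerivAt_const (0 : ℝ) (Pi.single ν 1 : Fin n → ℝ))).fun_div
          (hasDerivAt_tri (h := h) hl hl hl) (by simpa using hX.ne'))
      have h2 := (Complex.ofRealCLM.hasFDerivAt.comp_hasDerivAt (0 : ℝ) h1).const_mul
        (-(3 / 2) * Complex.I)
      refine h2.congr_deriv ?_
      simp only [zero_smul, add_zero, Complex.ofRealCLM_apply, tri_zero₃]
      rw [tri_comm₁₂ h (imR v), tri_comm₁₂ h (imR v), tri_comm₂₃ h (imR X) (imR v) (imR X)]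
      congr 2
      field_simp
      ring
  rw [hd, hd, imR_single_one, imR_single_I, tri_zero₂, tri_zero₃]
  push_cast
  linear_combination ((3 / 4 : ℂ) * ((2 * (tri h (imR X) (Pi.single μ 1) (Pi.single ν 1) : ℝ)
          / (tri h (imR X) (imR X) (imR X) : ℝ)
        - 3 * (tri h (imR X) (imR X) (Pi.single μ 1) : ℝ)
          * (tri h (imR X) (imR X) (Pi.single ν 1) : ℝ)
          / ((tri h (imR X) (imR X) (imR X) : ℝ) : ℂ) ^ 2)) : ℂ) * Complex.I_sq

variable (h) in
/-- The Hessian `-¼ ∂² log h` at `x`, as a complex bilinear form. -/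
def logHess (x : Fin n → ℝ) (u v : Fin n → ℂ) : ℂ :=
  (-6 * tri h (cx x) u v / (tri h x x x : ℝ)
    + 9 * tri h (cx x) (cx x) u * tri h (cx x) (cx x) v / (tri h x x x : ℝ) ^ 2) / 4

theorem rMapMetric_apply (hh : h.IsHomogeneous 3) {X : Fin n → ℂ}
    (hX : 0 < tri h (imR X) (imR X) (imR X)) (u v : Fin n → ℂ) :
    rMapMetric h X u v = (logHess h (imR X) u (star v)).re := by
  rw [rMapMetric, kahlerMetric_apply]
  congr 1
  have hs : ∀ μ : Fin n, cx (Pi.single μ 1) = Pi.single μ 1 := by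
    intro μ; ext ν; simp only [cx, Pi.single_apply]; split_ifs <;> simp
  simp only [wirtinger_wirtingerBar_rMapPotential hh hX]
  push_cast
  simp only [← tri_cx, hs]
  rw [logHess, ← tri_cx, ← sum_mul_tri_single₂ (cx (imR X)) (star v) u,
    ← sum_mul_tri_single₃ (cx (imR X)) (cx (imR X)) u]
  simp only [Finset.mul_sum, Finset.sum_mul, Finset.sum_div, ← Finset.sum_add_distrib]
  refine Finset.sum_congr rfl fun μ _ => ?_
  rw [← sum_mul_tri_single₃ (cx (imR X)) (Pi.single μ 1) (star v),
    ← sum_mul_tri_single₃ (cx (imR X)) (cx (imR X)) (star v)]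
  simp only [Finset.mul_sum, Finset.sum_div, ← Finset.sum_add_distrib]
  refine Finset.sum_congr rfl fun ν _ => ?_
  ring

end KahlerMetric

/-! ### The r-map metric as a projective special Kähler metric -/

section ProjectiveDomain

variable {n : ℕ} {h : MvPolynomial (Fin n) ℝ} {U : Set (Fin n → ℝ)}

theorem bilC_comm {m : ℕ} {N : Matrix (Fin m) (Fin m) ℝ} (hN : N.transpose = N)
    (u v : Fin m → ℂ) : bilC N u v = bilC N v u := by
  rw [bilC, bilC, Finset.sum_comm]
  refine Finset.sum_congr rfl fun i _ => Finset.sum_congr rfl fun j _ => ?_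
  have : N i j = N j i := congrFun (congrFun hN j) i
  rw [this]; ring

theorem bilC_add_left {m : ℕ} (N : Matrix (Fin m) (Fin m) ℝ) (u u' v : Fin m → ℂ) :
    bilC N (u + u') v = bilC N u v + bilC N u' v := by
  simp only [bilC, ← Finset.sum_add_distrib, Pi.add_apply, mul_add, add_mul]

theorem bilC_smul_left {m : ℕ} (N : Matrix (Fin m) (Fin m) ℝ) (a : ℂ) (u v : Fin m → ℂ) :
    bilC N (a • u) v = a * bilC N u v := by
  simp only [bilC, Finset.mul_sum, Pi.smul_apply, smul_eq_mul]
  refine Finset.sum_congr rfl fun i _ => Finset.sum_congr rfl fun j _ => ?_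
  ring

theorem bilC_add_right {m : ℕ} (N : Matrix (Fin m) (Fin m) ℝ) (u v v' : Fin m → ℂ) :
    bilC N u (v + v') = bilC N u v + bilC N u v' := by
  simp only [bilC, ← Finset.sum_add_distrib, Pi.add_apply, mul_add]

theorem bilC_smul_right {m : ℕ} (N : Matrix (Fin m) (Fin m) ℝ) (a : ℂ) (u v : Fin m → ℂ) :
    bilC N u (a • v) = a * bilC N u v := by
  simp only [bilC, Finset.mul_sum, Pi.smul_apply, smul_eq_mul]
  refine Finset.sum_congr rfl fun i _ => Finset.sum_congr rfl fun j _ => ?_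
  ring

theorem star_bilC {m : ℕ} (N : Matrix (Fin m) (Fin m) ℝ) (u v : Fin m → ℂ) :
    (starRingEnd ℂ) (bilC N u v) = bilC N (star u) (star v) := by
  simp [bilC]

theorem affineMetric_apply (F : (Fin (n + 1) → ℂ) → ℂ) (z u v : Fin (n + 1) → ℂ) :
    affineMetric F z u v = (bilC (matN F z) u (star v)).re := by
  simp only [affineMetric, sum_apply, hermForm_apply, bilC, Complex.re_sum, dZ, smul_apply,
    ContinuousLinearMap.proj_apply, smul_eq_mul, Pi.star_apply]
  rfl

/-- The sum α² + (J^*α)² is the Hermitian square of the pairing with z, so the whole tensor is the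
real part of a single sesquilinear expression. -/
theorem horizontalForm_apply (F : (Fin (n + 1) → ℂ) → ℂ) (z u v : Fin (n + 1) → ℂ)
    (hN : (matN F z).transpose = matN F z) :
    horizontalForm F z u v = (-(bilC (matN F z) u (star v)) / (affinePotential F z)
      + bilC (matN F z) u (star z) * bilC (matN F z) z (star v) / (affinePotential F z) ^ 2).re := by
  set N := matN F z
  set f := affinePotential F z
  have e1 : ∀ u, affineMetric F z z (stdJ u) = (bilC N z (star u)).im := by
    intro u
    rw [affineMetric_apply]
    have : star (stdJ u) = (-Complex.I) • star u := by
      ext i; simp [stdJ]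
    rw [this, bilC_smul_right]
    simp [N]
  have e2 : bilC N u (star z) = (starRingEnd ℂ) (bilC N z (star u)) := by
    rw [star_bilC, star_star, bilC_comm hN]
  have e3 : ∀ w : ℂ, (w / (f : ℂ)).re = w.re / f := fun w => Complex.div_ofReal_re w f
  have e4 : ∀ w : ℂ, (w / (f : ℂ) ^ 2).re = w.re / f ^ 2 := fun w => by
    rw [← Complex.ofReal_pow]; exact Complex.div_ofReal_re w _
  simp only [horizontalForm, add_apply, smul_apply, sqForm, tensorForm,
    ContinuousLinearMap.smulRight_apply, ContinuousLinearMap.coe_comp, Function.comp_apply, e1,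
    smul_eq_mul, affineMetric_apply]
  rw [Complex.add_re, e3, e4, e2, Complex.mul_re, Complex.conj_re, Complex.conj_im]
  change -f⁻¹ * (bilC N u (star v)).re + (f ^ 2)⁻¹ * ((bilC N z (star u)).re *
    (bilC N z (star v)).re + (bilC N z (star u)).im * (bilC N z (star v)).im) = _
  rw [Complex.neg_re]
  ring

/-- The arguments on the left are u and v made transversal to (1, X) and (1, X̄). Independent
complex u and v are allowed because the identity also serves the fibre metric, the derivative of the
periods and the contact curvature. -/
theorem logHess_eq (hh : h.IsHomogeneous 3) {X : Fin n → ℂ}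
    (hX : 0 < tri h (imR X) (imR X) (imR X)) (u v : Fin (n + 1) → ℂ) :
    logHess h (imR X) (Fin.tail u - u 0 • X) (Fin.tail v - v 0 • star X) =
      -(bilC (matNX h X) u v) / (affinePotential (rMapPrepotential h) (homCoord X))
      + bilC (matNX h X) u (star (homCoord X)) * bilC (matNX h X) (homCoord X) v
        / (affinePotential (rMapPrepotential h) (homCoord X)) ^ 2 := by
  rw [affinePotential_homCoord hh]
  simp only [bilC_matNX hh, vert_homCoord, vert_star_homCoord, star_homCoord_zero, homCoord_zero]
  -- The vertical part used by N and the transversal part used here differ by a multiple of x. After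
  -- this substitution only a trilinear identity remains.
  have hu : vert X u = (Fin.tail u - u 0 • X) + (u 0 * Complex.I) • cx (imR X) := by
    rw [vert]
    conv_rhs => rw [cx_re_add_im X]
    ext μ; simp [cx, imR, reR]; ring
  have hv : vert X v = (Fin.tail v - v 0 • star X) - (v 0 * Complex.I) • cx (imR X) := by
    rw [vert, star_eq_re_sub_im]
    ext μ; simp; ring
  rw [hu, hv, logHess]
  generalize Fin.tail u - u 0 • X = p
  generalize Fin.tail v - v 0 • star X = q
  push_cast
  have hT : ((tri h (imR X) (imR X) (imR X) : ℝ) : ℂ) ≠ 0 := by exact_mod_cast hX.ne'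
  rw [← tri_cx] at hT ⊢
  generalize cx (imR X) = x at *
  have hI3 : Complex.I ^ 3 = -Complex.I := Complex.I_pow_three
  simp only [tri_add₂, tri_sub₃, tri_smul₂, tri_smul₃, tri_neg₃]
  rw [tri_comm₂₃ h x p x]
  field_simp
  ring_nf
  simp only [Complex.I_sq, hI3, Complex.I_pow_four]
  ring

theorem fderiv_projInhom {z : Fin (n + 1) → ℂ} (hz : z 0 ≠ 0) (u : Fin (n + 1) → ℂ) :
    fderiv ℝ projInhom z u = (z 0)⁻¹ • (Fin.tail u - u 0 • projInhom z) := by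
  have hd : DifferentiableAt ℝ (projInhom : (Fin (n + 1) → ℂ) → Fin n → ℂ) z := by
    unfold projInhom
    refine differentiableAt_pi.2 fun μ => ?_
    simp only [div_eq_mul_inv]
    exact DifferentiableAt.fun_mul (by fun_prop) (DifferentiableAt.fun_inv (by fun_prop) hz)
  apply fderiv_eq_of_line hd
  refine hasDerivAt_pi.2 fun μ => ?_
  have h1 := (hasDerivAt_line (𝕜 := ℝ) (z μ.succ) (u μ.succ)).fun_div
    (hasDerivAt_line (𝕜 := ℝ) (z 0) (u 0)) (by simpa using hz)
  refine h1.congr_deriv ?_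
  simp only [zero_smul, add_zero, Pi.smul_apply, Pi.sub_apply, smul_eq_mul, Fin.tail, projInhom]
  field_simp

/-- At z = a(1, X) the matrix N is that of (1, X), f gains the factor |a|² and dπ the factor 1/a.
These factors cancel, and `logHess_eq` at (1, X) remains. -/
theorem pullback_rMapMetric (hpsr : IsProjectiveSpecialReal h U) {z : Fin (n + 1) → ℂ}
    (hz : z ∈ rMapCone U) :
    pullbackForm (fderiv ℝ projInhom z) (rMapMetric h (projInhom z))
      = horizontalForm (rMapPrepotential h) z := by
  obtain ⟨a, ha, X, hX, rfl⟩ := hz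
  have hh := hpsr.cubic
  have hT : 0 < tri h (imR X) (imR X) (imR X) := (hpsr.isHyperbolicPoint hX).pos
  have hp : projInhom (a • homCoord X) = X := by
    ext μ; simp [projInhom, homCoord]; field_simp
  have ha0 : (a • homCoord X) 0 = a := by simp [homCoord]
  have haz : (a • homCoord X) 0 ≠ 0 := by rwa [ha0]
  have hNa := matN_smul hh (homCoord_ne X) ha
  have hf : affinePotential (rMapPrepotential h) (a • homCoord X)
      = Complex.normSq a * affinePotential (rMapPrepotential h) (homCoord X) := by
    have e : ∀ z, affinePotential (rMapPrepotential h) z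
      = (bilC (matN (rMapPrepotential h) z) z (star z)).re := fun z => rfl
    rw [e, e, hNa, star_smul, bilC_smul_left, bilC_smul_right, ← mul_assoc]
    rw [show a * star a = (Complex.normSq a : ℂ) from Complex.mul_conj a, Complex.re_ofReal_mul]
  ext u v
  rw [horizontalForm_apply _ _ _ _ (by rw [hNa]; exact matNX_transpose hh X), hNa, hf]
  change rMapMetric h (projInhom (a • homCoord X)) (fderiv ℝ projInhom (a • homCoord X) u)
    (fderiv ℝ projInhom (a • homCoord X) v) = _
  rw [fderiv_projInhom haz, fderiv_projInhom haz, ha0, hp, rMapMetric_apply hh hT]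
  have hs : star (a⁻¹ • (Fin.tail v - v 0 • X))
      = (star a)⁻¹ • (Fin.tail (star v) - star v 0 • star X) := by
    ext μ; simp [Fin.tail]
  have hl : ∀ (b c : ℂ) p q, logHess h (imR X) (b • p) (c • q) = b * c * logHess h (imR X) p q := by
    intro b c p q
    simp only [logHess, tri_smul₂, tri_smul₃]; ring
  rw [hs, hl, logHess_eq hh hT, star_smul, bilC_smul_left, bilC_smul_right]
  congr 1
  push_cast
  have hn : (Complex.normSq a : ℂ) = a * star a := (Complex.mul_conj a).symm
  have hsa : star a ≠ 0 := star_ne_zero.2 ha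
  have hf0 : (affinePotential (rMapPrepotential h) (homCoord X) : ℂ) ≠ 0 := by
    rw [affinePotential_homCoord hh]
    exact_mod_cast (by positivity)
  rw [hn]
  field_simp

theorem isProjectiveSpecialKahlerDomain (hpsr : IsProjectiveSpecialReal h U) :
    IsProjectiveSpecialKahlerDomain (rMapCone U) (rMapPrepotential h) (rMapDomain U)
      (rMapMetric h) where
  conical := isConicalSpecialKahlerDomain hpsr
  zero_ne z hz := (mem_rMapCone_iff.1 hz).1
  image_eq := by
    ext X
    constructor
    · rintro ⟨z, hz, rfl⟩
      exact (mem_rMapCone_iff.1 hz).2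
    · intro hX
      exact ⟨homCoord X, ⟨1, one_ne_zero, X, hX, (one_smul _ _).symm⟩, by
        ext μ; simp [projInhom, homCoord]⟩
  pullback_eq z hz := pullback_rMapMetric hpsr hz

end ProjectiveDomain

/-! ### The quaternionic model and a factorisation of the Kähler metric -/

section Model

/-- A real isomorphism onto `ℂ^m × ℂ^m` transports the standard quaternionic structure. -/
theorem exists_quaternionic_of_bijective {E ι : Type*} [NormedAddCommGroup E] [NormedSpace ℝ E]
    [FiniteDimensional ℝ E] (Φ : E →ₗ[ℝ] (ι → ℂ) × (ι → ℂ)) (hΦ : Function.Bijective Φ) :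
    ∃ J : Fin 3 → E →L[ℝ] E, (∀ a, J a * J a = -1) ∧ J 0 * J 1 = J 2 ∧
      (∀ v, Φ (J 0 v) = (Complex.I • (Φ v).1, Complex.I • (Φ v).2)) ∧
      (∀ v, Φ (J 1 v) = (-star (Φ v).2, star (Φ v).1)) := by
  let e := LinearEquiv.ofBijective Φ hΦ
  let I0 : ((ι → ℂ) × (ι → ℂ)) →ₗ[ℝ] (ι → ℂ) × (ι → ℂ) :=
    { toFun := fun p => (Complex.I • p.1, Complex.I • p.2)
      map_add' := fun p q => by simp
      map_smul' := fun r p => by ext i <;> simp <;> ring }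
  -- This map is antilinear, so it anticommutes with multiplication by i, and it squares to -1.
  let I1 : ((ι → ℂ) × (ι → ℂ)) →ₗ[ℝ] (ι → ℂ) × (ι → ℂ) :=
    { toFun := fun p => (-star p.2, star p.1)
      map_add' := fun p q => by ext i <;> simp; ring
      map_smul' := fun r p => by ext i <;> simp }
  let T : (((ι → ℂ) × (ι → ℂ)) →ₗ[ℝ] (ι → ℂ) × (ι → ℂ)) → E →L[ℝ] E := fun A =>
    LinearMap.toContinuousLinearMap (e.symm.toLinearMap ∘ₗ A ∘ₗ e.toLinearMap)
  have hT : ∀ A v, Φ (T A v) = A (Φ v) := fun A v => e.apply_symm_apply _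
  have hinj : ∀ v w, Φ v = Φ w → v = w := fun v w h => hΦ.1 h
  refine ⟨![T I0, T I1, T I0 * T I1], ?_, rfl, hT I0, hT I1⟩
  have h0 : ∀ v, Φ (T I0 (T I0 v)) = - Φ v := by
    intro v
    rw [hT, hT]
    ext i <;> simp [I0, ← mul_assoc]
  have h1 : ∀ v, Φ (T I1 (T I1 v)) = - Φ v := by
    intro v
    rw [hT, hT]
    ext i <;> simp [I1]
  have h2 : ∀ v, Φ (T I0 (T I1 (T I0 (T I1 v)))) = - Φ v := by
    intro v
    rw [hT, hT, hT, hT]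
    ext i <;> simp [I0, I1, ← mul_assoc]
  intro a
  ext v
  apply hinj
  change Φ _ = Φ (-v)
  rw [map_neg]
  fin_cases a
  · exact h0 v
  · exact h1 v
  · exact h2 v

variable {n : ℕ} {h : MvPolynomial (Fin n) ℝ}

theorem logHess_sum (x : Fin n → ℝ) (u v : Fin n → ℂ) :
    logHess h x u v =
      ∑ μ, ∑ ν, (((-6 * tri h x (Pi.single μ 1) (Pi.single ν 1) / tri h x x x
        + 9 * tri h x x (Pi.single μ 1) * tri h x x (Pi.single ν 1) / tri h x x x ^ 2) / 4 : ℝ) : ℂ)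
        * (u μ * v ν) := by
  have hs : ∀ μ : Fin n, cx (Pi.single μ 1) = Pi.single μ 1 := by
    intro μ; ext ν; simp only [cx, Pi.single_apply]; split_ifs <;> simp
  push_cast
  simp only [← tri_cx, hs]
  rw [logHess, ← tri_cx, ← sum_mul_tri_single₂ (cx x) v u,
    ← sum_mul_tri_single₃ (cx x) (cx x) u]
  simp only [Finset.mul_sum, Finset.sum_mul, Finset.sum_div, ← Finset.sum_add_distrib]
  refine Finset.sum_congr rfl fun μ _ => ?_
  rw [← sum_mul_tri_single₃ (cx x) (Pi.single μ 1) v,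
    ← sum_mul_tri_single₃ (cx x) (cx x) v]
  simp only [Finset.mul_sum, Finset.sum_div, ← Finset.sum_add_distrib]
  refine Finset.sum_congr rfl fun ν _ => ?_
  ring

theorem logHess_cx (x u v : Fin n → ℝ) :
    logHess h x (cx u) (cx v) = (((-6 * tri h x u v / tri h x x x
        + 9 * tri h x x u * tri h x x v / tri h x x x ^ 2) / 4 : ℝ) : ℂ) := by
  simp only [logHess, tri_cx]
  push_cast
  ring

/-- For v = lx + w the value is 3l² - 6 tri(x, w, w)/tri(x, x, x): passing to -log h reverses the
sign along x and makes the Lorentzian form definite. -/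
theorem IsHyperbolicPoint.logHess_pos {x : Fin n → ℝ} (hx : IsHyperbolicPoint h x)
    {v : Fin n → ℝ} (hv : v ≠ 0) : 0 < -6 * tri h x v v / tri h x x x
        + 9 * tri h x x v * tri h x x v / tri h x x x ^ 2 := by
  obtain ⟨l, w, hvw, -, h1, h2, h3, h4⟩ := hx.decomp v
  have hT := hx.pos
  rw [h1, h2]
  have e : -6 * (l ^ 2 * tri h x x x + tri h x w w) / tri h x x x
      + 9 * (l * tri h x x x) * (l * tri h x x x) / tri h x x x ^ 2
      = 3 * l ^ 2 + 6 * (-tri h x w w / tri h x x x) := by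
    field_simp; ring
  rw [e]
  by_cases hl : l = 0
  · have hw : tri h x w w ≠ 0 := fun h0 => hv (by rw [hvw, hl, h4 h0]; simp)
    have : 0 < -tri h x w w := by
      rcases h3.lt_or_eq with h | h
      · linarith
      · exact absurd h hw
    positivity
  · have : 0 ≤ -tri h x w w := by linarith
    positivity

/-- L is a real factor of the positive definite real matrix, extended complex-linearly. Since it
commutes with conjugation, it handles logHess(u, v) and logHess(u, v̄) alike. No regularity in x is
claimed. -/
theorem IsHyperbolicPoint.exists_logHess_factor {x : Fin n → ℝ} (hx : IsHyperbolicPoint h x) :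
    ∃ L : (Fin n → ℂ) →ₗ[ℂ] (Fin n → ℂ), Function.Injective L ∧
      (∀ v, L (star v) = star (L v)) ∧ ∀ u v, logHess h x u v = ∑ i, L u i * L v i := by
  let B : Matrix (Fin n) (Fin n) ℝ := Matrix.of fun μ ν =>
    (-6 * tri h x (Pi.single μ 1) (Pi.single ν 1) / tri h x x x
        + 9 * tri h x x (Pi.single μ 1) * tri h x x (Pi.single ν 1) / tri h x x x ^ 2) / 4
  have hB : B.PosDef := by
    refine Matrix.PosDef.of_dotProduct_mulVec_pos ?_ fun v hv => ?_
    · ext μ ν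
      simp only [B, Matrix.conjTranspose_apply, Matrix.of_apply, star_trivial]
      rw [tri_comm₂₃ h x (Pi.single ν 1)]
      ring
    · have h1 := hx.logHess_pos hv
      have h2 := logHess_cx (h := h) x v v
      rw [logHess_sum] at h2
      have h3 : ((star v ⬝ᵥ B.mulVec v : ℝ) : ℂ) =
          ((-6 * tri h x v v / tri h x x x
            + 9 * tri h x x v * tri h x x v / tri h x x x ^ 2) / 4 : ℝ) := by
        rw [star_trivial, ofReal_dotProduct_mulVec, bilC]
        refine Eq.trans ?_ h2
        refine Finset.sum_congr rfl fun i _ => Finset.sum_congr rfl fun j _ => ?_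
        simp only [B, Matrix.of_apply, cx]
        ring
      rw [Complex.ofReal_inj] at h3
      rw [h3]
      linarith
  obtain ⟨S, hS, hBS⟩ := posDef_exists_factor hB
  have hS' : IsUnit (S.map (Complex.ofRealHom : ℝ → ℂ)).det := by
    have := hS.map Complex.ofRealHom
    rwa [RingHom.map_det] at this
  refine ⟨(S.map Complex.ofRealHom).mulVecLin, ?_, fun v => ?_, fun u v => ?_⟩
  · exact Matrix.mulVec_injective_of_isUnit ((Matrix.isUnit_iff_isUnit_det _).2 hS')
  · ext i
    simp [Matrix.mulVec, dotProduct]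
  · rw [logHess_sum]
    have hb : ∀ μ ν, (-6 * tri h x (Pi.single μ 1) (Pi.single ν 1) / tri h x x x
        + 9 * tri h x x (Pi.single μ 1) * tri h x x (Pi.single ν 1) / tri h x x x ^ 2) / 4
        = ∑ i, S i μ * S i ν := by
      intro μ ν
      have := congrFun (congrFun hBS μ) ν
      simpa [Matrix.mul_apply, B] using this
    simp only [hb, Matrix.mulVecLin_apply, Matrix.mulVec, dotProduct, Matrix.map_apply,
      Complex.ofRealHom_eq_coe, Finset.sum_mul_sum,
      Complex.ofReal_sum, Complex.ofReal_mul]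
    refine Eq.symm (Eq.trans ?_ (Finset.sum_congr rfl fun μ _ => Finset.sum_congr rfl fun ν _ =>
      (Finset.sum_mul _ _ _).symm))
    rw [Finset.sum_comm]
    refine Finset.sum_congr rfl fun μ _ => ?_
    rw [Finset.sum_comm]
    refine Finset.sum_congr rfl fun ν _ => Finset.sum_congr rfl fun i _ => ?_
    ring

end Model

/-! ### N-dual vectors of the fibre coordinates -/

section GaugeCouplings

variable {n : ℕ} {h : MvPolynomial (Fin n) ℝ}

variable (h) in
/-- The matrix `N` at `(1, X)`, with complex entries. -/
def matNC (X : Fin n → ℂ) : Matrix (Fin (n + 1)) (Fin (n + 1)) ℂ :=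
  (matNX h X).map Complex.ofRealHom

theorem bilC_eq_dotProduct (X : Fin n → ℂ) (u v : Fin (n + 1) → ℂ) :
    bilC (matNX h X) u v = u ⬝ᵥ (matNC h X).mulVec v := by
  simp only [bilC, matNC, dotProduct, Matrix.mulVec, Finset.mul_sum, Matrix.map_apply,
    Complex.ofRealHom_eq_coe]
  refine Finset.sum_congr rfl fun i _ => Finset.sum_congr rfl fun j _ => ?_
  ring

theorem isUnit_det_matNC (hh : h.IsHomogeneous 3) {X : Fin n → ℂ}
    (hX : IsHyperbolicPoint h (imR X)) : IsUnit (matNC h X).det := by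
  have := (hasSignatureOneN_matNX hh hX).isUnit_det.map Complex.ofRealHom
  rwa [RingHom.map_det] at this

theorem matNC_transpose (hh : h.IsHomogeneous 3) (X : Fin n → ℂ) :
    (matNC h X).transpose = matNC h X := by
  rw [matNC, ← Matrix.transpose_map, matNX_transpose hh]

theorem star_matNC_mulVec (X : Fin n → ℂ) (u : Fin (n + 1) → ℂ) :
    star ((matNC h X).mulVec u) = (matNC h X).mulVec (star u) := by
  ext i
  simp [matNC, Matrix.mulVec, dotProduct]

variable (h) in
/-- The complex covector `dζ̃_I + F_{IJ} dζ^J`. -/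
def perVec (X : Fin n → ℂ) (a b : Fin (n + 1) → ℝ) : Fin (n + 1) → ℂ :=
  (fun i => (a i : ℂ)) + (hessF (rMapPrepotential h) (homCoord X)).mulVec fun i => (b i : ℂ)

variable (h) in
/-- The vector which is `N`-dual to `dζ̃_I + F_{IJ} dζ^J`. -/
def cotVec (X : Fin n → ℂ) (a b : Fin (n + 1) → ℝ) : Fin (n + 1) → ℂ :=
  ((matNC h X)⁻¹).mulVec (perVec h X a b)

theorem matNC_mulVec_cotVec (hh : h.IsHomogeneous 3) {X : Fin n → ℂ}
    (hX : IsHyperbolicPoint h (imR X)) (a b : Fin (n + 1) → ℝ) :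
    (matNC h X).mulVec (cotVec h X a b) = perVec h X a b := by
  rw [cotVec, Matrix.mulVec_mulVec, Matrix.mul_nonsing_inv _ (isUnit_det_matNC hh hX),
    Matrix.one_mulVec]

theorem matNC_mulVec_injective (hh : h.IsHomogeneous 3) {X : Fin n → ℂ}
    (hX : IsHyperbolicPoint h (imR X)) : Function.Injective (matNC h X).mulVec :=
  Matrix.mulVec_injective_of_isUnit
    ((Matrix.isUnit_iff_isUnit_det _).2 (isUnit_det_matNC hh hX))

theorem matNC_eq (X : Fin n → ℂ) : matNC h X = (-Complex.I) •
    (hessF (rMapPrepotential h) (homCoord X)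
      - (hessF (rMapPrepotential h) (homCoord X)).map (starRingEnd ℂ)) := by
  ext i j
  simp only [matNC, matNX, matN, Matrix.map_apply, Matrix.of_apply, Matrix.smul_apply,
    Matrix.sub_apply, Complex.sub_conj, smul_eq_mul, Complex.ofRealHom_eq_coe]
  push_cast
  linear_combination (2 * ((hessF (rMapPrepotential h) (homCoord X) i j).im : ℂ)) * Complex.I_sq

theorem star_perVec (X : Fin n → ℂ) (a b : Fin (n + 1) → ℝ) :
    star (perVec h X a b) = (fun i => (a i : ℂ)) +
      ((hessF (rMapPrepotential h) (homCoord X)).map (starRingEnd ℂ)).mulVec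
        fun i => (b i : ℂ) := by
  ext i
  simp [perVec, Matrix.mulVec, dotProduct]

theorem perVec_sub_star (X : Fin n → ℂ) (a b : Fin (n + 1) → ℝ) :
    perVec h X a b - star (perVec h X a b)
      = (matNC h X).mulVec (Complex.I • fun i => (b i : ℂ)) := by
  rw [star_perVec, perVec, matNC_eq, Matrix.smul_mulVec, Matrix.mulVec_smul, smul_smul,
    Matrix.sub_mulVec]
  simp

/-- As F - F̄ = iN, the imaginary part of the dual vector is dζ/2. This is how reality of the fibre
coordinates appears on the dual side. -/
theorem cotVec_sub_star (hh : h.IsHomogeneous 3) {X : Fin n → ℂ}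
    (hX : IsHyperbolicPoint h (imR X)) (a b : Fin (n + 1) → ℝ) :
    cotVec h X a b - star (cotVec h X a b) = Complex.I • fun i => (b i : ℂ) := by
  apply matNC_mulVec_injective hh hX
  rw [Matrix.mulVec_sub, ← star_matNC_mulVec, matNC_mulVec_cotVec hh hX, perVec_sub_star]

theorem bilC_cotVec (hh : h.IsHomogeneous 3) {X : Fin n → ℂ}
    (hX : IsHyperbolicPoint h (imR X)) (u : Fin (n + 1) → ℂ) (a b : Fin (n + 1) → ℝ) :
    bilC (matNX h X) u (cotVec h X a b) = u ⬝ᵥ perVec h X a b := by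
  rw [bilC_eq_dotProduct, matNC_mulVec_cotVec hh hX]

/-- The contact curvature in terms of dual vectors. -/
theorem im_bilC_cotVec (hh : h.IsHomogeneous 3) {X : Fin n → ℂ}
    (hX : IsHyperbolicPoint h (imR X)) (a b a' b' : Fin (n + 1) → ℝ) :
    2 * (bilC (matNX h X) (star (cotVec h X a b)) (cotVec h X a' b')).im
      = a ⬝ᵥ b' - b ⬝ᵥ a' := by
  set N := matNX h X
  set u := cotVec h X a b with hu
  set u' := cotVec h X a' b' with hu'
  have hN : N.transpose = N := matNX_transpose hh X
  -- The difference of the two pairings involves N only through u - ū and u' - ū', where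
  -- `cotVec_sub_star` and duality eliminate it. The terms with F then cancel by symmetry.
  have e1 : bilC N (star u) u' - bilC N u (star u') =
      bilC N u (u' - star u') - bilC N (u - star u) u' := by
    simp only [sub_eq_add_neg, ← neg_one_smul ℂ (star u), ← neg_one_smul ℂ (star u'),
      bilC_add_left, bilC_add_right, bilC_smul_left, bilC_smul_right]
    ring
  rw [cotVec_sub_star hh hX, cotVec_sub_star hh hX, bilC_smul_left, bilC_smul_right,
    bilC_comm hN u fun i => (b' i : ℂ), hu, bilC_cotVec hh hX _ a b, ← hu, hu',
    bilC_cotVec hh hX (fun i => (b i : ℂ)) a' b', ← hu'] at e1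
  have e2 : (starRingEnd ℂ) (bilC N (star u) u') = bilC N u (star u') := by
    rw [star_bilC, star_star]
  rw [← e2, Complex.sub_conj] at e1
  have hF : (fun i => (b' i : ℂ)) ⬝ᵥ (hessF (rMapPrepotential h) (homCoord X)).mulVec
      (fun i => (b i : ℂ)) = (fun i => (b i : ℂ)) ⬝ᵥ
      (hessF (rMapPrepotential h) (homCoord X)).mulVec (fun i => (b' i : ℂ)) := by
    rw [Matrix.dotProduct_mulVec, ← Matrix.mulVec_transpose, dotProduct_comm]
    congr 2
    ext i j
    exact hessF_symm hh (homCoord_ne X) j i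
  have hc : ∀ x y : Fin (n + 1) → ℝ, (fun i => (x i : ℂ)) ⬝ᵥ (fun i => (y i : ℂ))
      = ((x ⬝ᵥ y : ℝ) : ℂ) := by
    intro x y; simp [dotProduct]
  rw [perVec, perVec, dotProduct_add, dotProduct_add, hF, hc, hc] at e1
  have e3 : ((2 * (bilC N (star u) u').im : ℝ) : ℂ) = ((a ⬝ᵥ b' - b ⬝ᵥ a' : ℝ) : ℂ) := by
    have hI := Complex.I_ne_zero
    apply mul_right_cancel₀ hI
    rw [e1, dotProduct_comm a b']
    push_cast
    ring
  exact Complex.ofReal_injective e3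

/-- For a cubic h this product is real: it equals -16 h(x) = -2f. It is the denominator in 𝒩, hence
nonzero where h > 0. -/
theorem bilC_homCoord_self (hh : h.IsHomogeneous 3) (X : Fin n → ℂ) :
    bilC (matNX h X) (homCoord X) (homCoord X)
      = -(8 / 3) * (tri h (imR X) (imR X) (imR X) : ℝ) := by
  rw [bilC_matNX hh, vert_homCoord, homCoord_zero, tri_smul₂, tri_smul₃, tri_cx,
    ← mul_assoc Complex.I, Complex.I_mul_I]
  ring

theorem bilC_homCoord_star (hh : h.IsHomogeneous 3) (X : Fin n → ℂ) :
    bilC (matNX h X) (homCoord X) (star (homCoord X))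
      = (affinePotential (rMapPrepotential h) (homCoord X) : ℝ) := by
  rw [affinePotential_homCoord hh, bilC_matNX hh, vert_homCoord, vert_star_homCoord,
    star_homCoord_zero, homCoord_zero, tri_neg₃, tri_smul₂, tri_smul₃, tri_cx, ← mul_assoc,
    Complex.I_mul_I]
  push_cast
  ring

end GaugeCouplings

/-! ### The gauge matrix and the fibre metric -/

section FibreMetric

variable {n : ℕ} {h : MvPolynomial (Fin n) ℝ}

theorem cx_dotProduct {m : ℕ} (u v : Fin m → ℝ) : cx u ⬝ᵥ cx v = ((u ⬝ᵥ v : ℝ) : ℂ) := by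
  simp [dotProduct, cx]

theorem map_mulVec_cx {m : ℕ} (M : Matrix (Fin m) (Fin m) ℝ) (v : Fin m → ℝ) :
    (M.map Complex.ofRealHom).mulVec (cx v) = cx (M.mulVec v) := by
  ext i; simp [Matrix.mulVec, dotProduct, cx]

theorem star_cx {m : ℕ} (v : Fin m → ℝ) : star (cx v) = cx v := by
  ext i; simp [cx]

variable (h) in
/-- The complex matrix of the inverse gauge couplings. -/
def gaugeK (X : Fin n → ℂ) : Matrix (Fin (n + 1)) (Fin (n + 1)) ℂ :=
  (-2 : ℂ) • (matNC h X)⁻¹ +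
    (2 / (affinePotential (rMapPrepotential h) (homCoord X) : ℂ)) •
      (Matrix.vecMulVec (homCoord X) (star (homCoord X))
        + Matrix.vecMulVec (star (homCoord X)) (homCoord X))

theorem affinePotential_pos (hh : h.IsHomogeneous 3) {X : Fin n → ℂ}
    (hX : IsHyperbolicPoint h (imR X)) :
    0 < affinePotential (rMapPrepotential h) (homCoord X) := by
  have := hX.pos
  rw [affinePotential_homCoord hh]; positivity

theorem bilC_homCoord_self' (hh : h.IsHomogeneous 3) (X : Fin n → ℂ) :
    bilC (matNX h X) (homCoord X) (homCoord X)
      = -2 * (affinePotential (rMapPrepotential h) (homCoord X) : ℂ) := by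
  rw [bilC_homCoord_self hh, affinePotential_homCoord hh]; push_cast; ring

theorem gaugeMatrix_eq (hh : h.IsHomogeneous 3) (X : Fin n → ℂ) :
    gaugeMatrix (rMapPrepotential h) X =
      (hessF (rMapPrepotential h) (homCoord X)).map (starRingEnd ℂ) +
      (-(Complex.I / (2 * (affinePotential (rMapPrepotential h) (homCoord X) : ℂ)))) •
        Matrix.vecMulVec ((matNC h X).mulVec (homCoord X)) ((matNC h X).mulVec (homCoord X)) := by
  ext i j
  have e : (∑ K, ∑ L, (matN (rMapPrepotential h) (homCoord X) K L : ℂ) * homCoord X K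
    * homCoord X L) = _ := bilC_homCoord_self' hh X
  have e2 : ∀ i, ∑ K, (matN (rMapPrepotential h) (homCoord X) i K : ℂ) * homCoord X K
    = (matNC h X).mulVec (homCoord X) i := fun i => rfl
  rw [gaugeMatrix, Matrix.of_apply, e, e2, e2]
  simp only [Matrix.add_apply, Matrix.map_apply, Matrix.smul_apply, Matrix.vecMulVec_apply,
    smul_eq_mul]
  rw [neg_mul, div_neg]
  ring

theorem gaugeMatrix_symm (hh : h.IsHomogeneous 3) (X : Fin n → ℂ) :
    (gaugeMatrix (rMapPrepotential h) X).transpose = gaugeMatrix (rMapPrepotential h) X := by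
  ext i j
  rw [Matrix.transpose_apply, gaugeMatrix, Matrix.of_apply, Matrix.of_apply,
    hessF_symm hh (homCoord_ne X) j i]
  ring

theorem gaugeR_symm (hh : h.IsHomogeneous 3) (X : Fin n → ℂ) :
    (gaugeR (rMapPrepotential h) X).transpose = gaugeR (rMapPrepotential h) X := by
  rw [gaugeR, ← Matrix.transpose_map, gaugeMatrix_symm hh]

theorem gaugeI_map (hh : h.IsHomogeneous 3) (X : Fin n → ℂ) :
    (gaugeI (rMapPrepotential h) X).map Complex.ofRealHom =
      (-(1 / 2) : ℂ) • matNC h X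
      + (-(1 / (4 * (affinePotential (rMapPrepotential h) (homCoord X) : ℂ)))) •
        (Matrix.vecMulVec ((matNC h X).mulVec (homCoord X)) ((matNC h X).mulVec (homCoord X))
        + Matrix.vecMulVec ((matNC h X).mulVec (star (homCoord X)))
          ((matNC h X).mulVec (star (homCoord X)))) := by
  have hs : ∀ i, (matNC h X).mulVec (star (homCoord X)) i
      = (starRingEnd ℂ) ((matNC h X).mulVec (homCoord X) i) := fun i =>
    (congrFun (star_matNC_mulVec X (homCoord X)) i).symm
  rw [gaugeI, gaugeMatrix_eq hh]
  ext i j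
  have hm : matNC h X i j = -Complex.I * (hessF (rMapPrepotential h) (homCoord X) i j -
      (starRingEnd ℂ) (hessF (rMapPrepotential h) (homCoord X) i j)) :=
    congrFun (congrFun (matNC_eq X) i) j
  simp only [Matrix.map_apply, Matrix.add_apply, Matrix.smul_apply, Matrix.vecMulVec_apply,
    smul_eq_mul, Complex.ofRealHom_eq_coe, hs]
  rw [hm]
  generalize (matNC h X).mulVec (homCoord X) i = p
  generalize (matNC h X).mulVec (homCoord X) j = q
  generalize hessF (rMapPrepotential h) (homCoord X) i j = F
  generalize affinePotential (rMapPrepotential h) (homCoord X) = f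
  have e : ∀ w : ℂ, (w.im : ℂ) = (-Complex.I / 2) * (w - (starRingEnd ℂ) w) := by
    intro w
    rw [Complex.sub_conj]
    push_cast
    linear_combination (w.im : ℂ) * Complex.I_sq
  rw [e]
  simp only [map_add, map_mul, Complex.conj_conj, map_neg, map_div₀, Complex.conj_I,
    Complex.conj_ofReal, map_ofNat]
  ring_nf
  simp only [Complex.I_sq]
  ring

/-- ℐ is -N/2 plus rank-one terms in Nz and Nz̄, with z = (1, X), and the inverse has the analogous
shape. The coefficients match because the N-products among z and z̄ are only -2f and f. -/
theorem gaugeI_mul_gaugeK (hh : h.IsHomogeneous 3) {X : Fin n → ℂ}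
    (hX : IsHyperbolicPoint h (imR X)) :
    (gaugeI (rMapPrepotential h) X).map Complex.ofRealHom * gaugeK h X = 1 := by
  have hu := isUnit_det_matNC hh hX
  have hf : (affinePotential (rMapPrepotential h) (homCoord X) : ℂ) ≠ 0 := by
    exact_mod_cast (affinePotential_pos hh hX).ne'
  have h1 : homCoord X ⬝ᵥ (matNC h X).mulVec (homCoord X) = _ :=
    (bilC_eq_dotProduct X _ _).symm.trans (bilC_homCoord_self' hh X)
  have h2 : homCoord X ⬝ᵥ (matNC h X).mulVec (star (homCoord X)) = _ :=
    (bilC_eq_dotProduct X _ _).symm.trans (bilC_homCoord_star hh X)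
  have h3 : star (homCoord X) ⬝ᵥ (matNC h X).mulVec (homCoord X)
      = (affinePotential (rMapPrepotential h) (homCoord X) : ℂ) := by
    rw [← bilC_eq_dotProduct, bilC_comm (matNX_transpose hh X), bilC_homCoord_star hh]
  have h4 : star (homCoord X) ⬝ᵥ (matNC h X).mulVec (star (homCoord X))
      = -2 * (affinePotential (rMapPrepotential h) (homCoord X) : ℂ) := by
    rw [← bilC_eq_dotProduct, ← star_bilC, bilC_homCoord_self' hh, map_mul, Complex.conj_ofReal,
      map_neg, map_ofNat]
  have hinv : ∀ z, Matrix.vecMul ((matNC h X).mulVec z) (matNC h X)⁻¹ = z := by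
    intro z
    rw [← Matrix.vecMul_transpose, matNC_transpose hh, Matrix.vecMul_vecMul,
      Matrix.mul_nonsing_inv _ hu, Matrix.vecMul_one]
  have hK : ∀ z, Matrix.vecMul ((matNC h X).mulVec z) (gaugeK h X) = (-2 : ℂ) • z +
      (2 / (affinePotential (rMapPrepotential h) (homCoord X) : ℂ)) •
        ((homCoord X ⬝ᵥ (matNC h X).mulVec z) • star (homCoord X)
          + (star (homCoord X) ⬝ᵥ (matNC h X).mulVec z) • homCoord X) := by
    intro z
    rw [gaugeK, Matrix.vecMul_add, Matrix.vecMul_smul, hinv, Matrix.vecMul_smul,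
      Matrix.vecMul_add, Matrix.vecMul_vecMulVec, Matrix.vecMul_vecMulVec, dotProduct_comm _ (homCoord X),
      dotProduct_comm _ (star (homCoord X))]
  rw [gaugeI_map hh, add_mul, Matrix.smul_mul, Matrix.smul_mul, add_mul, Matrix.vecMulVec_mul,
    Matrix.vecMulVec_mul, hK, hK, h1, h2, h3, h4, gaugeK, mul_add, Matrix.mul_smul,
    Matrix.mul_smul, Matrix.mul_nonsing_inv _ hu, mul_add, Matrix.mul_vecMulVec,
    Matrix.mul_vecMulVec]
  generalize (matNC h X).mulVec (homCoord X) = e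
  generalize (matNC h X).mulVec (star (homCoord X)) = e'
  generalize star (homCoord X) = z'
  generalize homCoord X = z at *
  generalize (affinePotential (rMapPrepotential h) z : ℂ) = f at *
  ext i j
  simp only [Matrix.add_apply, Matrix.smul_apply, Matrix.vecMulVec_apply, Pi.add_apply,
    Pi.smul_apply, smul_eq_mul]
  field_simp
  ring

theorem gaugeI_isUnit (hh : h.IsHomogeneous 3) {X : Fin n → ℂ}
    (hX : IsHyperbolicPoint h (imR X)) : IsUnit (gaugeI (rMapPrepotential h) X).det := by
  have := congrArg Matrix.det (gaugeI_mul_gaugeK hh hX)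
  rw [Matrix.det_mul, Matrix.det_one] at this
  have h2 : (((gaugeI (rMapPrepotential h) X).map Complex.ofRealHom).det) ≠ 0 :=
    left_ne_zero_of_mul_eq_one this
  rw [isUnit_iff_ne_zero]
  intro h0
  apply h2
  have := RingHom.map_det Complex.ofRealHom (gaugeI (rMapPrepotential h) X)
  rw [h0, map_zero] at this
  exact this.symm

theorem gaugeI_inv_map (hh : h.IsHomogeneous 3) {X : Fin n → ℂ}
    (hX : IsHyperbolicPoint h (imR X)) :
    ((gaugeI (rMapPrepotential h) X)⁻¹).map Complex.ofRealHom = gaugeK h X := by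
  have e : ((gaugeI (rMapPrepotential h) X)⁻¹).map Complex.ofRealHom *
      (gaugeI (rMapPrepotential h) X).map Complex.ofRealHom = 1 := by
    rw [← Matrix.map_mul, Matrix.nonsing_inv_mul _ (gaugeI_isUnit hh hX)]
    exact Matrix.map_one _ (map_zero _) (map_one _)
  rw [← mul_one (((gaugeI (rMapPrepotential h) X)⁻¹).map Complex.ofRealHom),
    ← gaugeI_mul_gaugeK hh hX, ← mul_assoc, e, one_mul]

/-- Completes the square in the block matrix, using the symmetry of ℛ. This already accounts for the
two ways in which the fibre metric is written at c = 0. -/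
theorem matH_dotProduct (hh : h.IsHomogeneous 3) (X : Fin n → ℂ) (a b a' b' : Fin (n + 1) → ℝ) :
    Sum.elim a b ⬝ᵥ (matH (rMapPrepotential h) X).mulVec (Sum.elim a' b') =
      (a + (gaugeR (rMapPrepotential h) X).mulVec b) ⬝ᵥ
        ((gaugeI (rMapPrepotential h) X)⁻¹).mulVec
          (a' + (gaugeR (rMapPrepotential h) X).mulVec b')
      + b ⬝ᵥ (gaugeI (rMapPrepotential h) X).mulVec b' := by
  rw [matH, Matrix.fromBlocks_mulVec, sumElim_dotProduct_sumElim]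
  simp only [Matrix.mulVec_add, add_dotProduct, dotProduct_add, Matrix.add_mulVec,
    ← Matrix.mulVec_mulVec, Function.comp_def,
    Sum.elim_inl, Sum.elim_inr]
  have hR : ∀ w : Fin (n + 1) → ℝ, (gaugeR (rMapPrepotential h) X).mulVec b ⬝ᵥ w
      = b ⬝ᵥ (gaugeR (rMapPrepotential h) X).mulVec w := by
    intro w
    rw [Matrix.dotProduct_mulVec, ← Matrix.mulVec_transpose, gaugeR_symm hh]
  rw [hR, hR]
  ring

/-- The part of a vector transversal to `(1, \bar X)`. -/
def kap (X : Fin n → ℂ) (u : Fin (n + 1) → ℂ) : Fin n → ℂ := Fin.tail u - u 0 • star X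

/-- In terms of dual vectors the fibre metric splits into the Kähler metric on the parts transversal
to (1, X̄) and the square of the period. Both are sums of Hermitian squares, as a unitary coframe
requires. -/
theorem matH_eq (hh : h.IsHomogeneous 3) {X : Fin n → ℂ}
    (hX : IsHyperbolicPoint h (imR X)) (a b a' b' : Fin (n + 1) → ℝ) :
    Sum.elim a b ⬝ᵥ (matH (rMapPrepotential h) X).mulVec (Sum.elim a' b') =
      (2 * (affinePotential (rMapPrepotential h) (homCoord X) : ℂ) *
          logHess h (imR X) (star (kap X (cotVec h X a' b'))) (kap X (cotVec h X a b))
        + 2 / (affinePotential (rMapPrepotential h) (homCoord X) : ℂ) *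
          ((starRingEnd ℂ) (bilC (matNX h X) (homCoord X) (cotVec h X a b)) *
            bilC (matNX h X) (homCoord X) (cotVec h X a' b'))).re := by
  set f := affinePotential (rMapPrepotential h) (homCoord X) with hfdef
  have hf : (f : ℂ) ≠ 0 := by exact_mod_cast (affinePotential_pos hh hX).ne'
  set N := matNX h X
  set z := homCoord X with hz
  have hN : N.transpose = N := matNX_transpose hh X
  -- the vector dual to `a + 𝒩 b`
  let y : (Fin (n + 1) → ℝ) → (Fin (n + 1) → ℝ) → Fin (n + 1) → ℂ := fun a b =>
    star (cotVec h X a b) + ((bilC N z (cotVec h X a b) - bilC N z (star (cotVec h X a b)))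
      / (-2 * f)) • z
  have hzy : ∀ a b, bilC N z (y a b) = bilC N z (cotVec h X a b) := by
    intro a b
    rw [bilC_add_right, bilC_smul_right, bilC_homCoord_self' hh, ← hfdef]
    field_simp
    ring
  -- The multiple of z in y supplies the rank-one term by which 𝒩 differs from F̄.
  have hQ : ∀ a b, (matNC h X).mulVec (y a b) =
      cx (a + (gaugeR (rMapPrepotential h) X).mulVec b)
        + Complex.I • cx ((gaugeI (rMapPrepotential h) X).mulVec b) := by
    intro a b
    have e1 : cx (a + (gaugeR (rMapPrepotential h) X).mulVec b)
        + Complex.I • cx ((gaugeI (rMapPrepotential h) X).mulVec b)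
        = cx a + (gaugeMatrix (rMapPrepotential h) X).mulVec (cx b) := by
      ext i
      simp only [cx, Pi.add_apply, Pi.smul_apply, smul_eq_mul, Matrix.mulVec, dotProduct, gaugeR,
        gaugeI, Matrix.map_apply]
      push_cast
      rw [Finset.mul_sum, add_assoc, ← Finset.sum_add_distrib]
      congr 1
      refine Finset.sum_congr rfl fun j _ => ?_
      conv_rhs => rw [← Complex.re_add_im (gaugeMatrix (rMapPrepotential h) X i j)]
      ring
    have e2 : (matNC h X).mulVec z ⬝ᵥ cx b = -Complex.I *
        (bilC N z (cotVec h X a b) - bilC N z (star (cotVec h X a b))) := by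
      have : bilC N z (cotVec h X a b) - bilC N z (star (cotVec h X a b))
          = bilC N z (cotVec h X a b - star (cotVec h X a b)) := by
        rw [sub_eq_add_neg (cotVec h X a b), ← neg_one_smul ℂ (star (cotVec h X a b)),
          bilC_add_right, bilC_smul_right]
        ring
      rw [this, cotVec_sub_star hh hX, bilC_smul_right, ← mul_assoc, neg_mul, Complex.I_mul_I,
        neg_neg, one_mul, bilC_comm hN, bilC_eq_dotProduct, dotProduct_comm]
      rfl
    rw [e1, gaugeMatrix_eq hh, Matrix.add_mulVec, Matrix.smul_mulVec, Matrix.vecMulVec_mulVec,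
      e2, Matrix.mulVec_add, ← star_matNC_mulVec, matNC_mulVec_cotVec hh hX, star_perVec,
      Matrix.mulVec_smul, ← add_assoc]
    congr 1
    rw [← hfdef]
    ext i
    simp only [Pi.smul_apply, smul_eq_mul, MulOpposite.smul_eq_mul_unop, MulOpposite.unop_op]
    field_simp
    ring_nf
    simp only [Complex.I_sq]
    ring
  -- Since a + 𝒩b has real part a + ℛb and imaginary part ℐb, the two squares of `matH_dotProduct`
  -- form one Hermitian square for ℐ⁻¹.
  have hre : Sum.elim a b ⬝ᵥ (matH (rMapPrepotential h) X).mulVec (Sum.elim a' b') =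
      (star ((matNC h X).mulVec (y a b)) ⬝ᵥ
        (gaugeK h X).mulVec ((matNC h X).mulVec (y a' b'))).re := by
    rw [matH_dotProduct hh, hQ, hQ, ← gaugeI_inv_map hh hX]
    have hb : ((gaugeI (rMapPrepotential h) X)⁻¹).mulVec
        ((gaugeI (rMapPrepotential h) X).mulVec b') = b' := by
      rw [Matrix.mulVec_mulVec, Matrix.nonsing_inv_mul _ (gaugeI_isUnit hh hX), Matrix.one_mulVec]
    have hIs : (gaugeI (rMapPrepotential h) X).mulVec b ⬝ᵥ b'
        = b ⬝ᵥ (gaugeI (rMapPrepotential h) X).mulVec b' := by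
      rw [Matrix.dotProduct_mulVec, ← Matrix.mulVec_transpose, gaugeI, ← Matrix.transpose_map,
        gaugeMatrix_symm hh]
    rw [star_add, star_smul, star_cx, star_cx, Matrix.mulVec_add (Matrix.map _ _), Matrix.mulVec_smul,
      map_mulVec_cx, map_mulVec_cx, hb]
    simp only [add_dotProduct, dotProduct_add, smul_dotProduct, dotProduct_smul, cx_dotProduct,
      hIs]
    simp
  rw [hre]
  congr 1
  have hl : (gaugeK h X).mulVec ((matNC h X).mulVec (y a' b')) = (-2 : ℂ) • y a' b' +
      (2 / (f : ℂ)) • (bilC N (star z) (y a' b') • z + bilC N z (y a' b') • star z) := by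
    rw [gaugeK, Matrix.add_mulVec, Matrix.smul_mulVec, Matrix.mulVec_mulVec,
      Matrix.nonsing_inv_mul _ (isUnit_det_matNC hh hX), Matrix.one_mulVec, Matrix.smul_mulVec,
      Matrix.add_mulVec, Matrix.vecMulVec_mulVec, Matrix.vecMulVec_mulVec, bilC_eq_dotProduct,
      bilC_eq_dotProduct]
    simp only [op_smul_eq_smul]
    rfl
  rw [hl, star_matNC_mulVec, dotProduct_comm]
  simp only [add_dotProduct, smul_dotProduct, smul_eq_mul, ← bilC_eq_dotProduct]
  have hk : kap X (cotVec h X a b) = Fin.tail (star (y a b)) - star (y a b) 0 • star X := by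
    ext μ
    simp only [kap, y, star_add, star_star, star_smul, Pi.sub_apply, Pi.add_apply, Fin.tail,
      Pi.smul_apply, smul_eq_mul, Pi.star_apply, hz, homCoord_zero]
    simp [homCoord]
    ring
  have hk' : star (kap X (cotVec h X a' b')) = Fin.tail (y a' b') - y a' b' 0 • X := by
    ext μ
    simp only [kap, y, Pi.sub_apply, Pi.add_apply, Fin.tail, star_sub,
      Pi.smul_apply, smul_eq_mul, Pi.star_apply, hz, homCoord_zero]
    simp [homCoord]
    ring
  rw [hk, hk', logHess_eq hh hX.pos, ← hfdef]
  have c1 : (starRingEnd ℂ) (bilC N z (cotVec h X a b)) = bilC N (star z) (star (y a b)) := by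
    rw [← hzy, star_bilC]
  rw [c1, ← hzy a' b', bilC_comm hN (y a' b') (star z)]
  field_simp
  ring

end FibreMetric

/-! ### The one-loop metric in Hermitian form -/

section OneLoopMetric

variable {n : ℕ} {h : MvPolynomial (Fin n) ℝ}

theorem kahlerPotential_eq (hh : h.IsHomogeneous 3) :
    kahlerPotential (rMapPrepotential h) = (rMapPotential h : (Fin n → ℂ) → ℝ) := by
  ext X
  rw [kahlerPotential, affinePotential_homCoord hh, rMapPotential_eq hh]

theorem dC_kahlerPotential (hh : h.IsHomogeneous 3) {X : Fin n → ℂ}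
    (hX : 0 < tri h (imR X) (imR X) (imR X)) (v : Fin n → ℂ) :
    dC (kahlerPotential (rMapPrepotential h)) X v
      = 3 * tri h (imR X) (imR X) (reR v) / tri h (imR X) (imR X) (imR X) := by
  have e : imR (stdJ v) = reR v := by ext μ; simp [imR, reR, stdJ]
  change -(fderiv ℝ (kahlerPotential (rMapPrepotential h)) X (stdJ v)) = _
  rw [kahlerPotential_eq hh, fderiv_rMapPotential hh hX, e, neg_neg]

theorem contactForm_apply (p v : CMapSpace n) :
    contactForm p v = v.2.2.1 + (p.2.2.2.2 ⬝ᵥ v.2.2.2.1 - p.2.2.2.1 ⬝ᵥ v.2.2.2.2) := by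
  simp only [contactForm, add_apply, sum_apply, sub_apply, smul_apply, smul_eq_mul, dotProduct,
    ← Finset.sum_sub_distrib]
  rfl

theorem gradF_homCoord (hh : h.IsHomogeneous 3) (X : Fin n → ℂ) (I : Fin (n + 1)) :
    holDeriv I (rMapPrepotential h) (homCoord X)
      = ∑ J, hessF (rMapPrepotential h) (homCoord X) I J * homCoord X J := by
  rw [holDeriv_prepotential hh (homCoord_ne X)]
  simp only [hessF_prepotential hh (homCoord_ne X), hessB_sum_right]
  simp only [gradF, hessB, tail_homCoord, homCoord_zero, tri_comm₂₃ h X _ X]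
  ring

/-- By Euler's relation F_I = ∑ F_{IJ} X^J, the period form is (1, X) paired with the covector dζ̃ +
F dζ, that is, an N-product with the dual vector. -/
theorem periodForm_apply (hh : h.IsHomogeneous 3) {X : Fin n → ℂ}
    (hX : IsHyperbolicPoint h (imR X)) (v : CMapSpace n) :
    periodForm (rMapPrepotential h) X v
      = bilC (matNX h X) (homCoord X) (cotVec h X v.2.2.2.1 v.2.2.2.2) := by
  rw [bilC_cotVec hh hX, perVec, dotProduct_add]
  simp only [periodForm, sum_apply, add_apply, Finset.sum_add_distrib]
  congr 1
  simp only [gradF_homCoord hh, dotProduct, Matrix.mulVec, Finset.mul_sum]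
  rw [Finset.sum_comm]
  refine Finset.sum_congr rfl fun I _ => ?_
  change (∑ J, _) * ((v.2.2.2.2 I : ℝ) : ℂ) = _
  rw [Finset.sum_mul]
  refine Finset.sum_congr rfl fun J _ => ?_
  rw [hessF_symm hh (homCoord_ne X) I J]
  ring

variable (h) in
/-- The one-form `dφ̃ + ∑ (ζ^I dζ̃_I - ζ̃_I dζ^I) + c d^c𝒦`. -/
def connForm (c : ℝ) (p : CMapSpace n) : CMapSpace n →L[ℝ] ℝ :=
  contactForm p + c • (dC (kahlerPotential (rMapPrepotential h)) p.1 ∘L dX)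

variable (h) in
/-- The transversal part of the vector dual to the periods. -/
def kapV (X : Fin n → ℂ) (v : CMapSpace n) : Fin n → ℂ :=
  kap X (cotVec h X v.2.2.2.1 v.2.2.2.2)

theorem logHess_comm (x : Fin n → ℝ) (u v : Fin n → ℂ) : logHess h x u v = logHess h x v u := by
  rw [logHess, logHess, tri_comm₂₃ h (cx x) u v]; ring

theorem sum_sum_mul_eq_dotProduct {ι : Type*} [Fintype ι] (M : Matrix ι ι ℝ) (v w : ι → ℝ) :
    ∑ i, ∑ j, M i j * (v i * w j) = v ⬝ᵥ M.mulVec w := by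
  simp only [dotProduct, Matrix.mulVec, Finset.mul_sum]
  refine Finset.sum_congr rfl fun i _ => Finset.sum_congr rfl fun j _ => ?_
  ring

theorem sum_matH (X : Fin n → ℂ) (v w : CMapSpace n) :
    ∑ a, ∑ b, matH (rMapPrepotential h) X a b * (dP a v * dP b w) =
      Sum.elim v.2.2.2.1 v.2.2.2.2 ⬝ᵥ (matH (rMapPrepotential h) X).mulVec
        (Sum.elim w.2.2.2.1 w.2.2.2.2) := by
  have hd : ∀ (v : CMapSpace n) a, dP a v = Sum.elim v.2.2.2.1 v.2.2.2.2 a := by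
    rintro v (a | a) <;> rfl
  simp only [hd, sum_sum_mul_eq_dotProduct]

/-- The period part of Ĥ has weight 1/(ρf) and the one-loop term weight 2c/(ρ²f), as e^𝒦 = 1/f.
Together they give the coefficient (ρ + 2c)/(ρ²f). -/
theorem oneLoopMetric_apply (hh : h.IsHomogeneous 3) {c : ℝ} (hc : 0 ≤ c) {p : CMapSpace n}
    (hX : IsHyperbolicPoint h (imR p.1)) (hρ : 0 < p.2.1) (v w : CMapSpace n) :
    oneLoopMetric (rMapMetric h) (rMapPrepotential h) c p v w =
      (p.2.1 + c) / p.2.1 * (logHess h (imR p.1) v.1 (star w.1)).re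
      + 1 / (4 * p.2.1 ^ 2) * ((p.2.1 + 2 * c) / (p.2.1 + c)) * (v.2.1 * w.2.1)
      + 1 / (4 * p.2.1 ^ 2) * ((p.2.1 + c) / (p.2.1 + 2 * c))
          * (connForm h c p v * connForm h c p w)
      + affinePotential (rMapPrepotential h) (homCoord p.1) / p.2.1 *
          (logHess h (imR p.1) (kapV h p.1 v) (star (kapV h p.1 w))).re
      + (p.2.1 + 2 * c) / (p.2.1 ^ 2 * affinePotential (rMapPrepotential h) (homCoord p.1)) *
          (periodForm (rMapPrepotential h) p.1 v *
            (starRingEnd ℂ) (periodForm (rMapPrepotential h) p.1 w)).re := by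
  have hf := affinePotential_pos hh hX
  set f := affinePotential (rMapPrepotential h) (homCoord p.1) with hfd
  have e1 : ∑ a, ∑ b, matH (rMapPrepotential h) p.1 a b * (dP a v * dP b w)
      = 2 * f * (logHess h (imR p.1) (kapV h p.1 v) (star (kapV h p.1 w))).re
        + 2 / f * (periodForm (rMapPrepotential h) p.1 v *
            (starRingEnd ℂ) (periodForm (rMapPrepotential h) p.1 w)).re := by
    rw [sum_matH, matH_eq hh hX, ← hfd, ← periodForm_apply hh hX, ← periodForm_apply hh hX,
      logHess_comm, Complex.add_re]
    have c1 : ∀ w : ℂ, (2 * (f : ℂ) * w).re = 2 * f * w.re := by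
      intro w
      rw [show (2 * (f : ℂ)) = ((2 * f : ℝ) : ℂ) by push_cast; ring, Complex.re_ofReal_mul]
    have c2 : ∀ w : ℂ, (2 / (f : ℂ) * w).re = 2 / f * w.re := by
      intro w
      rw [show (2 / (f : ℂ)) = ((2 / f : ℝ) : ℂ) by push_cast; ring, Complex.re_ofReal_mul]
    rw [c1, c2]
    congr 2
    simp only [Complex.mul_re, Complex.conj_re, Complex.conj_im]
    ring
  have hK : Real.exp (kahlerPotential (rMapPrepotential h) p.1) = f⁻¹ := by
    rw [kahlerPotential, Real.exp_neg, Real.exp_log hf]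
  have hm : rMapMetric h p.1 v.1 w.1 = _ := rMapMetric_apply hh hX.pos v.1 w.1
  have hpb : pullbackForm dX (rMapMetric h p.1) v w = rMapMetric h p.1 v.1 w.1 := rfl
  simp only [oneLoopMetric, add_apply, smul_apply, sum_apply, smul_eq_mul, sqForm,
    hermForm_apply]
  rw [hK, hpb, hm]
  have e2 : ∑ x, ∑ y, matH (rMapPrepotential h) p.1 x y * (tensorForm (dP x) (dP y)) v w
      = ∑ a, ∑ b, matH (rMapPrepotential h) p.1 a b * (dP a v * dP b w) := rfl
  rw [e2, e1]
  change (p.2.1 + c) / p.2.1 * _ + 1 / (4 * p.2.1 ^ 2) * ((p.2.1 + 2 * c) / (p.2.1 + c)) *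
    (v.2.1 * w.2.1) + 1 / (4 * p.2.1 ^ 2) * ((p.2.1 + c) / (p.2.1 + 2 * c)) *
    (connForm h c p v * connForm h c p w) + _ + _ = _
  field_simp
  ring

/-- The q-map metric is the undeformed one-loop metric. -/
theorem oneLoopMetric_zero (hh : h.IsHomogeneous 3) {p : CMapSpace n} (hρ : 0 < p.2.1) :
    oneLoopMetric (rMapMetric h) (rMapPrepotential h) 0 p = qMapMetric h p := by
  have hρ' := hρ.ne'
  refine ContinuousLinearMap.ext fun v => ContinuousLinearMap.ext fun w => ?_
  have hd : ∀ (v : CMapSpace n) I,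
      (dZetaT I + ∑ K, gaugeR (rMapPrepotential h) p.1 I K • dZeta K) v
      = (v.2.2.2.1 + (gaugeR (rMapPrepotential h) p.1).mulVec v.2.2.2.2) I := by
    intro v I
    simp only [add_apply, sum_apply, smul_apply]
    rfl
  have e2 := sum_sum_mul_eq_dotProduct (gaugeI (rMapPrepotential h) p.1) v.2.2.2.2 w.2.2.2.2
  have e3 := sum_sum_mul_eq_dotProduct (gaugeI (rMapPrepotential h) p.1)⁻¹
    (v.2.2.2.1 + (gaugeR (rMapPrepotential h) p.1).mulVec v.2.2.2.2)
    (w.2.2.2.1 + (gaugeR (rMapPrepotential h) p.1).mulVec w.2.2.2.2)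
  simp only [← hd] at e3
  have t1 : ∑ x, ∑ y, matH (rMapPrepotential h) p.1 x y * (tensorForm (dP x) (dP y)) v w = _ :=
    sum_matH p.1 v w
  simp only [oneLoopMetric, qMapMetric, cMapMetric, add_apply, smul_apply, sum_apply, smul_eq_mul]
  rw [t1, matH_dotProduct hh, ← e2, ← e3]
  change _ = _ + _ + _ + 1 / (2 * p.2.1) *
    (∑ I, ∑ J, gaugeI (rMapPrepotential h) p.1 I J * (v.2.2.2.2 I * w.2.2.2.2 J))
    + 1 / (2 * p.2.1) * (∑ I, ∑ J, (gaugeI (rMapPrepotential h) p.1)⁻¹ I J *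
      ((dZetaT I + ∑ K, gaugeR (rMapPrepotential h) p.1 I K • dZeta K) v *
          (dZetaT J + ∑ L, gaugeR (rMapPrepotential h) p.1 J L • dZeta L) w))
  rw [zero_smul, add_zero]
  simp only [add_zero, mul_zero, zero_div, zero_mul, div_self hρ', one_mul, mul_one]
  ring

end OneLoopMetric

/-! ### The derivative of the periods -/

section FrameForms

variable {n : ℕ} {h : MvPolynomial (Fin n) ℝ}

theorem periodForm_eq_tri (hh : h.IsHomogeneous 3) (X : Fin n → ℂ) (w : CMapSpace n) :
    periodForm (rMapPrepotential h) X w =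
      homCoord X ⬝ᵥ cx w.2.2.2.1 + (tri h X X (cx (Fin.tail w.2.2.2.2)) / 2
        - tri h X X X * (w.2.2.2.2 0 : ℂ) / 6) := by
  have e := gradF_sum (h := h) (homCoord X) (cx w.2.2.2.2)
  have e2 : gradF h (homCoord X) (cx w.2.2.2.2) = tri h X X (cx (Fin.tail w.2.2.2.2)) / 2
        - tri h X X X * (w.2.2.2.2 0 : ℂ) / 6 := by
    rw [gradF, tail_homCoord, homCoord_zero]
    simp only [mul_one, one_pow]
    rfl
  rw [← e2, ← e]
  simp only [periodForm, sum_apply, add_apply, Finset.sum_add_distrib]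
  congr 1
  refine Finset.sum_congr rfl fun I _ => ?_
  rw [holDeriv_prepotential hh (homCoord_ne X)]
  rfl

/-- The derivative has a transversal part and a part proportional to the periods. The second is a
connection term, which the factor e^{𝒦/2} and the form ½ d^c𝒦 in θ₀ compensate later. -/
theorem hasDerivAt_periodForm (hh : h.IsHomogeneous 3) {p : CMapSpace n}
    (hX : IsHyperbolicPoint h (imR p.1)) (v w : CMapSpace n) :
    HasDerivAt (fun t : ℝ => periodForm (rMapPrepotential h) (p + t • v).1 w)
      (-(affinePotential (rMapPrepotential h) (homCoord p.1) : ℂ) *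
          logHess h (imR p.1) v.1 (kapV h p.1 w)
        - Complex.I * (3 / 2) * (tri h (cx (imR p.1)) (cx (imR p.1)) v.1
          / (tri h (imR p.1) (imR p.1) (imR p.1) : ℝ))
          * periodForm (rMapPrepotential h) p.1 w) 0 := by
  simp only [periodForm_eq_tri hh (_ + _ : CMapSpace n).1]
  have hl : HasDerivAt (fun t : ℝ => (p + t • v).1) v.1 0 := hasDerivAt_line p.1 v.1
  have h1 : HasDerivAt (fun t : ℝ => homCoord (p + t • v).1 ⬝ᵥ cx w.2.2.2.1)
      ((Fin.cons 0 v.1 : Fin (n + 1) → ℂ) ⬝ᵥ cx w.2.2.2.1) 0 := by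
    unfold dotProduct
    refine HasDerivAt.fun_sum fun i _ => ?_
    refine HasDerivAt.mul_const (d := cx w.2.2.2.1 i) ?_
    refine Fin.cases ?_ (fun μ => ?_) i
    · exact hasDerivAt_const _ _
    · exact (hasDerivAt_pi.1 hl) μ
  have h2 := h1.fun_add (((hasDerivAt_tri (h := h) hl hl (hasDerivAt_const (0 : ℝ)
    (cx (Fin.tail w.2.2.2.2)))).div_const 2).fun_sub
      (((hasDerivAt_tri (h := h) hl hl hl).mul_const (w.2.2.2.2 0 : ℂ)).div_const 6))
  refine h2.congr_deriv ?_
  simp only [zero_smul, add_zero]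
  -- With first argument (0, dX), the term N(u, ·) in `logHess_eq` is exactly the derivative of the
  -- period, computed in `hP`.
  have hL := logHess_eq hh hX.pos (Fin.cons 0 v.1) (cotVec h p.1 w.2.2.2.1 w.2.2.2.2)
  rw [← periodForm_apply hh hX, bilC_cotVec hh hX, bilC_matNX hh, vert_star_homCoord,
    star_homCoord_zero] at hL
  simp only [Fin.tail_cons, Fin.cons_zero, zero_smul, sub_zero, vert] at hL
  change logHess h (imR p.1) v.1 (kapV h p.1 w) = _ at hL
  have hf : (affinePotential (rMapPrepotential h) (homCoord p.1) : ℂ)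
      = 4 / 3 * (tri h (imR p.1) (imR p.1) (imR p.1) : ℝ) := by
    rw [affinePotential_homCoord hh]; push_cast; ring
  have hT : ((tri h (imR p.1) (imR p.1) (imR p.1) : ℝ) : ℂ) ≠ 0 := by
    exact_mod_cast hX.pos.ne'
  have hP : (Fin.cons 0 v.1 : Fin (n + 1) → ℂ) ⬝ᵥ perVec h p.1 w.2.2.2.1 w.2.2.2.2
      = (Fin.cons 0 v.1 : Fin (n + 1) → ℂ) ⬝ᵥ cx w.2.2.2.1 +
        (tri h p.1 v.1 (cx (Fin.tail w.2.2.2.2)) -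
          tri h p.1 p.1 v.1 * (w.2.2.2.2 0 : ℂ) / 2) := by
    rw [perVec, dotProduct_add]
    congr 1
    have := hessF_sum hh (homCoord_ne p.1) (Fin.cons 0 v.1) (cx w.2.2.2.2)
    rw [dotProduct]
    simp only [Matrix.mulVec, dotProduct, Finset.mul_sum]
    have e : hessB h (homCoord p.1) (Fin.cons 0 v.1) (cx w.2.2.2.2)
        = tri h p.1 v.1 (cx (Fin.tail w.2.2.2.2)) -
          tri h p.1 p.1 v.1 * (w.2.2.2.2 0 : ℂ) / 2 := by
      rw [hessB, tail_homCoord, homCoord_zero]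
      simp only [Fin.tail_cons, Fin.cons_zero, mul_zero, zero_mul, zero_div, sub_zero, add_zero,
        mul_one, one_pow, div_one]
      rfl
    rw [← e, ← this]
    refine Finset.sum_congr rfl fun i _ => Finset.sum_congr rfl fun j _ => ?_
    simp only [cx]
    ring
  rw [hP] at hL
  rw [hL, hf]
  have e3 : tri h p.1 p.1 v.1 = tri h v.1 p.1 p.1 := by rw [tri_comm₂₃, tri_comm₁₂]
  have e4 : tri h p.1 v.1 p.1 = tri h v.1 p.1 p.1 := tri_comm₁₂ _ _ _ _
  have e5 : tri h p.1 v.1 (cx (Fin.tail w.2.2.2.2)) = tri h v.1 p.1 (cx (Fin.tail w.2.2.2.2)) :=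
    tri_comm₁₂ _ _ _ _
  have e6 : tri h (cx (imR p.1)) v.1 (-(Complex.I • cx (imR p.1)))
      = -(Complex.I * tri h (cx (imR p.1)) (cx (imR p.1)) v.1) := by
    rw [tri_neg₃, tri_smul₃, tri_comm₂₃]
  rw [e3, e4, e5, e6, tri_zero₃]
  field_simp
  ring

end FrameForms

/-! ### The connection forms θ₀, θ₁, θ₂ and their derivatives -/

section FrameForms

variable {n : ℕ} {h : MvPolynomial (Fin n) ℝ}

variable (h) in
/-- The region where `h(Im X) > 0` and `ρ > 0`. -/
def positiveRegion : Set (CMapSpace n) :=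
  {p | 0 < tri h (imR p.1) (imR p.1) (imR p.1) ∧ 0 < p.2.1}

theorem contDiff_tri_imR_fst {m : ℕ∞ω} : ContDiff ℝ m fun p : CMapSpace n =>
    tri h (imR p.1) (imR p.1) (imR p.1) := by
  have := contDiff_imR.comp (contDiff_fst (𝕜 := ℝ) (E := Fin n → ℂ) (n := m)
    (F := ℝ × ℝ × (Fin (n + 1) → ℝ) × (Fin (n + 1) → ℝ)))
  exact contDiffOn_univ.1 (contDiffOn_tri this.contDiffOn this.contDiffOn this.contDiffOn)

theorem contDiff_tri_imR_fst' {m : ℕ∞ω} (v : Fin n → ℝ) : ContDiff ℝ m fun p : CMapSpace n =>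
    tri h (imR p.1) (imR p.1) v := by
  have := contDiff_imR.comp (contDiff_fst (𝕜 := ℝ) (E := Fin n → ℂ) (n := m)
    (F := ℝ × ℝ × (Fin (n + 1) → ℝ) × (Fin (n + 1) → ℝ)))
  exact contDiffOn_univ.1 (contDiffOn_tri this.contDiffOn this.contDiffOn contDiffOn_const)

theorem isOpen_positiveRegion : IsOpen (positiveRegion h) :=
  (isOpen_lt continuous_const (contDiff_tri_imR_fst (m := 0)).continuous).inter
    (isOpen_lt continuous_const (continuous_fst.comp continuous_snd))

variable (h) in
/-- The one-form `½ d^c𝒦 + (dφ̃ + ∑ (ζ^I dζ̃_I - ζ̃_I dζ^I) + c d^c𝒦) / (2ρ)`. -/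
def frameZero (c : ℝ) (p : CMapSpace n) : CMapSpace n →L[ℝ] ℝ :=
  (1 / 2 : ℝ) • (dC (kahlerPotential (rMapPrepotential h)) p.1 ∘L dX)
    + (1 / (2 * p.2.1)) • connForm h c p

variable (h) in
/-- The complex one-form `2 √(ρ + c) / ρ · e^{𝒦/2} ∑ (X^I dζ̃_I + F_I dζ^I)`. -/
def framePlus (c : ℝ) (p : CMapSpace n) : CMapSpace n →L[ℝ] ℂ :=
  (2 * (√(p.2.1 + c) / p.2.1) * Real.exp (rMapPotential h p.1 / 2)) •
    periodForm (rMapPrepotential h) p.1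

variable (h) in
/-- The connection forms of the quaternionic structure. -/
def frameForm (c : ℝ) : Fin 3 → CMapSpace n → CMapSpace n →L[ℝ] ℝ :=
  ![frameZero h c, fun p => Complex.reCLM ∘L framePlus h c p,
    fun p => Complex.imCLM ∘L framePlus h c p]

theorem dC_comp_dX_apply (hh : h.IsHomogeneous 3) {p : CMapSpace n}
    (hp : p ∈ positiveRegion h) (v : CMapSpace n) :
    (dC (kahlerPotential (rMapPrepotential h)) p.1 ∘L dX) v
      = 3 * tri h (imR p.1) (imR p.1) (reR v.1) / tri h (imR p.1) (imR p.1) (imR p.1) :=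
  dC_kahlerPotential hh hp.1 v.1

theorem contDiffOn_dC_apply (hh : h.IsHomogeneous 3) (v : CMapSpace n) :
    ContDiffOn ℝ ∞ (fun p : CMapSpace n =>
      (dC (kahlerPotential (rMapPrepotential h)) p.1 ∘L dX) v) (positiveRegion h) := by
  refine ContDiffOn.congr (f := fun p : CMapSpace n =>
    3 * tri h (imR p.1) (imR p.1) (reR v.1) / tri h (imR p.1) (imR p.1) (imR p.1)) ?_
    fun p hp => dC_comp_dX_apply hh hp v
  exact ((contDiff_tri_imR_fst' _).contDiffOn.const_smul (3 : ℝ)).div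
    contDiff_tri_imR_fst.contDiffOn fun p hp => hp.1.ne'

theorem contDiff_contactForm_apply (v : CMapSpace n) :
    ContDiff ℝ ∞ (fun p : CMapSpace n => contactForm p v) := by
  simp only [contactForm_apply, dotProduct]
  fun_prop

theorem contDiffOn_connForm_apply (hh : h.IsHomogeneous 3) (c : ℝ) (v : CMapSpace n) :
    ContDiffOn ℝ ∞ (fun p : CMapSpace n => connForm h c p v) (positiveRegion h) :=
  (contDiff_contactForm_apply v).contDiffOn.add ((contDiffOn_dC_apply hh v).const_smul c)

theorem contDiffOn_rMapPotential (hh : h.IsHomogeneous 3) :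
    ContDiffOn ℝ ∞ (fun p : CMapSpace n => rMapPotential h p.1) (positiveRegion h) := by
  rw [funext (fun p : CMapSpace n => rMapPotential_eq hh p.1)]
  exact ((contDiff_const.mul contDiff_tri_imR_fst).contDiffOn.log
    fun p hp => (mul_pos (by norm_num) hp.1).ne').neg

theorem contDiff_periodForm_apply (hh : h.IsHomogeneous 3) (v : CMapSpace n) :
    ContDiff ℝ ∞ (fun p : CMapSpace n => periodForm (rMapPrepotential h) p.1 v) := by
  simp only [periodForm_eq_tri hh]
  have hX : ContDiff ℝ ∞ fun p : CMapSpace n => p.1 := contDiff_fst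
  have h1 : ContDiff ℝ ∞ fun p : CMapSpace n => tri h p.1 p.1 (cx (Fin.tail v.2.2.2.2)) :=
    contDiffOn_univ.1 (contDiffOn_tri hX.contDiffOn hX.contDiffOn contDiffOn_const)
  have h2 : ContDiff ℝ ∞ fun p : CMapSpace n => tri h p.1 p.1 p.1 :=
    contDiffOn_univ.1 (contDiffOn_tri hX.contDiffOn hX.contDiffOn hX.contDiffOn)
  refine ContDiff.add ?_ ((h1.div_const _).sub ((h2.mul contDiff_const).div_const _))
  unfold dotProduct
  refine ContDiff.sum fun i _ => ContDiff.mul ?_ contDiff_const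
  refine Fin.cases ?_ (fun μ => ?_) i
  · exact contDiff_const
  · exact (contDiff_apply ℝ ℂ μ).comp hX

theorem contDiffOn_rho {m : ℕ∞ω} {s : Set (CMapSpace n)} :
    ContDiffOn ℝ m (fun p : CMapSpace n => p.2.1) s :=
  (contDiff_fst.comp contDiff_snd).contDiffOn

theorem contDiffOn_frameZero (hh : h.IsHomogeneous 3) (c : ℝ) :
    ContDiffOn ℝ ∞ (frameZero h c) (positiveRegion h) := by
  rw [contDiffOn_clm_apply]
  intro v
  refine ((contDiffOn_dC_apply hh v).const_smul (1 / 2 : ℝ)).add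
    (ContDiffOn.smul ?_ (contDiffOn_connForm_apply hh c v))
  exact contDiffOn_const.div (contDiffOn_const.mul contDiffOn_rho)
    fun p hp => (mul_pos two_pos hp.2).ne'

theorem contDiffOn_framePlus (hh : h.IsHomogeneous 3) {c : ℝ} (hc : 0 ≤ c) :
    ContDiffOn ℝ ∞ (framePlus h c) (positiveRegion h) := by
  rw [contDiffOn_clm_apply]
  intro v
  suffices hs : ContDiffOn ℝ ∞ (fun p : CMapSpace n => 2 * (√(p.2.1 + c) / p.2.1) *
      Real.exp (rMapPotential h p.1 / 2)) (positiveRegion h) from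
    hs.smul (contDiff_periodForm_apply hh v).contDiffOn
  refine (contDiffOn_const.mul (ContDiffOn.div ?_ contDiffOn_rho fun p hp => hp.2.ne')).mul
    ((contDiffOn_rMapPotential hh).div_const 2).exp
  exact (contDiffOn_rho.add contDiffOn_const).sqrt fun p hp => (by linarith [hp.2] : 0 < p.2.1 + c).ne'

theorem contDiffOn_frameForm (hh : h.IsHomogeneous 3) {c : ℝ} (hc : 0 ≤ c) (a : Fin 3) :
    ContDiffOn ℝ ∞ (frameForm h c a) (positiveRegion h) := by
  fin_cases a
  · exact contDiffOn_frameZero hh c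
  · exact contDiffOn_const.clm_comp (contDiffOn_framePlus hh hc)
  · exact contDiffOn_const.clm_comp (contDiffOn_framePlus hh hc)

theorem fderiv_form_eq_of_line {E G : Type*} [NormedAddCommGroup E] [NormedSpace ℝ E]
    [NormedAddCommGroup G] [NormedSpace ℝ G] {θ : E → E →L[ℝ] G} {x v w : E} {d : G}
    (hθ : DifferentiableAt ℝ θ x) (hd : HasDerivAt (fun t : ℝ => θ (x + t • v) w) d 0) :
    fderiv ℝ θ x v w = d := by
  have h1 := hθ.hasFDerivAt.clm_apply (hasFDerivAt_const w x)
  have h2 := fderiv_eq_of_line (f := fun y => θ y w) h1.differentiableAt hd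
  rw [h1.fderiv] at h2
  simpa using h2

theorem hasDerivAt_connQuotient {p : CMapSpace n} (hp : p ∈ positiveRegion h)
    (v w : CMapSpace n) :
    HasDerivAt (fun t : ℝ => 3 * tri h (imR (p + t • v).1) (imR (p + t • v).1) (reR w.1)
      / tri h (imR (p + t • v).1) (imR (p + t • v).1) (imR (p + t • v).1))
      (-4 * (logHess h (imR p.1) (cx (imR v.1)) (cx (reR w.1))).re) 0 := by
  have hl := hasDerivAt_imR_line p.1 v.1
  have h1 := ((hasDerivAt_tri (h := h) hl hl (hasDerivAt_const (0 : ℝ) (reR w.1))).const_mul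
    3).fun_div (hasDerivAt_tri (h := h) hl hl hl) (by simpa using hp.1.ne')
  refine h1.congr_deriv ?_
  simp only [zero_smul, add_zero, logHess_cx, Complex.ofReal_re]
  rw [tri_comm₁₂ h (imR v.1) (imR p.1), tri_comm₁₂ h (imR v.1) (imR p.1),
    tri_comm₂₃ h (imR p.1) (imR v.1) (imR p.1), tri_zero₃]
  have := hp.1.ne'
  field_simp
  ring

theorem fderiv_frameZero (hh : h.IsHomogeneous 3) (c : ℝ) {p : CMapSpace n}
    (hp : p ∈ positiveRegion h) (v w : CMapSpace n) :
    fderiv ℝ (frameZero h c) p v w =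
      (1 / 2 + c / (2 * p.2.1)) * (-4 * (logHess h (imR p.1) (cx (imR v.1)) (cx (reR w.1))).re)
      + (v.2.2.2.2 ⬝ᵥ w.2.2.2.1 - v.2.2.2.1 ⬝ᵥ w.2.2.2.2) / (2 * p.2.1)
      - v.2.1 / (2 * p.2.1 ^ 2) * connForm h c p w := by
  apply fderiv_form_eq_of_line
  · exact ((contDiffOn_frameZero hh c).contDiffAt
      (isOpen_positiveRegion.mem_nhds hp)).differentiableAt (by simp)
  have hc : Continuous fun t : ℝ => p + t • v := by fun_prop
  have hev : ∀ᶠ t in 𝓝 (0 : ℝ), p + t • v ∈ positiveRegion h :=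
    hc.continuousAt.eventually (isOpen_positiveRegion.mem_nhds (by simpa using hp))
  have hev2 : (fun t : ℝ => frameZero h c (p + t • v) w) =ᶠ[𝓝 0] fun t : ℝ =>
      (1 / 2) * (3 * tri h (imR (p + t • v).1) (imR (p + t • v).1) (reR w.1)
      / tri h (imR (p + t • v).1) (imR (p + t • v).1) (imR (p + t • v).1))
      + (1 / (2 * (p + t • v).2.1)) * ((w.2.2.1 + ((p + t • v).2.2.2.2 ⬝ᵥ w.2.2.2.1
        - (p + t • v).2.2.2.1 ⬝ᵥ w.2.2.2.2)) +
        c * (3 * tri h (imR (p + t • v).1) (imR (p + t • v).1) (reR w.1)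
      / tri h (imR (p + t • v).1) (imR (p + t • v).1) (imR (p + t • v).1))) := by
    filter_upwards [hev] with t ht
    rw [← dC_comp_dX_apply hh ht w, ← contactForm_apply]
    rfl
  refine HasDerivAt.congr_of_eventuallyEq ?_ hev2
  have hq := hasDerivAt_connQuotient hp v w
  have hρ : HasDerivAt (fun t : ℝ => (p + t • v).2.1) v.2.1 0 := hasDerivAt_line p.2.1 v.2.1
  have hζ : HasDerivAt (fun t : ℝ => (p + t • v).2.2.2.2 ⬝ᵥ w.2.2.2.1) (v.2.2.2.2 ⬝ᵥ w.2.2.2.1) 0 :=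
    HasDerivAt.fun_sum fun i _ => (hasDerivAt_pi.1 (hasDerivAt_line p.2.2.2.2 v.2.2.2.2) i).mul_const _
  have hζ' : HasDerivAt (fun t : ℝ => (p + t • v).2.2.2.1 ⬝ᵥ w.2.2.2.2) (v.2.2.2.1 ⬝ᵥ w.2.2.2.2) 0 :=
    HasDerivAt.fun_sum fun i _ => (hasDerivAt_pi.1 (hasDerivAt_line p.2.2.2.1 v.2.2.2.1) i).mul_const _
  have hρ0 : p.2.1 ≠ 0 := hp.2.ne'
  have h1 := (hq.const_mul (1 / 2)).fun_add (((hasDerivAt_const (0 : ℝ) (1 : ℝ)).fun_div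
    (hρ.const_mul 2) (by simpa using hρ0)).fun_mul
      (((hζ.fun_sub hζ').const_add w.2.2.1).fun_add (hq.const_mul c)))
  refine h1.congr_deriv ?_
  simp only [zero_smul, add_zero]
  have e : connForm h c p w = (w.2.2.1 + (p.2.2.2.2 ⬝ᵥ w.2.2.2.1
        - p.2.2.2.1 ⬝ᵥ w.2.2.2.2)) +
        c * (3 * tri h (imR p.1) (imR p.1) (reR w.1) / tri h (imR p.1) (imR p.1) (imR p.1)) := by
    rw [← dC_comp_dX_apply hh hp w, ← contactForm_apply]
    rfl
  rw [e]
  field_simp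
  ring

theorem fderiv_framePlus (hh : h.IsHomogeneous 3) {c : ℝ} (hc : 0 ≤ c) {p : CMapSpace n}
    (hX : IsHyperbolicPoint h (imR p.1)) (hρ : 0 < p.2.1) (v w : CMapSpace n) :
    fderiv ℝ (framePlus h c) p v w =
      (Real.exp (rMapPotential h p.1 / 2) : ℂ) * ((-((p.2.1 + 2 * c) / (√(p.2.1 + c) * p.2.1 ^ 2) * v.2.1
        + 3 * (√(p.2.1 + c) / p.2.1) * (tri h (imR p.1) (imR p.1) (imR v.1)
          / tri h (imR p.1) (imR p.1) (imR p.1))) : ℝ) * periodForm (rMapPrepotential h) p.1 w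
      + 2 * (√(p.2.1 + c) / p.2.1 : ℝ) *
      (-(affinePotential (rMapPrepotential h) (homCoord p.1) : ℂ) *
          logHess h (imR p.1) v.1 (kapV h p.1 w)
        - Complex.I * (3 / 2) * (tri h (cx (imR p.1)) (cx (imR p.1)) v.1
          / (tri h (imR p.1) (imR p.1) (imR p.1) : ℝ))
          * periodForm (rMapPrepotential h) p.1 w)) := by
  have hp : p ∈ positiveRegion h := ⟨hX.pos, hρ⟩
  apply fderiv_form_eq_of_line
  · exact ((contDiffOn_framePlus hh hc).contDiffAt
      (isOpen_positiveRegion.mem_nhds hp)).differentiableAt (by simp)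
  have hρ1 : HasDerivAt (fun t : ℝ => (p + t • v).2.1) v.2.1 0 := hasDerivAt_line p.2.1 v.2.1
  have hK : HasDerivAt (fun t : ℝ => rMapPotential h (p + t • v).1)
      (-(3 * tri h (imR p.1) (imR p.1) (imR v.1) / tri h (imR p.1) (imR p.1) (imR p.1))) 0 := by
    have := (differentiableAt_rMapPotential hh hX.pos).hasFDerivAt
    rw [← fderiv_rMapPotential hh hX.pos v.1]
    have hl : HasDerivAt (fun t : ℝ => (p + t • v).1) v.1 0 := hasDerivAt_line p.1 v.1
    have h0 : (p + (0 : ℝ) • v).1 = p.1 := by simp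
    rw [← h0] at this
    exact (this.comp_hasDerivAt (0 : ℝ) hl).congr_deriv (by rw [h0])
  have hα : 0 < p.2.1 + c := by linarith
  have hs := (((hρ1.add_const c).sqrt (by simpa using hα.ne')).fun_div hρ1
    (by simpa using hρ.ne')).const_mul 2
  have h1 := ((hs.fun_mul ((hK.div_const 2).exp)).ofReal_comp).fun_mul (hasDerivAt_periodForm hh hX v w)
  refine h1.congr_deriv ?_
  simp only [zero_smul, add_zero]
  have hsq : √(p.2.1 + c) ^ 2 = p.2.1 + c := Real.sq_sqrt hα.le
  have hsn : √(p.2.1 + c) ≠ 0 := (Real.sqrt_pos.2 hα).ne'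
  have hρ0 : p.2.1 ≠ 0 := hρ.ne'
  have e1 : (v.2.1 / (2 * √(p.2.1 + c)) * p.2.1 - √(p.2.1 + c) * v.2.1) / p.2.1 ^ 2
      = - ((p.2.1 + 2 * c) / (2 * √(p.2.1 + c) * p.2.1 ^ 2) * v.2.1) := by
    field_simp
    rw [hsq]; ring
  rw [e1]
  generalize √(p.2.1 + c) = s at *
  push_cast
  have hsn' : (s : ℂ) ≠ 0 := by exact_mod_cast hsn
  have hρ' : (p.2.1 : ℂ) ≠ 0 := by exact_mod_cast hρ0
  field_simp
  ring

end FrameForms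

/-! ### The unitary coframe and the curvature of the connection forms -/

section QuaternionicFrame

variable {n : ℕ} {h : MvPolynomial (Fin n) ℝ}

theorem perVec_add (X : Fin n → ℂ) (a b a' b' : Fin (n + 1) → ℝ) :
    perVec h X (a + a') (b + b') = perVec h X a b + perVec h X a' b' := by
  have e : ∀ a a' : Fin (n + 1) → ℝ, (fun i => (((a + a') i : ℝ) : ℂ))
    = (fun i => (a i : ℂ)) + fun i => (a' i : ℂ) := by intro a a'; ext i; simp
  rw [perVec, e, e, Matrix.mulVec_add, perVec, perVec]
  abel

theorem perVec_smul (X : Fin n → ℂ) (r : ℝ) (a b : Fin (n + 1) → ℝ) :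
    perVec h X (r • a) (r • b) = (r : ℂ) • perVec h X a b := by
  have e : ∀ a : Fin (n + 1) → ℝ, (fun i => (((r • a) i : ℝ) : ℂ))
    = (r : ℂ) • fun i => (a i : ℂ) := by intro a; ext i; simp
  rw [perVec, e, e, Matrix.mulVec_smul, perVec, smul_add]

theorem kap_add (X : Fin n → ℂ) (u v : Fin (n + 1) → ℂ) : kap X (u + v) = kap X u + kap X v := by
  ext μ; simp [kap, Fin.tail]; ring

theorem kap_smul (X : Fin n → ℂ) (r : ℂ) (u : Fin (n + 1) → ℂ) : kap X (r • u) = r • kap X u := by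
  ext μ; simp [kap, Fin.tail]; ring

theorem kapV_add (X : Fin n → ℂ) (v w : CMapSpace n) :
    kapV h X (v + w) = kapV h X v + kapV h X w := by
  simp only [kapV, cotVec, Prod.snd_add, Prod.fst_add, perVec_add, Matrix.mulVec_add, kap_add]

theorem kapV_smul (X : Fin n → ℂ) (r : ℝ) (v : CMapSpace n) :
    kapV h X (r • v) = (r : ℂ) • kapV h X v := by
  simp only [kapV, cotVec, Prod.smul_snd, Prod.smul_fst, perVec_smul, Matrix.mulVec_smul, kap_smul]

variable (h) in
/-- The unitary coframe of the one-loop deformed metric. -/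
def unitaryCoframe (c : ℝ) (L : (Fin n → ℂ) →ₗ[ℂ] (Fin n → ℂ)) (p : CMapSpace n) :
    CMapSpace n →ₗ[ℝ] (Fin (n + 1) → ℂ) × (Fin (n + 1) → ℂ) where
  toFun v :=
    (Fin.cons
      ((1 / (2 * p.2.1) * (√(p.2.1 + 2 * c) / √(p.2.1 + c)) * v.2.1 : ℝ)
        - (1 / (2 * p.2.1) * (√(p.2.1 + c) / √(p.2.1 + 2 * c)) * connForm h c p v : ℝ) * Complex.I)
      (((√(p.2.1 + c) / √p.2.1 : ℝ) : ℂ) • L v.1),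
    Fin.cons
      (-((√(p.2.1 + 2 * c) / p.2.1 * Real.exp (rMapPotential h p.1 / 2) : ℝ) : ℂ) *
        periodForm (rMapPrepotential h) p.1 v)
      (-((1 / (Real.exp (rMapPotential h p.1 / 2) * √p.2.1) : ℝ) : ℂ) • L (kapV h p.1 v)))
  map_add' v w := by
    ext i
    all_goals
      refine Fin.cases ?_ (fun μ => ?_) i
      · simp only [Fin.cons_zero, Prod.snd_add, Prod.fst_add, map_add, Pi.add_apply]
        push_cast
        ring
      · simp only [Fin.cons_succ, Prod.snd_add, Prod.fst_add, map_add, Pi.add_apply, kapV_add,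
          Pi.smul_apply, smul_eq_mul]
        ring
  map_smul' r v := by
    have hr : ∀ x : Fin n → ℂ, L (r • x) = (r : ℂ) • L x := fun x => by
      rw [← map_smul]; rfl
    ext i
    all_goals
      refine Fin.cases ?_ (fun μ => ?_) i
      · simp only [Fin.cons_zero, Prod.smul_snd, Prod.smul_fst, map_smul, Pi.smul_apply,
          Complex.real_smul, RingHom.id_apply, smul_eq_mul]
        push_cast
        ring
      · simp only [Fin.cons_succ, Prod.smul_snd, Prod.smul_fst, map_smul, Pi.smul_apply, kapV_smul,
          smul_eq_mul, hr, RingHom.id_apply, Complex.real_smul]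
        ring

/-- The standard Hermitian form on `ℂ^m × ℂ^m`. -/
def stdHerm {m : ℕ} (p q : (Fin m → ℂ) × (Fin m → ℂ)) : ℂ :=
  ∑ i, (starRingEnd ℂ) (p.1 i) * q.1 i + ∑ i, (starRingEnd ℂ) (p.2 i) * q.2 i

/-- The standard complex symplectic form on `ℂ^m × ℂ^m`. -/
def stdSymp {m : ℕ} (p q : (Fin m → ℂ) × (Fin m → ℂ)) : ℂ :=
  ∑ i, (p.1 i * q.2 i - q.1 i * p.2 i)

theorem exp_rMapPotential_half_sq (hh : h.IsHomogeneous 3) {X : Fin n → ℂ}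
    (hX : IsHyperbolicPoint h (imR X)) :
    Real.exp (rMapPotential h X / 2) ^ 2 * affinePotential (rMapPrepotential h) (homCoord X)
      = 1 := by
  have hf := affinePotential_pos hh hX
  rw [← kahlerPotential_eq hh, kahlerPotential, ← Real.exp_nat_mul]
  push_cast
  rw [mul_div_cancel₀ _ two_ne_zero, Real.exp_neg, Real.exp_log hf, inv_mul_cancel₀ hf.ne']

variable {L : (Fin n → ℂ) →ₗ[ℂ] (Fin n → ℂ)} {c : ℝ} {p : CMapSpace n}

/-- The real part of this formula is the one-loop metric and twice its imaginary part is the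
curvature of θ₀, so one computation serves both. -/
theorem stdHerm_unitaryCoframe (hh : h.IsHomogeneous 3) (hc : 0 ≤ c)
    (hX : IsHyperbolicPoint h (imR p.1)) (hρ : 0 < p.2.1)
    (hLs : ∀ v, L (star v) = star (L v))
    (hL : ∀ u v, logHess h (imR p.1) u v = ∑ i, L u i * L v i) (v w : CMapSpace n) :
    stdHerm (unitaryCoframe h c L p v) (unitaryCoframe h c L p w) =
      ((p.2.1 + c) / p.2.1 : ℝ) * logHess h (imR p.1) (star v.1) w.1
      + (1 / (4 * p.2.1 ^ 2) : ℝ) * ((((p.2.1 + 2 * c) / (p.2.1 + c)) * (v.2.1 * w.2.1) : ℝ)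
      + (((p.2.1 + c) / (p.2.1 + 2 * c)) * (connForm h c p v * connForm h c p w) : ℝ)
      + Complex.I * (connForm h c p v * w.2.1 - v.2.1 * connForm h c p w : ℝ))
      + (affinePotential (rMapPrepotential h) (homCoord p.1) / p.2.1 : ℝ) *
          logHess h (imR p.1) (star (kapV h p.1 v)) (kapV h p.1 w)
      + ((p.2.1 + 2 * c) / (p.2.1 ^ 2 * affinePotential (rMapPrepotential h) (homCoord p.1)) : ℝ) *
          ((starRingEnd ℂ) (periodForm (rMapPrepotential h) p.1 v) *
            periodForm (rMapPrepotential h) p.1 w) := by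
  have hα : 0 < p.2.1 + c := by linarith
  have hβ : 0 < p.2.1 + 2 * c := by linarith
  have hα2 : ((√(p.2.1 + c) : ℝ) : ℂ) ^ 2 = p.2.1 + c := by
    exact_mod_cast Real.sq_sqrt hα.le
  have hβ2 : ((√(p.2.1 + 2 * c) : ℝ) : ℂ) ^ 2 = p.2.1 + 2 * c := by
    exact_mod_cast Real.sq_sqrt hβ.le
  have hγ2 : ((√p.2.1 : ℝ) : ℂ) ^ 2 = p.2.1 := by exact_mod_cast Real.sq_sqrt hρ.le
  have hα0 : ((√(p.2.1 + c) : ℝ) : ℂ) ≠ 0 := by exact_mod_cast (Real.sqrt_pos.2 hα).ne'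
  have hβ0 : ((√(p.2.1 + 2 * c) : ℝ) : ℂ) ≠ 0 := by exact_mod_cast (Real.sqrt_pos.2 hβ).ne'
  have hγ0 : ((√p.2.1 : ℝ) : ℂ) ≠ 0 := by exact_mod_cast (Real.sqrt_pos.2 hρ).ne'
  have he0 : (Real.exp (rMapPotential h p.1 / 2) : ℂ) ≠ 0 := by
    exact_mod_cast (Real.exp_pos _).ne'
  have hef : (affinePotential (rMapPrepotential h) (homCoord p.1) : ℂ)
      = 1 / (Real.exp (rMapPotential h p.1 / 2) : ℂ) ^ 2 := by
    rw [eq_div_iff (pow_ne_zero _ he0), mul_comm]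
    exact_mod_cast exp_rMapPotential_half_sq hh hX
  have hs : ∀ u v : Fin n → ℂ, ∑ i, (starRingEnd ℂ) (L u i) * L v i
      = logHess h (imR p.1) (star u) v := by
    intro u v; rw [hL, hLs]; rfl
  rw [← hs, ← hs]
  simp only [stdHerm, unitaryCoframe, LinearMap.coe_mk, AddHom.coe_mk, Fin.sum_univ_succ,
    Fin.cons_zero, Fin.cons_succ, Pi.smul_apply, smul_eq_mul, map_mul, map_sub, map_neg,
    Complex.conj_ofReal, Complex.conj_I]
  have s1 : ∀ (k : ℂ) (x y : Fin n → ℂ), ∑ i, k * (starRingEnd ℂ) (x i) * (k * y i)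
      = k ^ 2 * ∑ i, (starRingEnd ℂ) (x i) * y i := by
    intro k x y
    rw [Finset.mul_sum]
    refine Finset.sum_congr rfl fun i _ => ?_
    ring
  rw [s1, s1]
  generalize Real.exp (rMapPotential h p.1 / 2) = e at *
  push_cast
  rw [hef, ← hα2, ← hβ2, ← hγ2]
  generalize ((√(p.2.1 + c) : ℝ) : ℂ) = α at *
  generalize ((√(p.2.1 + 2 * c) : ℝ) : ℂ) = β at *
  generalize ((√p.2.1 : ℝ) : ℂ) = γ at *
  field_simp
  ring_nf
  simp only [Complex.I_sq]
  ring

theorem stdSymp_unitaryCoframe (hc : 0 ≤ c) (hρ : 0 < p.2.1)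
    (hL : ∀ u v, logHess h (imR p.1) u v = ∑ i, L u i * L v i) (v w : CMapSpace n) :
    stdSymp (unitaryCoframe h c L p v) (unitaryCoframe h c L p w) =
      -((Real.exp (rMapPotential h p.1 / 2) : ℂ) / (2 * p.2.1 ^ 2)) *
        (((p.2.1 + 2 * c) / √(p.2.1 + c) * v.2.1 - √(p.2.1 + c) * connForm h c p v * Complex.I)
          * periodForm (rMapPrepotential h) p.1 w
        - ((p.2.1 + 2 * c) / √(p.2.1 + c) * w.2.1 - √(p.2.1 + c) * connForm h c p w * Complex.I)
          * periodForm (rMapPrepotential h) p.1 v)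
      - (√(p.2.1 + c) / (p.2.1 * Real.exp (rMapPotential h p.1 / 2))) *
        (logHess h (imR p.1) v.1 (kapV h p.1 w) - logHess h (imR p.1) w.1 (kapV h p.1 v)) := by
  have hα : 0 < p.2.1 + c := by linarith
  have hβ : 0 < p.2.1 + 2 * c := by linarith
  have hβ2 : ((√(p.2.1 + 2 * c) : ℝ) : ℂ) ^ 2 = p.2.1 + 2 * c := by
    exact_mod_cast Real.sq_sqrt hβ.le
  have hγ2 : ((√p.2.1 : ℝ) : ℂ) ^ 2 = p.2.1 := by exact_mod_cast Real.sq_sqrt hρ.le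
  have hα0 : ((√(p.2.1 + c) : ℝ) : ℂ) ≠ 0 := by exact_mod_cast (Real.sqrt_pos.2 hα).ne'
  have hβ0 : ((√(p.2.1 + 2 * c) : ℝ) : ℂ) ≠ 0 := by exact_mod_cast (Real.sqrt_pos.2 hβ).ne'
  have hγ0 : ((√p.2.1 : ℝ) : ℂ) ≠ 0 := by exact_mod_cast (Real.sqrt_pos.2 hρ).ne'
  have he0 : (Real.exp (rMapPotential h p.1 / 2) : ℂ) ≠ 0 := by
    exact_mod_cast (Real.exp_pos _).ne'
  rw [hL, hL]
  simp only [stdSymp, unitaryCoframe, LinearMap.coe_mk, AddHom.coe_mk, Fin.sum_univ_succ,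
    Fin.cons_zero, Fin.cons_succ, Pi.smul_apply, smul_eq_mul]
  have s1 : ∀ (k l : ℂ) (x y x' y' : Fin n → ℂ), ∑ i, (k * x i * (l * y i) - k * x' i * (l * y' i))
      = k * l * (∑ i, x i * y i - ∑ i, x' i * y' i) := by
    intro k l x y x' y'
    rw [← Finset.sum_sub_distrib, Finset.mul_sum]
    refine Finset.sum_congr rfl fun i _ => ?_
    ring
  rw [s1]
  generalize Real.exp (rMapPotential h p.1 / 2) = e at *
  push_cast
  rw [← hβ2, ← hγ2]
  generalize ((√(p.2.1 + c) : ℝ) : ℂ) = α at *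
  generalize ((√(p.2.1 + 2 * c) : ℝ) : ℂ) = β at *
  generalize ((√p.2.1 : ℝ) : ℂ) = γ at *
  field_simp
  ring

theorem frameZero_apply (hh : h.IsHomogeneous 3) (hp : p ∈ positiveRegion h) (v : CMapSpace n) :
    frameZero h c p v = 3 / 2 * (tri h (imR p.1) (imR p.1) (reR v.1)
      / tri h (imR p.1) (imR p.1) (imR p.1)) + connForm h c p v / (2 * p.2.1) := by
  have := dC_comp_dX_apply hh hp v
  simp only [frameZero, add_apply, smul_apply, smul_eq_mul, this]
  ring

theorem framePlus_apply (v : CMapSpace n) :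
    framePlus h c p v = ((2 * (√(p.2.1 + c) / p.2.1) * Real.exp (rMapPotential h p.1 / 2) : ℝ) : ℂ) *
      periodForm (rMapPrepotential h) p.1 v := rfl

theorem fderiv_comp_form {E G H : Type*} [NormedAddCommGroup E] [NormedSpace ℝ E]
    [NormedAddCommGroup G] [NormedSpace ℝ G] [NormedAddCommGroup H] [NormedSpace ℝ H]
    {θ : E → E →L[ℝ] G} {x : E} (hθ : DifferentiableAt ℝ θ x) (A : G →L[ℝ] H) (v w : E) :
    fderiv ℝ (fun y => A ∘L θ y) x v w = A (fderiv ℝ θ x v w) := by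
  have := ((hasFDerivAt_const A x).clm_comp hθ.hasFDerivAt).fderiv
  rw [this]
  simp

/-- The curvature of `θ₁ + i θ₂`. -/
theorem curvForm_plus (hh : h.IsHomogeneous 3) (hc : 0 ≤ c)
    (hX : IsHyperbolicPoint h (imR p.1)) (hρ : 0 < p.2.1)
    (hL : ∀ u v, logHess h (imR p.1) u v = ∑ i, L u i * L v i) (v w : CMapSpace n) :
    (curvForm (frameForm h c) 1 p v w : ℂ) + curvForm (frameForm h c) 2 p v w * Complex.I
      = 2 * stdSymp (unitaryCoframe h c L p v) (unitaryCoframe h c L p w) := by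
  have hp : p ∈ positiveRegion h := ⟨hX.pos, hρ⟩
  have hd : DifferentiableAt ℝ (framePlus h c) p :=
    ((contDiffOn_framePlus hh hc).contDiffAt
      (isOpen_positiveRegion.mem_nhds hp)).differentiableAt (by simp)
  have d1 : ∀ v w, fderiv ℝ (frameForm h c 1) p v w = (fderiv ℝ (framePlus h c) p v w).re :=
    fun v w => fderiv_comp_form hd Complex.reCLM v w
  have d2 : ∀ v w, fderiv ℝ (frameForm h c 2) p v w = (fderiv ℝ (framePlus h c) p v w).im :=
    fun v w => fderiv_comp_form hd Complex.imCLM v w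
  have e0 : ∀ v, frameForm h c (1 + 2) p v = frameZero h c p v := fun v => rfl
  have e0' : ∀ v, frameForm h c (2 + 1) p v = frameZero h c p v := fun v => rfl
  have e1 : ∀ v, frameForm h c (2 + 2) p v = (framePlus h c p v).re := fun v => rfl
  have e2 : ∀ v, frameForm h c (1 + 1) p v = (framePlus h c p v).im := fun v => rfl
  -- The two real equations combine into d(θ₁ + iθ₂) + iθ₀ ∧ (θ₁ + iθ₂).
  have key : (curvForm (frameForm h c) 1 p v w : ℂ) + curvForm (frameForm h c) 2 p v w * Complex.I
      = fderiv ℝ (framePlus h c) p v w - fderiv ℝ (framePlus h c) p w v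
        + Complex.I * (frameZero h c p v * framePlus h c p w
          - frameZero h c p w * framePlus h c p v) := by
    simp only [curvForm, extD, d1, d2, e0, e0', e1, e2]
    apply Complex.ext
    · simp
      ring
    · simp
  rw [key, fderiv_framePlus hh hc hX hρ, fderiv_framePlus hh hc hX hρ,
    stdSymp_unitaryCoframe hc hρ hL, framePlus_apply, framePlus_apply, frameZero_apply hh hp,
    frameZero_apply hh hp]
  have hα : 0 < p.2.1 + c := by linarith
  have hα0 : ((√(p.2.1 + c) : ℝ) : ℂ) ≠ 0 := by exact_mod_cast (Real.sqrt_pos.2 hα).ne'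
  have hρ0 : (p.2.1 : ℂ) ≠ 0 := by exact_mod_cast hρ.ne'
  have he0 : (Real.exp (rMapPotential h p.1 / 2) : ℂ) ≠ 0 := by
    exact_mod_cast (Real.exp_pos _).ne'
  have hef : (affinePotential (rMapPrepotential h) (homCoord p.1) : ℂ)
      = 1 / (Real.exp (rMapPotential h p.1 / 2) : ℂ) ^ 2 := by
    rw [eq_div_iff (pow_ne_zero _ he0), mul_comm]
    exact_mod_cast exp_rMapPotential_half_sq hh hX
  have ht : ∀ v : CMapSpace n, tri h (cx (imR p.1)) (cx (imR p.1)) v.1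
      = (tri h (imR p.1) (imR p.1) (reR v.1) : ℝ)
        + Complex.I * (tri h (imR p.1) (imR p.1) (imR v.1) : ℝ) := by
    intro v
    conv_lhs => rw [cx_re_add_im v.1]
    rw [tri_add₃, tri_smul₃, tri_cx, tri_cx]
  have hT0 : ((tri h (imR p.1) (imR p.1) (imR p.1) : ℝ) : ℂ) ≠ 0 := by
    exact_mod_cast hX.pos.ne'
  rw [ht, ht, hef]
  generalize Real.exp (rMapPotential h p.1 / 2) = e at *
  push_cast
  generalize ((√(p.2.1 + c) : ℝ) : ℂ) = α at *
  field_simp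
  ring_nf
  simp only [Complex.I_sq]
  ring

/-- The curvature of `θ₀`. -/
theorem curvForm_zero (hh : h.IsHomogeneous 3) (hc : 0 ≤ c)
    (hX : IsHyperbolicPoint h (imR p.1)) (hρ : 0 < p.2.1)
    (hLs : ∀ v, L (star v) = star (L v))
    (hL : ∀ u v, logHess h (imR p.1) u v = ∑ i, L u i * L v i) (v w : CMapSpace n) :
    curvForm (frameForm h c) 0 p v w
      = 2 * (stdHerm (unitaryCoframe h c L p v) (unitaryCoframe h c L p w)).im := by
  have hp : p ∈ positiveRegion h := ⟨hX.pos, hρ⟩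
  have hα : 0 < p.2.1 + c := by linarith
  have hf := affinePotential_pos hh hX
  have he0 := (Real.exp_pos (rMapPotential h p.1 / 2)).ne'
  have hef : affinePotential (rMapPrepotential h) (homCoord p.1)
      = 1 / (Real.exp (rMapPotential h p.1 / 2)) ^ 2 := by
    rw [eq_div_iff (pow_ne_zero _ he0), mul_comm]
    exact exp_rMapPotential_half_sq hh hX
  -- By `im_bilC_cotVec` the contact two-form is an imaginary part of N on dual vectors, and
  -- `logHess_eq` splits it into transversal and period contributions.
  have hcon : v.2.2.2.2 ⬝ᵥ w.2.2.2.1 - v.2.2.2.1 ⬝ᵥ w.2.2.2.2 = 2 *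
      (affinePotential (rMapPrepotential h) (homCoord p.1) *
        (logHess h (imR p.1) (star (kapV h p.1 v)) (kapV h p.1 w)).im
      - 1 / affinePotential (rMapPrepotential h) (homCoord p.1) *
        ((starRingEnd ℂ) (periodForm (rMapPrepotential h) p.1 v) *
          periodForm (rMapPrepotential h) p.1 w).im) := by
    have h1 := im_bilC_cotVec hh hX v.2.2.2.1 v.2.2.2.2 w.2.2.2.1 w.2.2.2.2
    have h2 := logHess_eq hh hX.pos (star (cotVec h p.1 v.2.2.2.1 v.2.2.2.2))
      (cotVec h p.1 w.2.2.2.1 w.2.2.2.2)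
    rw [← star_bilC, bilC_comm (matNX_transpose hh p.1) _ (homCoord p.1),
      ← periodForm_apply hh hX, ← periodForm_apply hh hX] at h2
    have h3 : Fin.tail (star (cotVec h p.1 v.2.2.2.1 v.2.2.2.2))
        - star (cotVec h p.1 v.2.2.2.1 v.2.2.2.2) 0 • p.1 = star (kapV h p.1 v) := by
      ext μ; simp [kapV, kap, Fin.tail]
    rw [h3] at h2
    change logHess h (imR p.1) (star (kapV h p.1 v)) (kapV h p.1 w) = _ at h2
    have hf' : (affinePotential (rMapPrepotential h) (homCoord p.1) : ℂ) ≠ 0 := by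
      exact_mod_cast hf.ne'
    have h4 : bilC (matNX h p.1) (star (cotVec h p.1 v.2.2.2.1 v.2.2.2.2))
        (cotVec h p.1 w.2.2.2.1 w.2.2.2.2) =
        ((-affinePotential (rMapPrepotential h) (homCoord p.1) : ℝ) : ℂ) *
          logHess h (imR p.1) (star (kapV h p.1 v)) (kapV h p.1 w)
        + ((1 / affinePotential (rMapPrepotential h) (homCoord p.1) : ℝ) : ℂ) *
          ((starRingEnd ℂ) (periodForm (rMapPrepotential h) p.1 v) *
          periodForm (rMapPrepotential h) p.1 w) := by
      rw [h2]
      push_cast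
      field_simp
      ring
    have h5 : v.2.2.2.2 ⬝ᵥ w.2.2.2.1 - v.2.2.2.1 ⬝ᵥ w.2.2.2.2 =
      -(v.2.2.2.1 ⬝ᵥ w.2.2.2.2 - v.2.2.2.2 ⬝ᵥ w.2.2.2.1) := by ring
    rw [h5, ← h1, h4, Complex.add_im, Complex.im_ofReal_mul, Complex.im_ofReal_mul]
    ring
  have hcon' : w.2.2.2.2 ⬝ᵥ v.2.2.2.1 - w.2.2.2.1 ⬝ᵥ v.2.2.2.2
      = -(v.2.2.2.2 ⬝ᵥ w.2.2.2.1 - v.2.2.2.1 ⬝ᵥ w.2.2.2.2) := by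
    rw [dotProduct_comm w.2.2.2.2, dotProduct_comm w.2.2.2.1]; ring
  -- The derivative of d^c𝒦 in θ₀ contributes the Kähler form of the base in this real form.
  have hlog : (logHess h (imR p.1) (star v.1) w.1).im
      = (logHess h (imR p.1) (cx (imR w.1)) (cx (reR v.1))).re
        - (logHess h (imR p.1) (cx (imR v.1)) (cx (reR w.1))).re := by
    have e : logHess h (imR p.1) (star v.1) w.1 =
        (logHess h (imR p.1) (cx (reR v.1)) (cx (reR w.1))
          + logHess h (imR p.1) (cx (imR v.1)) (cx (imR w.1)))
        + (logHess h (imR p.1) (cx (imR w.1)) (cx (reR v.1))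
          - logHess h (imR p.1) (cx (imR v.1)) (cx (reR w.1))) * Complex.I := by
      rw [star_eq_re_sub_im]
      conv_lhs => rw [cx_re_add_im w.1]
      simp only [logHess, tri_add₃, tri_sub₂, tri_sub₃, tri_smul₂, tri_smul₃]
      rw [tri_comm₂₃ h (cx (imR p.1)) (cx (imR w.1)) (cx (reR v.1))]
      ring_nf
      simp only [Complex.I_sq]
      ring
    rw [e]
    simp only [logHess_cx, Complex.add_im, Complex.mul_im, Complex.sub_re, Complex.sub_im,
      Complex.ofReal_im, Complex.ofReal_re, Complex.I_re, Complex.I_im]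
    ring
  have hpl : ∀ v w : CMapSpace n, (framePlus h c p v).re * (framePlus h c p w).im
      - (framePlus h c p w).re * (framePlus h c p v).im =
      4 * ((p.2.1 + c) / p.2.1 ^ 2) * Real.exp (rMapPotential h p.1 / 2) ^ 2 *
        ((starRingEnd ℂ) (periodForm (rMapPrepotential h) p.1 v) *
          periodForm (rMapPrepotential h) p.1 w).im := by
    intro v w
    have hs : √(p.2.1 + c) ^ 2 = p.2.1 + c := Real.sq_sqrt hα.le
    rw [framePlus_apply, framePlus_apply, Complex.re_ofReal_mul, Complex.re_ofReal_mul,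
      Complex.im_ofReal_mul, Complex.im_ofReal_mul, Complex.mul_im, Complex.conj_re,
      Complex.conj_im]
    conv_rhs => rw [← hs]
    field_simp
    ring
  have key : curvForm (frameForm h c) 0 p v w = fderiv ℝ (frameZero h c) p v w
      - fderiv ℝ (frameZero h c) p w v + ((framePlus h c p v).re * (framePlus h c p w).im
      - (framePlus h c p w).re * (framePlus h c p v).im) := rfl
  rw [key, fderiv_frameZero hh c hp, fderiv_frameZero hh c hp, hpl, hcon', hcon,
    stdHerm_unitaryCoframe hh hc hX hρ hLs hL]
  simp only [Complex.add_im, Complex.ofReal_im, Complex.mul_im,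
    Complex.ofReal_re, Complex.I_re, Complex.I_im, zero_mul, one_mul, zero_add, add_zero,
    mul_zero, hlog]
  rw [← Complex.mul_im, hef]
  have hρ0 := hρ.ne'
  generalize Real.exp (rMapPotential h p.1 / 2) = e at *
  field_simp
  ring

end QuaternionicFrame

/-! ### The metric and its quaternionic frame on the whole domain -/

section QuaternionicKahler

variable {n : ℕ} {h : MvPolynomial (Fin n) ℝ} {U : Set (Fin n → ℝ)}
  {L : (Fin n → ℂ) →ₗ[ℂ] (Fin n → ℂ)} {c : ℝ} {p : CMapSpace n}

/-- Cramer's rule, entry by entry. -/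
theorem contDiffOn_matrix_inv {E ι : Type*} [NormedAddCommGroup E] [NormedSpace ℝ E] [Fintype ι]
    [DecidableEq ι] {A : E → Matrix ι ι ℂ} {s : Set E} {m : ℕ∞ω}
    (hA : ∀ i j, ContDiffOn ℝ m (fun p => A p i j) s) (hdet : ∀ p ∈ s, (A p).det ≠ 0) (i j : ι) :
    ContDiffOn ℝ m (fun p => (A p)⁻¹ i j) s := by
  have hd : ∀ B : E → Matrix ι ι ℂ, (∀ i j, ContDiffOn ℝ m (fun p => B p i j) s) →
      ContDiffOn ℝ m (fun p => (B p).det) s := by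
    intro B hB
    simp only [Matrix.det_apply]
    exact ContDiffOn.sum fun σ _ => (contDiffOn_prod fun i _ => hB _ _).const_smul _
  simp only [Matrix.inv_def, Ring.inverse_eq_inv', Matrix.smul_apply, smul_eq_mul,
    Matrix.adjugate_apply]
  refine ((hd A hA).inv hdet).mul (hd _ fun k l => ?_)
  simp only [Matrix.updateRow_apply]
  split_ifs
  · exact contDiffOn_const
  · exact hA k l

theorem mem_positiveRegion (hpsr : IsProjectiveSpecialReal h U)
    (hp : p ∈ cMapDomain (rMapDomain U)) :
    p ∈ positiveRegion h ∧ IsHyperbolicPoint h (imR p.1) :=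
  ⟨⟨(hpsr.isHyperbolicPoint hp.1).pos, hp.2⟩, hpsr.isHyperbolicPoint hp.1⟩

theorem contDiffOn_logHess {E : Type*} [NormedAddCommGroup E] [NormedSpace ℝ E]
    {x : E → Fin n → ℝ} {u v : E → Fin n → ℂ} {s : Set E} {m : ℕ∞ω}
    (hx : ContDiffOn ℝ m x s) (hu : ContDiffOn ℝ m u s) (hv : ContDiffOn ℝ m v s)
    (h0 : ∀ p ∈ s, tri h (x p) (x p) (x p) ≠ 0) :
    ContDiffOn ℝ m (fun p => logHess h (x p) (u p) (v p)) s := by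
  have hcx : ContDiffOn ℝ m (fun p => cx (x p)) s := contDiffOn_pi.2 fun i =>
    Complex.ofRealCLM.contDiff.comp_contDiffOn (contDiffOn_pi.1 hx i)
  have hT : ContDiffOn ℝ m (fun p => ((tri h (x p) (x p) (x p) : ℝ) : ℂ)) s :=
    Complex.ofRealCLM.contDiff.comp_contDiffOn (contDiffOn_tri hx hx hx)
  have hT0 : ∀ p ∈ s, ((tri h (x p) (x p) (x p) : ℝ) : ℂ) ≠ 0 := fun p hp => by
    exact_mod_cast h0 p hp
  unfold logHess
  simp only [div_eq_mul_inv]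
  refine ContDiffOn.mul (ContDiffOn.add ?_ ?_) contDiffOn_const
  · exact (contDiffOn_const.mul (contDiffOn_tri hcx hu hv)).mul (hT.inv hT0)
  · exact ((contDiffOn_const.mul (contDiffOn_tri hcx hcx hu)).mul
      (contDiffOn_tri hcx hcx hv)).mul ((hT.pow 2).inv fun p hp => pow_ne_zero _ (hT0 p hp))

theorem contDiff_hessF (hh : h.IsHomogeneous 3) {m : ℕ∞ω} (I J : Fin (n + 1)) :
    ContDiff ℝ m fun X : Fin n → ℂ => hessF (rMapPrepotential h) (homCoord X) I J := by
  have ht : ∀ a b c : (Fin n → ℂ) → Fin n → ℂ, ContDiff ℝ m a → ContDiff ℝ m b → ContDiff ℝ m c →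
      ContDiff ℝ m fun X => tri h (a X) (b X) (c X) := fun a b c ha hb hc =>
    contDiffOn_univ.1 (contDiffOn_tri ha.contDiffOn hb.contDiffOn hc.contDiffOn)
  simp only [hessF_prepotential hh (homCoord_ne _), hessB, tail_homCoord, homCoord_zero]
  have h1 := fun w => ht _ _ _ contDiff_id contDiff_id (contDiff_const (c := w))
  have h2 := fun w w' => ht _ _ _ contDiff_id (contDiff_const (c := w)) (contDiff_const (c := w'))
  have h3 := ht _ _ _ contDiff_id contDiff_id contDiff_id
  simp only [id] at h1 h2 h3
  exact ((((h2 _ _).div_const _).sub (((h1 _).mul contDiff_const).div_const _)).sub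
    (((h1 _).mul contDiff_const).div_const _)).add
      (((h3.mul contDiff_const).mul contDiff_const).div_const _)

theorem contDiffOn_kapV (hpsr : IsProjectiveSpecialReal h U) {m : ℕ∞ω} (v : CMapSpace n) :
    ContDiffOn ℝ m (fun p : CMapSpace n => kapV h p.1 v) (cMapDomain (rMapDomain U)) := by
  have hh := hpsr.cubic
  have hX : ContDiff ℝ m fun p : CMapSpace n => p.1 := contDiff_fst
  have hF : ∀ I J, ContDiffOn ℝ m (fun p : CMapSpace n =>
      hessF (rMapPrepotential h) (homCoord p.1) I J) (cMapDomain (rMapDomain U)) :=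
    fun I J => ((contDiff_hessF hh I J).comp hX).contDiffOn
  have hN : ∀ I J, ContDiffOn ℝ m (fun p : CMapSpace n => matNC h p.1 I J)
      (cMapDomain (rMapDomain U)) := fun I J =>
    Complex.ofRealCLM.contDiff.comp_contDiffOn
      (contDiffOn_const.mul (Complex.imCLM.contDiff.comp_contDiffOn (hF I J)))
  have hNi := contDiffOn_matrix_inv hN fun p hp =>
    (isUnit_det_matNC hh (mem_positiveRegion hpsr hp).2).ne_zero
  have hcot : ∀ I, ContDiffOn ℝ m (fun p : CMapSpace n => cotVec h p.1 v.2.2.2.1 v.2.2.2.2 I)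
      (cMapDomain (rMapDomain U)) := by
    intro I
    simp only [cotVec, perVec, Matrix.mulVec, dotProduct, Pi.add_apply]
    exact ContDiffOn.sum fun J _ => (hNi I J).mul (contDiffOn_const.add
      (ContDiffOn.sum fun K _ => (hF J K).mul contDiffOn_const))
  refine contDiffOn_pi.2 fun μ => ?_
  refine (hcot μ.succ).sub ((hcot 0).mul ?_)
  exact (Complex.conjCLE.contDiff.comp ((contDiff_apply ℝ ℂ μ).comp hX)).contDiffOn

theorem star_logHess (x : Fin n → ℝ) (u v : Fin n → ℂ) :
    (starRingEnd ℂ) (logHess h x u v) = logHess h x (star u) (star v) := by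
  simp only [logHess, map_div₀, map_add, map_mul, star_tri, star_cx, map_pow, Complex.conj_ofReal,
    map_neg, map_ofNat]

theorem oneLoopMetric_eq_stdHerm (hh : h.IsHomogeneous 3) (hc : 0 ≤ c)
    (hX : IsHyperbolicPoint h (imR p.1)) (hρ : 0 < p.2.1)
    (hLs : ∀ v, L (star v) = star (L v))
    (hL : ∀ u v, logHess h (imR p.1) u v = ∑ i, L u i * L v i) (v w : CMapSpace n) :
    oneLoopMetric (rMapMetric h) (rMapPrepotential h) c p v w
      = (stdHerm (unitaryCoframe h c L p v) (unitaryCoframe h c L p w)).re := by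
  have e : ∀ u v : Fin n → ℂ, (logHess h (imR p.1) (star u) v).re
      = (logHess h (imR p.1) u (star v)).re := by
    intro u v
    rw [← Complex.conj_re, star_logHess, star_star]
  rw [oneLoopMetric_apply hh hc hX hρ, stdHerm_unitaryCoframe hh hc hX hρ hLs hL]
  simp only [Complex.add_re, Complex.re_ofReal_mul, Complex.ofReal_re, e]
  rw [Complex.re_mul_ofReal, Complex.I_re]
  simp only [Complex.mul_re, Complex.conj_re, Complex.conj_im]
  ring

theorem stdHerm_self_re {m : ℕ} (q : (Fin m → ℂ) × (Fin m → ℂ)) :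
    (stdHerm q q).re = ∑ i, Complex.normSq (q.1 i) + ∑ i, Complex.normSq (q.2 i) := by
  simp only [stdHerm, ← Complex.normSq_eq_conj_mul_self, ← Complex.ofReal_sum,
    ← Complex.ofReal_add, Complex.ofReal_re]

theorem star_stdHerm {m : ℕ} (q r : (Fin m → ℂ) × (Fin m → ℂ)) :
    (starRingEnd ℂ) (stdHerm q r) = stdHerm r q := by
  simp only [stdHerm, map_add, map_sum, map_mul, Complex.conj_conj, mul_comm]

theorem stdHerm_self_pos {m : ℕ} {q : (Fin m → ℂ) × (Fin m → ℂ)} (hq : q ≠ 0) :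
    0 < (stdHerm q q).re := by
  rw [stdHerm_self_re]
  have h1 : 0 ≤ ∑ i, Complex.normSq (q.1 i) := Finset.sum_nonneg fun i _ => Complex.normSq_nonneg _
  have h2 : 0 ≤ ∑ i, Complex.normSq (q.2 i) := Finset.sum_nonneg fun i _ => Complex.normSq_nonneg _
  refine lt_of_le_of_ne (add_nonneg h1 h2) fun h0 => hq ?_
  have h3 := (add_eq_zero_iff_of_nonneg h1 h2).1 h0.symm
  rw [Finset.sum_eq_zero_iff_of_nonneg fun i _ => Complex.normSq_nonneg _,
    Finset.sum_eq_zero_iff_of_nonneg fun i _ => Complex.normSq_nonneg _] at h3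
  ext i
  · exact Complex.normSq_eq_zero.1 (h3.1 i (Finset.mem_univ i))
  · exact Complex.normSq_eq_zero.1 (h3.2 i (Finset.mem_univ i))

/-- If the transversal part vanishes, the dual vector is a multiple of z̄ with z = (1, X), and N(z,
z̄) = f ≠ 0 forces the multiple to be zero. A zero dual vector has b = 0 as its imaginary part, and
then a = 0. -/
theorem eq_zero_of_cotVec (hh : h.IsHomogeneous 3) {X : Fin n → ℂ}
    (hX : IsHyperbolicPoint h (imR X)) {a b : Fin (n + 1) → ℝ}
    (hA : bilC (matNX h X) (homCoord X) (cotVec h X a b) = 0)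
    (hκ : kap X (cotVec h X a b) = 0) : a = 0 ∧ b = 0 := by
  have hu : cotVec h X a b = cotVec h X a b 0 • star (homCoord X) := by
    ext i
    refine Fin.cases ?_ (fun μ => ?_) i
    · simp [homCoord]
    · have := congrFun hκ μ
      simp only [kap, Pi.sub_apply, Fin.tail, Pi.smul_apply, Pi.star_apply, smul_eq_mul,
        Pi.zero_apply, sub_eq_zero] at this
      rw [this]
      simp [homCoord]
  have hf : (affinePotential (rMapPrepotential h) (homCoord X) : ℂ) ≠ 0 := by
    exact_mod_cast (affinePotential_pos hh hX).ne'
  rw [hu, bilC_smul_right, bilC_homCoord_star hh] at hA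
  have h0 : cotVec h X a b = 0 := by
    rw [hu, (mul_eq_zero.1 hA).resolve_right hf, zero_smul]
  have hb : b = 0 := by
    have := cotVec_sub_star hh hX a b
    rw [h0, star_zero, sub_zero] at this
    ext i
    have := congrFun this i
    simpa using this.symm
  have ha : perVec h X a b = 0 := by
    rw [← matNC_mulVec_cotVec hh hX, h0, Matrix.mulVec_zero]
  refine ⟨?_, hb⟩
  ext i
  have := congrFun ha i
  rw [hb] at this
  simpa [perVec, Matrix.mulVec, dotProduct] using this

/-- The coframe is triangular: it determines dX and dρ directly, then dζ̃ and dζ by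
`eq_zero_of_cotVec`, and finally dφ̃ from the connection form. -/
theorem unitaryCoframe_injective (hh : h.IsHomogeneous 3) (hc : 0 ≤ c)
    (hX : IsHyperbolicPoint h (imR p.1)) (hρ : 0 < p.2.1) (hinj : Function.Injective L) :
    Function.Injective (unitaryCoframe h c L p) := by
  refine (injective_iff_map_eq_zero _).2 fun v hv => ?_
  have hα : 0 < √(p.2.1 + c) := Real.sqrt_pos.2 (by linarith)
  have hβ : 0 < √(p.2.1 + 2 * c) := Real.sqrt_pos.2 (by linarith)
  have hγ : 0 < √p.2.1 := Real.sqrt_pos.2 hρ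
  have he := Real.exp_pos (rMapPotential h p.1 / 2)
  have h1 := congrFun (congrArg Prod.fst hv)
  have h2 := congrFun (congrArg Prod.snd hv)
  simp only [unitaryCoframe, LinearMap.coe_mk, AddHom.coe_mk, Prod.fst_zero, Prod.snd_zero,
    Pi.zero_apply] at h1 h2
  have h10 := h1 0
  have h20 := h2 0
  have hL0 : ∀ (k : ℝ) (x : Fin n → ℂ), k ≠ 0 → (∀ μ, ((k : ℂ) • L x) μ = 0) → x = 0 := by
    intro k x hk hx
    apply hinj
    rw [map_zero]
    ext μ
    exact (mul_eq_zero.1 (hx μ)).resolve_left (by exact_mod_cast hk)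
  have hX0 : v.1 = 0 := hL0 _ _ (div_pos hα hγ).ne' fun μ => h1 μ.succ
  have hκ : kapV h p.1 v = 0 := hL0 (-(1 / (Real.exp (rMapPotential h p.1 / 2) * √p.2.1))) _
    (neg_ne_zero.2 (by positivity)) fun μ => by
      rw [Complex.ofReal_neg]; exact h2 μ.succ
  rw [Fin.cons_zero] at h10 h20
  have hA : periodForm (rMapPrepotential h) p.1 v = 0 := by
    refine (mul_eq_zero.1 h20).resolve_left (neg_ne_zero.2 ?_)
    exact_mod_cast (by positivity)
  have hr := congrArg Complex.re h10
  have hC := congrArg Complex.im h10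
  rw [Complex.sub_re, Complex.ofReal_re, Complex.re_ofReal_mul, Complex.I_re, mul_zero, sub_zero,
    Complex.zero_re] at hr
  rw [Complex.sub_im, Complex.ofReal_im, Complex.im_ofReal_mul, Complex.I_im, mul_one, zero_sub,
    Complex.zero_im, neg_eq_zero] at hC
  have hr0 : v.2.1 = 0 := (mul_eq_zero.1 hr).resolve_left (by positivity)
  have hC0 : connForm h c p v = 0 := (mul_eq_zero.1 hC).resolve_left (by positivity)
  obtain ⟨ha, hb⟩ := eq_zero_of_cotVec hh hX (by rw [← periodForm_apply hh hX, hA]) hκ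
  have hφ : v.2.2.1 = 0 := by
    have e : connForm h c p v = contactForm p v
        + c * (dC (kahlerPotential (rMapPrepotential h)) p.1 v.1) := rfl
    rw [e, hX0, map_zero, contactForm_apply, ha, hb] at hC0
    simpa using hC0
  exact Prod.ext hX0 (Prod.ext hr0 (Prod.ext hφ (Prod.ext ha hb)))

theorem finrank_pi_complex (m : ℕ) : Module.finrank ℝ (Fin m → ℂ) = 2 * m := by
  rw [Module.finrank_pi_fintype]
  simp [Complex.finrank_real_complex, mul_comm]

theorem finrank_CMapSpace : Module.finrank ℝ (CMapSpace n) = 4 * (n + 1) := by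
  simp only [Module.finrank_prod, finrank_pi_complex, Module.finrank_self, Module.finrank_fin_fun]
  ring

theorem unitaryCoframe_bijective (hh : h.IsHomogeneous 3) (hc : 0 ≤ c)
    (hX : IsHyperbolicPoint h (imR p.1)) (hρ : 0 < p.2.1) (hinj : Function.Injective L) :
    Function.Bijective (unitaryCoframe h c L p) := by
  have h1 := unitaryCoframe_injective hh hc hX hρ hinj
  refine ⟨h1, (LinearMap.injective_iff_surjective_of_finrank_eq_finrank ?_).1 h1⟩
  rw [finrank_CMapSpace, Module.finrank_prod, finrank_pi_complex]
  ring

theorem isRiemannianMetricOn_oneLoopMetric (hpsr : IsProjectiveSpecialReal h U) (hc : 0 ≤ c) :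
    IsRiemannianMetricOn (cMapDomain (rMapDomain U))
      (oneLoopMetric (rMapMetric h) (rMapPrepotential h) c) where
  contDiffOn := by
    have hh := hpsr.cubic
    rw [contDiffOn_clm_apply]
    intro v
    rw [contDiffOn_clm_apply]
    intro w
    -- Smoothness is checked on this formula and not on the coframe, whose factor L is only chosen
    -- pointwise.
    refine ContDiffOn.congr ?_ fun p hp => oneLoopMetric_apply hh hc
      (mem_positiveRegion hpsr hp).2 hp.2 v w
    have hsub : cMapDomain (rMapDomain U) ⊆ positiveRegion h :=
      fun p hp => (mem_positiveRegion hpsr hp).1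
    have hρ : ContDiffOn ℝ ∞ (fun p : CMapSpace n => p.2.1) (cMapDomain (rMapDomain U)) :=
      contDiffOn_rho
    have hf : ContDiffOn ℝ ∞ (fun p : CMapSpace n =>
        affinePotential (rMapPrepotential h) (homCoord p.1)) (cMapDomain (rMapDomain U)) := by
      simp only [affinePotential_homCoord hh]
      exact (contDiff_const.mul contDiff_tri_imR_fst).contDiffOn
    have hf0 : ∀ p ∈ cMapDomain (rMapDomain U),
        affinePotential (rMapPrepotential h) (homCoord p.1) ≠ 0 := fun p hp =>
      (affinePotential_pos hh (mem_positiveRegion hpsr hp).2).ne'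
    have him : ContDiffOn ℝ ∞ (fun p : CMapSpace n => imR p.1) (cMapDomain (rMapDomain U)) :=
      (contDiff_imR.comp contDiff_fst).contDiffOn
    have hstar : ∀ {f : CMapSpace n → Fin n → ℂ}, ContDiffOn ℝ ∞ f (cMapDomain (rMapDomain U)) →
        ContDiffOn ℝ ∞ (fun p => star (f p)) (cMapDomain (rMapDomain U)) := fun hf =>
      contDiffOn_pi.2 fun μ => Complex.conjCLE.contDiff.comp_contDiffOn (contDiffOn_pi.1 hf μ)
    have hre : ∀ {f : CMapSpace n → ℂ}, ContDiffOn ℝ ∞ f (cMapDomain (rMapDomain U)) →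
        ContDiffOn ℝ ∞ (fun p => (f p).re) (cMapDomain (rMapDomain U)) := fun hf =>
      Complex.reCLM.contDiff.comp_contDiffOn hf
    have hlog := contDiffOn_logHess (h := h) him (contDiffOn_const (c := v.1))
      (contDiffOn_const (c := star w.1)) fun p hp => (hsub hp).1.ne'
    have hlog' := contDiffOn_logHess (h := h) him (contDiffOn_kapV hpsr v)
      (hstar (contDiffOn_kapV hpsr w)) fun p hp => (hsub hp).1.ne'
    have hC := fun v => (contDiffOn_connForm_apply hh c v).mono hsub
    have hA := fun v => (contDiff_periodForm_apply hh v).contDiffOn (s := cMapDomain (rMapDomain U))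
    have hA' := Complex.conjCLE.contDiff.comp_contDiffOn (hA w)
    have hρ0 : ∀ p ∈ cMapDomain (rMapDomain U), p.2.1 ≠ 0 := fun p hp => hp.2.ne'
    have hρ4 : ∀ p ∈ cMapDomain (rMapDomain U), 4 * p.2.1 ^ 2 ≠ 0 := fun p hp =>
      mul_ne_zero four_ne_zero (pow_ne_zero _ hp.2.ne')
    have hρc : ∀ p ∈ cMapDomain (rMapDomain U), p.2.1 + c ≠ 0 := fun p hp =>
      (add_pos_of_pos_of_nonneg hp.2 hc).ne'
    have hρ2c : ∀ p ∈ cMapDomain (rMapDomain U), p.2.1 + 2 * c ≠ 0 := fun p hp =>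
      (add_pos_of_pos_of_nonneg hp.2 (by positivity)).ne'
    have hρ1 := hρ.add (contDiffOn_const (c := c))
    have hρ2 := hρ.add (contDiffOn_const (c := 2 * c))
    have hq := (contDiffOn_const (c := (1 : ℝ))).div
      ((contDiffOn_const (c := (4 : ℝ))).mul (hρ.pow 2)) hρ4
    exact (((((hρ1.div hρ hρ0).mul (hre hlog)).add
      ((hq.mul (hρ2.div hρ1 hρc)).mul contDiffOn_const)).add
      ((hq.mul (hρ1.div hρ2 hρ2c)).mul ((hC v).mul (hC w)))).add
      ((hf.div hρ hρ0).mul (hre hlog'))).add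
      ((hρ2.div ((hρ.pow 2).mul hf) fun p hp => mul_ne_zero (pow_ne_zero _ (hρ0 p hp))
        (hf0 p hp)).mul (hre ((hA v).mul hA')))
  symm p hp v w := by
    obtain ⟨L, -, hLs, hL⟩ := (mem_positiveRegion hpsr hp).2.exists_logHess_factor
    rw [oneLoopMetric_eq_stdHerm hpsr.cubic hc (mem_positiveRegion hpsr hp).2 hp.2 hLs hL,
      oneLoopMetric_eq_stdHerm hpsr.cubic hc (mem_positiveRegion hpsr hp).2 hp.2 hLs hL,
      ← star_stdHerm, Complex.conj_re]
  pos p hp v hv := by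
    obtain ⟨L, hinj, hLs, hL⟩ := (mem_positiveRegion hpsr hp).2.exists_logHess_factor
    rw [oneLoopMetric_eq_stdHerm hpsr.cubic hc (mem_positiveRegion hpsr hp).2 hp.2 hLs hL]
    refine stdHerm_self_pos fun h0 => hv ?_
    exact unitaryCoframe_injective hpsr.cubic hc (mem_positiveRegion hpsr hp).2 hp.2 hinj
      (h0.trans (map_zero _).symm)

/-- Pull the model structure back through the coframe at p. Applying i to the first argument of the
standard Hermitian form exchanges real and imaginary parts, and applying the antilinear structure
turns it into the symplectic form. These are half the curvature forms found above. -/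
theorem exists_quaternionic_at (hpsr : IsProjectiveSpecialReal h U) (hc : 0 ≤ c)
    (hp : p ∈ cMapDomain (rMapDomain U)) :
    ∃ J : Fin 3 → CMapSpace n →L[ℝ] CMapSpace n, (∀ a, J a * J a = -1) ∧ J 0 * J 1 = J 2 ∧
      ∀ a v w, 2 * oneLoopMetric (rMapMetric h) (rMapPrepotential h) c p (J a v) w
        = curvForm (frameForm h c) a p v w := by
  have hh := hpsr.cubic
  have hX := (mem_positiveRegion hpsr hp).2
  obtain ⟨L, hinj, hLs, hL⟩ := hX.exists_logHess_factor
  obtain ⟨J, hsq, hmul, h0, h1⟩ := exists_quaternionic_of_bijective _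
    (unitaryCoframe_bijective hh hc hX hp.2 hinj)
  refine ⟨J, hsq, hmul, ?_⟩
  have hI : ∀ q r : (Fin (n + 1) → ℂ) × (Fin (n + 1) → ℂ),
      stdHerm (Complex.I • q.1, Complex.I • q.2) r = -Complex.I * stdHerm q r := by
    intro q r
    simp only [stdHerm, Pi.smul_apply, smul_eq_mul, map_mul, Complex.conj_I, mul_add,
      Finset.mul_sum, mul_assoc]
  have hS : ∀ q r : (Fin (n + 1) → ℂ) × (Fin (n + 1) → ℂ),
      stdHerm (-star q.2, star q.1) r = stdSymp q r := by
    intro q r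
    simp only [stdHerm, stdSymp, ← Finset.sum_add_distrib, Pi.neg_apply, Pi.star_apply, map_neg]
    refine Finset.sum_congr rfl fun i _ => ?_
    simp only [← starRingEnd_apply, Complex.conj_conj]
    ring
  have hpl := curvForm_plus hh hc hX hp.2 hL
  intro a v w
  rw [oneLoopMetric_eq_stdHerm hh hc hX hp.2 hLs hL]
  have hre := congrArg Complex.re (hpl v w)
  have him := congrArg Complex.im (hpl v w)
  simp only [Complex.add_re, Complex.add_im, Complex.ofReal_re, Complex.ofReal_im,
    Complex.re_ofReal_mul, Complex.im_ofReal_mul, Complex.I_re, Complex.I_im, mul_zero, add_zero,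
    mul_one, zero_add] at hre him
  have r2 : ∀ z : ℂ, (2 * z).re = 2 * z.re := fun z => by simp
  have i2 : ∀ z : ℂ, (2 * z).im = 2 * z.im := fun z => by simp
  have rI : ∀ z : ℂ, (-Complex.I * z).re = z.im := fun z => by simp
  fin_cases a
  · change 2 * (stdHerm (unitaryCoframe h c L p (J 0 v)) _).re = curvForm (frameForm h c) 0 p v w
    rw [h0, hI, rI, curvForm_zero hh hc hX hp.2 hLs hL]
  · change 2 * (stdHerm (unitaryCoframe h c L p (J 1 v)) _).re = curvForm (frameForm h c) 1 p v w
    rw [h1, hS, hre, r2]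
  · change 2 * (stdHerm (unitaryCoframe h c L p (J 2 v)) _).re = curvForm (frameForm h c) 2 p v w
    have e : J 2 v = J 0 (J 1 v) := by rw [← hmul]; rfl
    rw [e, h0, hI, rI, h1, hS, him, i2]

theorem isOpen_cMapDomain {M : Set (Fin n → ℂ)} (hM : IsOpen M) : IsOpen (cMapDomain M) :=
  (hM.preimage continuous_fst).inter
    (isOpen_lt continuous_const (continuous_fst.comp continuous_snd))

theorem isConnected_cMapDomain {M : Set (Fin n → ℂ)} (hM : IsConnected M) :
    IsConnected (cMapDomain M) := by
  have : cMapDomain M = M ×ˢ (Set.Ioi (0 : ℝ) ×ˢ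
      (Set.univ : Set (ℝ × (Fin (n + 1) → ℝ) × (Fin (n + 1) → ℝ)))) := by
    ext p; simp [cMapDomain]
  rw [this]
  exact hM.prod (isConnected_Ioi.prod isConnected_univ)

/-- J is chosen separately at each point, and its value 0 outside the domain plays no role: the
notion of frame demands smoothness of θ and g only. -/
theorem exists_isQuaternionicFrame (hpsr : IsProjectiveSpecialReal h U) (hc : 0 ≤ c) :
    ∃ J, IsQuaternionicFrame (cMapDomain (rMapDomain U))
      (oneLoopMetric (rMapMetric h) (rMapPrepotential h) c) (frameForm h c) J 2 := by
  classical
  refine ⟨fun a p => if hp : p ∈ cMapDomain (rMapDomain U) then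
    (exists_quaternionic_at (h := h) hpsr hc hp).choose a else 0,
    isOpen_cMapDomain (isOpen_rMapDomain hpsr.isOpen),
    isRiemannianMetricOn_oneLoopMetric hpsr hc, two_ne_zero,
    fun a => (contDiffOn_frameForm hpsr.cubic hc a).mono
      fun p hp => (mem_positiveRegion hpsr hp).1, ?_, ?_, ?_⟩
  · intro p hp a
    simp only [dif_pos hp]
    exact (exists_quaternionic_at hpsr hc hp).choose_spec.1 a
  · intro p hp
    simp only [dif_pos hp]
    exact (exists_quaternionic_at hpsr hc hp).choose_spec.2.1
  · intro p hp a v w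
    simp only [dif_pos hp]
    exact (exists_quaternionic_at hpsr hc hp).choose_spec.2.2 a v w

theorem isQuaternionicKahler_oneLoopMetric (hpsr : IsProjectiveSpecialReal h U) (hc : 0 ≤ c) :
    IsQuaternionicKahler (cMapDomain (rMapDomain U))
      (oneLoopMetric (rMapMetric h) (rMapPrepotential h) c) := by
  obtain ⟨J, hJ⟩ := exists_isQuaternionicFrame (h := h) hpsr hc
  refine hJ.isQuaternionicKahler
    (isConnected_cMapDomain (isConnected_rMapDomain hpsr.isConnected)) ?_
  rw [finrank_CMapSpace]
  -- U is nonempty and avoids 0, so n ≥ 1 and the dimension 4(n + 1) is at least 8.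
  have hn : n ≠ 0 := by
    rintro rfl
    obtain ⟨x, hx⟩ := hpsr.isConnected.nonempty
    exact hpsr.zero_notMem (by rwa [Subsingleton.elim x 0] at hx)
  omega

end QuaternionicKahler

/-! ### Lengths, Cauchy sequences and traps -/

section Completeness

variable {E F : Type*} [NormedAddCommGroup E] [NormedSpace ℝ E] [NormedAddCommGroup F]
  [NormedSpace ℝ F] {S Ω : Set E} {g : E → E →L[ℝ] E →L[ℝ] ℝ} {γ : ℝ → E}

theorem exists_curve_of_riemDist_lt {x y : E} {ε : ℝ≥0∞} (hxy : riemDist S g x y < ε) :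
    ∃ γ : ℝ → E, ContDiffOn ℝ 1 γ (Set.Icc 0 1) ∧ Set.MapsTo γ (Set.Icc 0 1) S ∧ γ 0 = x ∧
      γ 1 = y ∧ curveLength g γ < ε := by
  simp only [riemDist, iInf_lt_iff] at hxy
  obtain ⟨γ, h1, h2, h3, h4, h5⟩ := hxy
  exact ⟨γ, h1, h2, h3, h4, h5⟩

theorem riemDist_le_curveLength {x y : E} (h1 : ContDiffOn ℝ 1 γ (Set.Icc 0 1))
    (h2 : Set.MapsTo γ (Set.Icc 0 1) S) (h3 : γ 0 = x) (h4 : γ 1 = y) :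
    riemDist S g x y ≤ curveLength g γ :=
  iInf_le_of_le γ (iInf_le_of_le h1 (iInf_le_of_le h2 (iInf_le_of_le h3 (iInf_le _ h4))))

theorem hasDerivWithinAt_of_contDiffOn (hγ : ContDiffOn ℝ 1 γ (Set.Icc 0 1)) {t : ℝ}
    (ht : t ∈ Set.Icc (0 : ℝ) 1) :
    HasDerivWithinAt γ (derivWithin γ (Set.Icc 0 1) t) (Set.Icc 0 1) t :=
  ((hγ.differentiableOn (by simp)) t ht).hasDerivWithinAt

/-- A `C¹` map whose derivative is bounded by the metric along a curve is Lipschitz with respect to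
the length of the curve. -/
theorem enorm_comp_sub_le (hγ : ContDiffOn ℝ 1 γ (Set.Icc 0 1)) {f : E → F}
    (hf : ∀ t ∈ Set.Icc (0 : ℝ) 1, ContDiffAt ℝ 1 f (γ t)) {C : ℝ} (hC : 0 ≤ C)
    (hb : ∀ t ∈ Set.Icc (0 : ℝ) 1, ‖fderiv ℝ f (γ t) (derivWithin γ (Set.Icc 0 1) t)‖ ≤
      C * √(g (γ t) (derivWithin γ (Set.Icc 0 1) t) (derivWithin γ (Set.Icc 0 1) t)))
    {t : ℝ} (ht : t ∈ Set.Icc (0 : ℝ) 1) :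
    ‖f (γ t) - f (γ 0)‖ₑ ≤ ENNReal.ofReal C * curveLength g γ := by
  rcases eq_or_lt_of_le ht.1 with h0 | h0
  · rw [← h0]; simp
  have hsub : Set.Icc 0 t ⊆ Set.Icc (0 : ℝ) 1 := Set.Icc_subset_Icc_right ht.2
  have hfγ : ContDiffOn ℝ 1 (f ∘ γ) (Set.Icc 0 t) := fun s hs =>
    (hf s (hsub hs)).comp_contDiffWithinAt s ((hγ s (hsub hs)).mono hsub)
  have h1 := enorm_sub_le_lintegral_derivWithin_Icc_of_contDiffOn_Icc hfγ h0.le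
  refine h1.trans ?_
  rw [curveLength, ← MeasureTheory.lintegral_const_mul' _ _ ENNReal.ofReal_ne_top]
  refine (MeasureTheory.setLIntegral_mono' measurableSet_Icc fun s hs => ?_).trans
    (MeasureTheory.lintegral_mono_set hsub)
  have hd := (((hf s (hsub hs)).differentiableAt (by simp)).hasFDerivAt.comp_hasDerivWithinAt s
    (hasDerivWithinAt_of_contDiffOn hγ (hsub hs))).mono hsub
  rw [hd.derivWithin (uniqueDiffOn_Icc h0 s hs), ← ENNReal.ofReal_mul hC, ← ofReal_norm]
  exact ENNReal.ofReal_le_ofReal (hb s (hsub hs))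

/-- The sequence `u` is Cauchy for the Riemannian distance. -/
def IsRiemCauchy (S : Set E) (g : E → E →L[ℝ] E →L[ℝ] ℝ) (u : ℕ → E) : Prop :=
  ∀ ε : ℝ≥0∞, 0 < ε → ∃ k₀, ∀ k ≥ k₀, ∀ l ≥ k₀, riemDist S g (u k) (u l) < ε

/-- Short curves that start at late points of the sequence `u` stay in `K`. -/
def IsTrap (S : Set E) (g : E → E →L[ℝ] E →L[ℝ] ℝ) (u : ℕ → E) (K : Set E) : Prop :=
  ∃ ε : ℝ≥0∞, 0 < ε ∧ ∃ k₀, ∀ k ≥ k₀, ∀ γ : ℝ → E, ContDiffOn ℝ 1 γ (Set.Icc 0 1) →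
    Set.MapsTo γ (Set.Icc 0 1) S → γ 0 = u k → curveLength g γ < ε →
    Set.MapsTo γ (Set.Icc 0 1) K

variable {u : ℕ → E} {K : Set E}

theorem IsTrap.mono (h : IsTrap S g u K) {K' : Set E} (hK : ∀ p ∈ K, p ∈ S → p ∈ K') :
    IsTrap S g u K' := by
  obtain ⟨ε, hε, k₀, hk⟩ := h
  exact ⟨ε, hε, k₀, fun k hkk γ h1 h2 h3 h4 t ht => hK _ (hk k hkk γ h1 h2 h3 h4 ht) (h2 ht)⟩

theorem IsTrap.eventually_mem (h : IsTrap S g u K) (hu : IsRiemCauchy S g u) :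
    ∀ᶠ k in Filter.atTop, u k ∈ K := by
  obtain ⟨ε, hε, k₀, hk⟩ := h
  obtain ⟨k₁, hk₁⟩ := hu ε hε
  filter_upwards [Filter.eventually_ge_atTop (max k₀ k₁)] with k hkk
  -- The Cauchy condition with l = k supplies a short curve from u k to itself, to which the trap
  -- applies.
  obtain ⟨γ, h1, h2, h3, -, h5⟩ := exists_curve_of_riemDist_lt
    (hk₁ k (le_of_max_le_right hkk) k (le_of_max_le_right hkk))
  rw [← h3]
  exact hk k (le_of_max_le_left hkk) γ h1 h2 h3 h5 ⟨le_rfl, zero_le_one⟩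

/-- A function whose derivative is bounded by the metric on a trap converges along a Cauchy
sequence, and its values near the limit cut out a smaller trap. -/
theorem IsTrap.exists_limit [CompleteSpace F] (h : IsTrap S g u K) (hu : IsRiemCauchy S g u)
    {f : E → F} (hf : ∀ p ∈ S, ContDiffAt ℝ 1 f p) {C : ℝ} (hC : 0 ≤ C)
    (hb : ∀ p ∈ S, p ∈ K → ∀ v, ‖fderiv ℝ f p v‖ ≤ C * √(g p v v)) :
    ∃ a, Filter.Tendsto (fun k => f (u k)) Filter.atTop (𝓝 a) ∧
      ∀ δ : ℝ, 0 < δ → IsTrap S g u (K ∩ {p | dist (f p) a < δ}) := by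
  obtain ⟨ε, hε, k₀, hk⟩ := h
  have key : ∀ k ≥ k₀, ∀ γ : ℝ → E, ContDiffOn ℝ 1 γ (Set.Icc 0 1) →
      Set.MapsTo γ (Set.Icc 0 1) S → γ 0 = u k → ∀ η : ℝ, 0 ≤ η →
      curveLength g γ < min ε (ENNReal.ofReal η) → ∀ t ∈ Set.Icc (0 : ℝ) 1,
      dist (f (γ t)) (f (u k)) ≤ C * η := by
    intro k hkk γ h1 h2 h3 η hη h4 t ht
    have hK := hk k hkk γ h1 h2 h3 (h4.trans_le (min_le_left _ _))
    have h5 := enorm_comp_sub_le (g := g) h1 (fun t ht => hf _ (h2 ht)) hC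
      (fun t ht => hb _ (h2 ht) (hK ht) _) ht
    have h6 : ‖f (γ t) - f (γ 0)‖ₑ ≤ ENNReal.ofReal (C * η) := by
      rw [ENNReal.ofReal_mul hC]
      exact h5.trans (mul_le_mul_right (h4.le.trans (min_le_right _ _)) _)
    rw [← ofReal_norm, ENNReal.ofReal_le_ofReal_iff (mul_nonneg hC hη), h3] at h6
    rwa [dist_eq_norm]
  have hcau : CauchySeq fun k => f (u k) := by
    refine Metric.cauchySeq_iff.2 fun δ hδ => ?_
    -- With C + 1 in the denominator C = 0 is allowed, and C times this number is at most δ/2.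
    have hη : 0 < δ / (2 * (C + 1)) := by positivity
    obtain ⟨k₁, hk₁⟩ := hu (min ε (ENNReal.ofReal (δ / (2 * (C + 1)))))
      (lt_min hε (ENNReal.ofReal_pos.2 hη))
    refine ⟨max k₀ k₁, fun k hkk l hl => ?_⟩
    obtain ⟨γ, h1, h2, h3, h4, h5⟩ := exists_curve_of_riemDist_lt
      (hk₁ l (le_of_max_le_right hl) k (le_of_max_le_right hkk))
    have := key l (le_of_max_le_left hl) γ h1 h2 h3 _ hη.le h5 1 ⟨zero_le_one, le_rfl⟩
    rw [h4] at this
    refine this.trans_lt ?_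
    have e : C * (δ / (2 * (C + 1))) = δ / 2 * (C / (C + 1)) := by field_simp
    rw [e]
    have : C / (C + 1) ≤ 1 := (div_le_one (by positivity)).2 (by linarith)
    nlinarith
  obtain ⟨a, ha⟩ := cauchySeq_tendsto_of_complete hcau
  refine ⟨a, ha, fun δ hδ => ?_⟩
  have hη : 0 < δ / (2 * (C + 1)) := by positivity
  obtain ⟨k₁, hk₁⟩ := Metric.tendsto_atTop.1 ha (δ / 2) (by positivity)
  refine ⟨min ε (ENNReal.ofReal (δ / (2 * (C + 1)))), lt_min hε (ENNReal.ofReal_pos.2 hη),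
    max k₀ k₁, fun k hkk γ h1 h2 h3 h4 t ht => ⟨?_, ?_⟩⟩
  · exact hk k (le_of_max_le_left hkk) γ h1 h2 h3 (h4.trans_le (min_le_left _ _)) ht
  · have h5 := key k (le_of_max_le_left hkk) γ h1 h2 h3 _ hη.le h4 t ht
    have h6 := hk₁ k (le_of_max_le_right hkk)
    have e : C * (δ / (2 * (C + 1))) = δ / 2 * (C / (C + 1)) := by field_simp
    rw [e] at h5
    have h7 : C / (C + 1) ≤ 1 := (div_le_one (by positivity)).2 (by linarith)
    have h8 := dist_triangle (f (γ t)) (f (u k)) a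
    change dist (f (γ t)) a < δ
    nlinarith

/-- A continuous family of positive definite quadratic functions is uniformly definite on a compact
set. -/
theorem exists_uniform_pos [FiniteDimensional ℝ F] {X : Type*} [TopologicalSpace X] {K : Set X}
    (hK : IsCompact K) {q : X → F → ℝ}
    (hq : ContinuousOn (fun z : X × F => q z.1 z.2) (K ×ˢ Set.univ))
    (hsm : ∀ x ∈ K, ∀ (r : ℝ) v, q x (r • v) = r ^ 2 * q x v)
    (hpos : ∀ x ∈ K, ∀ v, v ≠ 0 → 0 < q x v) :
    ∃ C : ℝ, 0 ≤ C ∧ ∀ x ∈ K, ∀ v, ‖v‖ ≤ C * √(q x v) := by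
  have hc : IsCompact (K ×ˢ Metric.sphere (0 : F) 1) := hK.prod (isCompact_sphere _ _)
  obtain ⟨m, hm, hle⟩ : ∃ m : ℝ, 0 < m ∧ ∀ z ∈ K ×ˢ Metric.sphere (0 : F) 1, m ≤ q z.1 z.2 := by
    rcases (K ×ˢ Metric.sphere (0 : F) 1).eq_empty_or_nonempty with he | he
    · exact ⟨1, one_pos, by simp [he]⟩
    · obtain ⟨z, hz, hmin⟩ := hc.exists_isMinOn he
        (hq.mono (Set.prod_mono_right (Set.subset_univ _)))
      refine ⟨q z.1 z.2, hpos _ hz.1 _ ?_, fun w hw => hmin hw⟩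
      rintro h0
      have := hz.2
      rw [h0] at this
      simp at this
  refine ⟨1 / √m, by positivity, fun x hx v => ?_⟩
  by_cases hv : v = 0
  · rw [hv, norm_zero]; positivity
  have hn : 0 < ‖v‖ := norm_pos_iff.2 hv
  have h1 : m ≤ q x (‖v‖⁻¹ • v) := hle (x, ‖v‖⁻¹ • v) ⟨hx, by
    simp [norm_smul, inv_mul_cancel₀ hn.ne']⟩
  rw [hsm x hx, inv_pow, inv_mul_eq_div, le_div_iff₀ (by positivity)] at h1
  have h2 : √m * ‖v‖ ≤ √(q x v) := by
    rw [← Real.sqrt_sq hn.le, ← Real.sqrt_mul hm.le]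
    exact Real.sqrt_le_sqrt h1
  rw [div_mul_eq_mul_div, one_mul, le_div_iff₀ (Real.sqrt_pos.2 hm)]
  linarith

/-- On a small ball around x, which is convex, g is bounded by M times the Euclidean metric, so
straight segments to x have length at most √M times their Euclidean length. -/
theorem tendsto_riemDist (hΩ : IsOpen Ω) (hg : ContinuousOn g Ω) {x : E} (hx : x ∈ Ω)
    (hu : Filter.Tendsto u Filter.atTop (𝓝 x)) :
    Filter.Tendsto (fun k => riemDist Ω g (u k) x) Filter.atTop (𝓝 0) := by
  have hgx := (hg.continuousAt (hΩ.mem_nhds hx)).norm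
  set M := ‖g x‖ + 1
  have hev : ∀ᶠ p in 𝓝 x, ‖g p‖ < M ∧ p ∈ Ω :=
    (hgx.eventually (gt_mem_nhds (by simp [M]))).and (hΩ.mem_nhds hx)
  obtain ⟨r, hr, hball⟩ := Metric.eventually_nhds_iff_ball.1 hev
  have hbound : ∀ᶠ k in Filter.atTop,
      riemDist Ω g (u k) x ≤ ENNReal.ofReal (√M * ‖x - u k‖) := by
    filter_upwards [hu.eventually (Metric.ball_mem_nhds x hr)] with k hk
    have hseg : ∀ t ∈ Set.Icc (0 : ℝ) 1, u k + t • (x - u k) ∈ Metric.ball x r := fun t ht =>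
      (convex_ball x r).add_smul_sub_mem hk (Metric.mem_ball_self hr) ht
    have hd : ∀ t : ℝ, HasDerivAt (fun t : ℝ => u k + t • (x - u k)) (x - u k) t := fun t => by
      simpa using ((hasDerivAt_id t).smul_const (x - u k)).const_add (u k)
    refine (riemDist_le_curveLength (γ := fun t : ℝ => u k + t • (x - u k)) (by fun_prop)
      (fun t ht => (hball _ (hseg t ht)).2) (by simp) (by simp)).trans ?_
    rw [curveLength]
    refine (MeasureTheory.setLIntegral_mono' (g := fun _ => ENNReal.ofReal (√M * ‖x - u k‖))
      measurableSet_Icc fun t ht => ?_).trans (by simp)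
    rw [(hd t).hasDerivWithinAt.derivWithin (uniqueDiffOn_Icc zero_lt_one t ht)]
    refine ENNReal.ofReal_le_ofReal ?_
    rw [← Real.sqrt_sq (norm_nonneg (x - u k)), ← Real.sqrt_mul (by positivity)]
    refine Real.sqrt_le_sqrt ?_
    have h1 := (g (u k + t • (x - u k))).le_opNorm₂ (x - u k) (x - u k)
    have h2 := (hball _ (hseg t ht)).1
    calc _ ≤ ‖(g (u k + t • (x - u k)) (x - u k)) (x - u k)‖ := Real.le_norm_self _
      _ ≤ _ := h1
      _ ≤ M * ‖x - u k‖ ^ 2 := by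
        rw [mul_assoc, ← sq]; gcongr
  refine tendsto_of_tendsto_of_tendsto_of_le_of_le' tendsto_const_nhds ?_
    (Filter.Eventually.of_forall fun _ => zero_le) hbound
  have h1 : Filter.Tendsto (fun k => √M * ‖x - u k‖) Filter.atTop (𝓝 0) := by
    have := (hu.const_sub x).norm.const_mul √M
    simpa using this
  simpa using ENNReal.tendsto_ofReal h1

end Completeness

/-! ### Radial projection of the cone onto the hypersurface -/

section SpecialRealCompleteness

variable {n : ℕ} {h : MvPolynomial (Fin n) ℝ} {U : Set (Fin n → ℝ)} {c : ℝ}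

variable (h) in
/-- The quadratic form `-¼ ∂² log h` at `x`. -/
def logForm (x v : Fin n → ℝ) : ℝ :=
  (-6 * tri h x v v / tri h x x x + 9 * tri h x x v * tri h x x v / tri h x x x ^ 2) / 4

theorem logForm_smul (x v : Fin n → ℝ) (r : ℝ) : logForm h x (r • v) = r ^ 2 * logForm h x v := by
  simp only [logForm, tri_smul₂, tri_smul₃]; ring

theorem IsHyperbolicPoint.logForm_pos {x : Fin n → ℝ} (hx : IsHyperbolicPoint h x)
    {v : Fin n → ℝ} (hv : v ≠ 0) : 0 < logForm h x v :=
  div_pos (hx.logHess_pos hv) four_pos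

theorem IsHyperbolicPoint.logForm_nonneg {x : Fin n → ℝ} (hx : IsHyperbolicPoint h x)
    (v : Fin n → ℝ) : 0 ≤ logForm h x v := by
  by_cases hv : v = 0
  · have := logForm_smul (h := h) x v 0
    rw [zero_smul] at this
    rw [hv, this]; simp
  · exact (hx.logForm_pos hv).le

theorem logHess_star_re (x : Fin n → ℝ) (u : Fin n → ℂ) :
    (logHess h x u (star u)).re = logForm h x (reR u) + logForm h x (imR u) := by
  have e : logHess h x u (star u) = logHess h x (cx (reR u)) (cx (reR u))
      + logHess h x (cx (imR u)) (cx (imR u)) := by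
    rw [star_eq_re_sub_im]
    conv_lhs => enter [3]; rw [cx_re_add_im u]
    simp only [logHess, tri_add₂, tri_add₃, tri_sub₃, tri_smul₂, tri_smul₃]
    rw [tri_comm₂₃ h (cx x) (cx (imR u)) (cx (reR u))]
    ring_nf
    simp only [Complex.I_sq]
    ring
  rw [e, logHess_cx, logHess_cx, ← Complex.ofReal_add, Complex.ofReal_re]
  rfl

/-- For v = lx + w the left side is 9l², and the logarithmic form is at least ¾ l². The estimate
makes log h a Lipschitz function. -/
theorem IsHyperbolicPoint.sq_le_logForm {x : Fin n → ℝ} (hx : IsHyperbolicPoint h x)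
    (v : Fin n → ℝ) : (3 * tri h x x v / tri h x x x) ^ 2 ≤ 12 * logForm h x v := by
  obtain ⟨l, w, -, -, h1, h2, h3, -⟩ := hx.decomp v
  have hT := hx.pos
  rw [logForm, h1, h2]
  have e : 12 * ((-6 * (l ^ 2 * tri h x x x + tri h x w w) / tri h x x x
      + 9 * (l * tri h x x x) * (l * tri h x x x) / tri h x x x ^ 2) / 4)
      = 9 * l ^ 2 + 18 * (-tri h x w w / tri h x x x) := by
    field_simp; ring
  have e2 : (3 * (l * tri h x x x) / tri h x x x) ^ 2 = 9 * l ^ 2 := by field_simp; ring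
  rw [e, e2]
  have : 0 ≤ -tri h x w w / tri h x x x := div_nonneg (by linarith) hT.le
  linarith

theorem IsProjectiveSpecialReal.eval_pos_iff (hpsr : IsProjectiveSpecialReal h U) {x : Fin n → ℝ}
    (hx : x ∈ U) : tri h x x x = 6 * MvPolynomial.eval x h ∧ 0 < MvPolynomial.eval x h := by
  refine ⟨?_, hpsr.pos x hx⟩
  rw [eval_eq_tri hpsr.cubic]; ring

theorem eval_psrHypersurface (hpsr : IsProjectiveSpecialReal h U) {y : Fin n → ℝ}
    (hy : y ∈ psrHypersurface h U) : tri h y y y = 6 := by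
  rw [(hpsr.eval_pos_iff hy.1).1, hy.2, mul_one]

/-- On h = 1 one has tri(y, y, y) = 6, and the term with d log h vanishes on tangent vectors. The
factor 4 undoes the ¼ in `logForm`. -/
theorem psrMetric_eq_logForm (hpsr : IsProjectiveSpecialReal h U) {y : Fin n → ℝ}
    (hy : y ∈ psrHypersurface h U) {v : Fin n → ℝ} (hv : tri h y y v = 0) :
    psrMetric h y v v = 4 * logForm h y v := by
  rw [psrMetric_apply hpsr.cubic, logForm, hv, eval_psrHypersurface hpsr hy]
  ring

theorem contDiff_tri_self {m : ℕ∞ω} : ContDiff ℝ m fun x : Fin n → ℝ => tri h x x x :=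
  contDiffOn_univ.1 (contDiffOn_tri contDiffOn_id contDiffOn_id contDiffOn_id)

theorem fderiv_tri_self (x v : Fin n → ℝ) :
    fderiv ℝ (fun x : Fin n → ℝ => tri h x x x) x v = 3 * tri h x x v := by
  apply fderiv_eq_of_line (contDiff_tri_self.differentiable (n := 1) (by simp) x)
  have hl := hasDerivAt_line (𝕜 := ℝ) x v
  refine (hasDerivAt_tri (h := h) hl hl hl).congr_deriv ?_
  simp only [zero_smul, add_zero]
  rw [tri_comm₂₃ h x v x, tri_comm₁₂ h v x x, tri_comm₂₃ h x v x]
  ring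

theorem tri_deriv_eq_zero (hpsr : IsProjectiveSpecialReal h U) {y : ℝ → Fin n → ℝ}
    (hy : ContDiffOn ℝ 1 y (Set.Icc 0 1)) (hyU : Set.MapsTo y (Set.Icc 0 1) (psrHypersurface h U))
    {t : ℝ} (ht : t ∈ Set.Icc (0 : ℝ) 1) :
    tri h (y t) (y t) (derivWithin y (Set.Icc 0 1) t) = 0 := by
  have h1 := (contDiff_tri_self (h := h) (m := 1)).differentiable (by simp) (y t)
  have h2 := h1.hasFDerivAt.comp_hasDerivWithinAt t (hasDerivWithinAt_of_contDiffOn hy ht)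
  rw [fderiv_tri_self] at h2
  have h3 : HasDerivWithinAt ((fun x : Fin n → ℝ => tri h x x x) ∘ y) 0 (Set.Icc 0 1) t :=
    (hasDerivWithinAt_const t (Set.Icc (0 : ℝ) 1) (6 : ℝ)).congr
      (fun s hs => eval_psrHypersurface hpsr (hyU hs)) (eval_psrHypersurface hpsr (hyU ht))
  have := (uniqueDiffOn_Icc zero_lt_one t ht).eq_deriv _ h2 h3
  linarith

variable (h) in
/-- The radial projection onto the hypersurface `h = 1`. -/
def radialProj (x : Fin n → ℝ) : Fin n → ℝ :=
  Real.exp (-Real.log (MvPolynomial.eval x h) / 3) • x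

theorem radialProj_mem (hpsr : IsProjectiveSpecialReal h U) {x : Fin n → ℝ} (hx : x ∈ U) :
    radialProj h x ∈ psrHypersurface h U := by
  refine ⟨hpsr.smul_mem x hx _ (Real.exp_pos _), ?_⟩
  have h0 := hpsr.pos x hx
  rw [radialProj, eval_eq_tri hpsr.cubic, tri_smul₁, tri_smul₂, tri_smul₃,
    (hpsr.eval_pos_iff hx).1]
  have e : Real.exp (-Real.log (MvPolynomial.eval x h) / 3) ^ 3 = (MvPolynomial.eval x h)⁻¹ := by
    rw [← Real.exp_nat_mul, show ((3 : ℕ) : ℝ) * (-Real.log (MvPolynomial.eval x h) / 3)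
      = -Real.log (MvPolynomial.eval x h) by push_cast; ring, Real.exp_neg, Real.exp_log h0]
  have e2 : ∀ r a : ℝ, r * (r * (r * (6 * a))) / 6 = r ^ 3 * a := fun r a => by ring
  rw [e2, e, inv_mul_cancel₀ h0.ne']

theorem contDiffOn_radialProj (hpsr : IsProjectiveSpecialReal h U) {m : ℕ∞ω} :
    ContDiffOn ℝ m (radialProj h) U := by
  have h1 : ContDiffOn ℝ m (fun x : Fin n → ℝ => MvPolynomial.eval x h) U := by
    simp only [eval_eq_tri hpsr.cubic]
    exact (contDiff_tri_self.div_const 6).contDiffOn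
  exact ((h1.log fun x hx => (hpsr.pos x hx).ne').neg.div_const 3).exp.smul contDiffOn_id

/-- The radial projection does not increase lengths, with respect to `-∂² log h`. -/
theorem psrMetric_radialProj_le (hpsr : IsProjectiveSpecialReal h U) {x : ℝ → Fin n → ℝ}
    (hx : ContDiffOn ℝ 1 x (Set.Icc 0 1)) (hxU : Set.MapsTo x (Set.Icc 0 1) U) :
    ContDiffOn ℝ 1 (fun t => radialProj h (x t)) (Set.Icc 0 1) ∧
    Set.MapsTo (fun t => radialProj h (x t)) (Set.Icc 0 1) (psrHypersurface h U) ∧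
    ∀ t ∈ Set.Icc (0 : ℝ) 1, psrMetric h (radialProj h (x t))
      (derivWithin (fun t => radialProj h (x t)) (Set.Icc 0 1) t)
      (derivWithin (fun t => radialProj h (x t)) (Set.Icc 0 1) t)
      ≤ 4 * logForm h (x t) (derivWithin x (Set.Icc 0 1) t) := by
  have hm : Set.MapsTo (fun t => radialProj h (x t)) (Set.Icc 0 1) (psrHypersurface h U) :=
    fun t ht => radialProj_mem hpsr (hxU ht)
  have hc : ContDiffOn ℝ 1 (fun t => radialProj h (x t)) (Set.Icc 0 1) :=
    (contDiffOn_radialProj hpsr).comp hx hxU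
  refine ⟨hc, hm, fun t ht => ?_⟩
  have htan := tri_deriv_eq_zero hpsr hc hm ht
  have hX := hpsr.isHyperbolicPoint (hxU ht)
  have hs : ContDiffOn ℝ 1 (fun t => Real.exp (-Real.log (MvPolynomial.eval (x t) h) / 3))
      (Set.Icc 0 1) := by
    have h1 : ContDiffOn ℝ 1 (fun t => MvPolynomial.eval (x t) h) (Set.Icc 0 1) := by
      simp only [eval_eq_tri hpsr.cubic]
      exact (contDiff_tri_self.comp_contDiffOn hx).div_const 6
    exact ((h1.log fun t ht => (hpsr.pos _ (hxU ht)).ne').neg.div_const 3).exp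
  have hd := (hasDerivWithinAt_of_contDiffOn hs ht).fun_smul (hasDerivWithinAt_of_contDiffOn hx ht)
  have hd' := hd.derivWithin (uniqueDiffOn_Icc zero_lt_one t ht)
  set r := Real.exp (-Real.log (MvPolynomial.eval (x t) h) / 3) with hr
  have hr0 : 0 < r := Real.exp_pos _
  have hrp : radialProj h (x t) = r • x t := rfl
  change derivWithin (fun t => radialProj h (x t)) (Set.Icc 0 1) t = _ at hd'
  rw [psrMetric_eq_logForm hpsr (hm ht) htan]
  rw [hd'] at htan ⊢
  beta_reduce at htan ⊢
  rw [hrp] at htan ⊢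
  obtain ⟨l, w, hv, hw, h1, h2, h3, -⟩ := hX.decomp (derivWithin x (Set.Icc 0 1) t)
  generalize derivWithin x (Set.Icc 0 1) t = v at *
  generalize derivWithin (fun t => Real.exp (-Real.log (MvPolynomial.eval (x t) h) / 3))
    (Set.Icc 0 1) t = s at *
  have hT := hX.pos
  rw [tri_smul₁, tri_smul₂, tri_add₃, tri_smul₃, tri_smul₃, h1] at htan
  -- The velocity of the projected curve is tangent to h = 1, so its component along x vanishes and
  -- only rw remains.
  have hs : r * l + s = 0 := by
    have : r * (r * ((r * l + s) * tri h (x t) (x t) (x t))) = 0 := by linarith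
    simpa [hr0.ne', hT.ne'] using this
  have hy : r • v + s • x t = r • w := by
    rw [hv, smul_add, smul_smul, add_right_comm, ← add_smul, hs, zero_smul, zero_add]
  rw [hy, logForm_smul]
  -- The form has degree -2 in the base point, which cancels the factor r² of the vector. It remains
  -- to drop 3l² ≥ 0.
  have e1 : logForm h (r • x t) w = (r ^ 2)⁻¹ * logForm h (x t) w := by
    simp only [logForm, tri_smul₁, tri_smul₂, tri_smul₃]
    field_simp
  rw [e1, ← mul_assoc (r ^ 2), mul_inv_cancel₀ (by positivity), one_mul]
  simp only [logForm, hw, h1, h2]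
  have : 4 * ((-6 * (l ^ 2 * tri h (x t) (x t) (x t) + tri h (x t) w w) / tri h (x t) (x t) (x t)
      + 9 * (l * tri h (x t) (x t) (x t)) * (l * tri h (x t) (x t) (x t))
        / tri h (x t) (x t) (x t) ^ 2) / 4)
      = 3 * l ^ 2 + -6 * tri h (x t) w w / tri h (x t) (x t) (x t) := by
    field_simp; ring
  rw [this]
  have := sq_nonneg l
  simp only [mul_zero, zero_div, add_zero]
  linarith

end SpecialRealCompleteness

/-! ### Completeness of the one-loop metric -/

section OneLoopCompleteness

variable {n : ℕ} {h : MvPolynomial (Fin n) ℝ} {U : Set (Fin n → ℝ)} {c : ℝ}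

/-- As c ≥ 0, the coefficients (ρ + c)/ρ and (ρ + 2c)/(ρ + c) are at least 1. The other three terms
are nonnegative and are dropped. -/
theorem le_oneLoopMetric (hh : h.IsHomogeneous 3) (hc : 0 ≤ c) {p : CMapSpace n}
    (hX : IsHyperbolicPoint h (imR p.1)) (hρ : 0 < p.2.1) (v : CMapSpace n) :
    logForm h (imR p.1) (reR v.1) + logForm h (imR p.1) (imR v.1) + (v.2.1 / p.2.1) ^ 2 / 4
      ≤ oneLoopMetric (rMapMetric h) (rMapPrepotential h) c p v v := by
  rw [oneLoopMetric_apply hh hc hX hρ, logHess_star_re, logHess_star_re]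
  have hf := affinePotential_pos hh hX
  have h1 := add_nonneg (hX.logForm_nonneg (reR v.1)) (hX.logForm_nonneg (imR v.1))
  have h2 := add_nonneg (hX.logForm_nonneg (reR (kapV h p.1 v)))
    (hX.logForm_nonneg (imR (kapV h p.1 v)))
  have a1 : 1 ≤ (p.2.1 + c) / p.2.1 := (one_le_div hρ).2 (by linarith)
  have a2 : 1 ≤ (p.2.1 + 2 * c) / (p.2.1 + c) := (one_le_div (by linarith)).2 (by linarith)
  have b1 := mul_le_mul_of_nonneg_right a1 h1
  have b2 := mul_le_mul_of_nonneg_right a2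
    (mul_nonneg (by positivity) (mul_self_nonneg v.2.1) :
      0 ≤ 1 / (4 * p.2.1 ^ 2) * (v.2.1 * v.2.1))
  have e : (v.2.1 / p.2.1) ^ 2 / 4 = 1 / (4 * p.2.1 ^ 2) * (v.2.1 * v.2.1) := by
    field_simp
  have c1 : 0 ≤ 1 / (4 * p.2.1 ^ 2) * ((p.2.1 + c) / (p.2.1 + 2 * c))
      * (connForm h c p v * connForm h c p v) :=
    mul_nonneg (by positivity) (mul_self_nonneg _)
  have c2 := mul_nonneg (div_nonneg hf.le hρ.le) h2
  have c3 : 0 ≤ (p.2.1 + 2 * c)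
      / (p.2.1 ^ 2 * affinePotential (rMapPrepotential h) (homCoord p.1))
      * (periodForm (rMapPrepotential h) p.1 v *
        (starRingEnd ℂ) (periodForm (rMapPrepotential h) p.1 v)).re := by
    rw [Complex.mul_conj, Complex.ofReal_re]
    exact mul_nonneg (by positivity) (Complex.normSq_nonneg _)
  rw [e]
  linarith

theorem continuousOn_logForm : ContinuousOn (fun z : (Fin n → ℝ) × (Fin n → ℝ) =>
    logForm h z.1 z.2) ({x | tri h x x x ≠ 0} ×ˢ Set.univ) := by
  have h1 : ContDiff ℝ 0 fun z : (Fin n → ℝ) × (Fin n → ℝ) => tri h z.1 z.1 z.1 :=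
    contDiff_tri_self.comp contDiff_fst
  have h2 : ContDiff ℝ 0 fun z : (Fin n → ℝ) × (Fin n → ℝ) => tri h z.1 z.1 z.2 :=
    contDiffOn_univ.1 (contDiffOn_tri contDiffOn_fst contDiffOn_fst contDiffOn_snd)
  have h3 : ContDiff ℝ 0 fun z : (Fin n → ℝ) × (Fin n → ℝ) => tri h z.1 z.2 z.2 :=
    contDiffOn_univ.1 (contDiffOn_tri contDiffOn_fst contDiffOn_snd contDiffOn_snd)
  unfold logForm
  refine ContinuousOn.div_const (ContinuousOn.add ?_ ?_) 4
  · exact (continuousOn_const.mul h3.continuous.continuousOn).div h1.continuous.continuousOn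
      fun z hz => hz.1
  · exact (((continuousOn_const.mul h2.continuous.continuousOn).mul
      h2.continuous.continuousOn)).div (h1.continuous.continuousOn.pow 2)
      fun z hz => pow_ne_zero _ hz.1

theorem exists_norm_le_sqrt_logForm (hpsr : IsProjectiveSpecialReal h U) {K : Set (Fin n → ℝ)}
    (hK : IsCompact K) (hKU : K ⊆ U) :
    ∃ C : ℝ, 0 ≤ C ∧ ∀ x ∈ K, ∀ v, ‖v‖ ≤ C * √(logForm h x v) :=
  exists_uniform_pos hK (continuousOn_logForm.mono (Set.prod_mono_left fun _ hx =>
    (hpsr.isHyperbolicPoint (hKU hx)).pos.ne')) (fun _ _ r v => logForm_smul _ v r)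
    fun _ hx _ hv => (hpsr.isHyperbolicPoint (hKU hx)).logForm_pos hv

/-- Pointwise g_ℋ ≤ 4 · (-¼ ∂² log h) ≤ 4 g along the projected curve, hence the factor 2 for
lengths. -/
theorem curveLength_radialProj_le (hpsr : IsProjectiveSpecialReal h U) (hc : 0 ≤ c)
    {γ : ℝ → CMapSpace n} (hγ : ContDiffOn ℝ 1 γ (Set.Icc 0 1))
    (hγΩ : Set.MapsTo γ (Set.Icc 0 1) (cMapDomain (rMapDomain U))) :
    ContDiffOn ℝ 1 (fun t => radialProj h (imR (γ t).1)) (Set.Icc 0 1) ∧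
    Set.MapsTo (fun t => radialProj h (imR (γ t).1)) (Set.Icc 0 1) (psrHypersurface h U) ∧
    curveLength (psrMetric h) (fun t => radialProj h (imR (γ t).1))
      ≤ 2 * curveLength (oneLoopMetric (rMapMetric h) (rMapPrepotential h) c) γ := by
  obtain ⟨h1, h2, h3⟩ := psrMetric_radialProj_le hpsr (x := fun t => imR (γ t).1)
    (contDiff_imR.comp_contDiffOn (contDiff_fst.comp_contDiffOn hγ)) fun t ht => (hγΩ ht).1
  refine ⟨h1, h2, ?_⟩
  rw [curveLength, curveLength, ← MeasureTheory.lintegral_const_mul' _ _ (by simp)]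
  refine MeasureTheory.setLIntegral_mono' measurableSet_Icc fun t ht => ?_
  have hd : derivWithin (fun t => imR (γ t).1) (Set.Icc 0 1) t
      = imR (derivWithin γ (Set.Icc 0 1) t).1 := by
    have hγ' := hasDerivWithinAt_of_contDiffOn hγ ht
    refine HasDerivWithinAt.derivWithin ?_ (uniqueDiffOn_Icc zero_lt_one t ht)
    refine hasDerivWithinAt_pi.2 fun μ => ?_
    have := hasDerivWithinAt_pi.1 hγ'.fst μ
    exact Complex.imCLM.hasFDerivAt.comp_hasDerivWithinAt t this
  have hX : IsHyperbolicPoint h (imR (γ t).1) := hpsr.isHyperbolicPoint (hγΩ ht).1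
  have h4 := le_oneLoopMetric hpsr.cubic hc hX (hγΩ ht).2 (derivWithin γ (Set.Icc 0 1) t)
  have h5 := hX.logForm_nonneg (reR (derivWithin γ (Set.Icc 0 1) t).1)
  have h6 := h3 t ht
  rw [hd] at h6
  have e : (2 : ℝ≥0∞) = ENNReal.ofReal √4 := by
    rw [show (4 : ℝ) = 2 ^ 2 by norm_num, Real.sqrt_sq zero_le_two]; simp
  rw [e, ← ENNReal.ofReal_mul (by positivity), ← Real.sqrt_mul (by norm_num)]
  refine ENNReal.ofReal_le_ofReal (Real.sqrt_le_sqrt (h6.trans ?_))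
  have : 0 ≤ ((derivWithin γ (Set.Icc 0 1) t).2.1 / (γ t).2.1) ^ 2 / 4 := by positivity
  linarith

/-- A bump function supported in a ball inside U is Lipschitz for g_ℋ: its differential vanishes
outside a compact ball, on which the metric is uniformly definite. It replaces a comparison of the
Riemannian and the Euclidean topology on ℋ. -/
theorem exists_bump_bound (hpsr : IsProjectiveSpecialReal h U) {x : Fin n → ℝ} (hx : x ∈ U) :
    ∃ (χ : ContDiffBump x) (C : ℝ), Metric.closedBall x χ.rOut ⊆ U ∧ 0 ≤ C ∧
      ∀ y ∈ psrHypersurface h U, ∀ v, tri h y y v = 0 →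
        ‖fderiv ℝ χ y v‖ ≤ C * √(psrMetric h y v v) := by
  obtain ⟨r, hr, hrU⟩ := Metric.nhds_basis_closedBall.mem_iff.1 (hpsr.isOpen.mem_nhds hx)
  let χ : ContDiffBump x := ⟨r / 2, r, by positivity, by linarith⟩
  have hcK : IsCompact (Metric.closedBall x r) := isCompact_closedBall x r
  obtain ⟨C, hC, hb⟩ := exists_norm_le_sqrt_logForm hpsr hcK hrU
  have hcont : Continuous (fderiv ℝ χ) := (χ.contDiff (n := 1)).continuous_fderiv (by simp)
  obtain ⟨D, hD⟩ := hcK.exists_bound_of_continuousOn hcont.continuousOn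
  have hD0 : 0 ≤ D := (norm_nonneg _).trans (hD x (Metric.mem_closedBall_self hr.le))
  refine ⟨χ, D * C, hrU, by positivity, fun y hy v hv => ?_⟩
  by_cases hyr : y ∈ Metric.closedBall x r
  · refine (ContinuousLinearMap.le_opNorm _ _).trans ?_
    rw [mul_assoc]
    refine mul_le_mul (hD y hyr) ((hb y hyr v).trans ?_) (norm_nonneg _) hD0
    refine mul_le_mul_of_nonneg_left (Real.sqrt_le_sqrt ?_) hC
    rw [psrMetric_eq_logForm hpsr hy hv]
    have := (hpsr.isHyperbolicPoint hy.1).logForm_nonneg v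
    linarith
  · have : fderiv ℝ χ y = 0 := by
      refine fderiv_of_notMem_tsupport ℝ fun hmem => hyr ?_
      rw [χ.tsupport_eq] at hmem
      exact hmem
    rw [this, zero_apply, norm_zero]
    positivity

variable {u : ℕ → CMapSpace n}

local notation "Ω" => cMapDomain (rMapDomain U)
local notation "gFS" => oneLoopMetric (rMapMetric h) (rMapPrepotential h) c

/-- The projected sequence converges to some x by completeness of ℋ. The bump function is 1 at x and
changes by at most ¼ along each of two short curves, from x to a late projected point and from there
along the given curve. It stays positive, which keeps the curve in a ball inside U. -/
theorem exists_isTrap_radialProj (hpsr : IsProjectiveSpecialReal h U)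
    (hcomplete : IsCompleteRiemannian (psrHypersurface h U) (psrMetric h)) (hc : 0 ≤ c)
    (huΩ : ∀ k, u k ∈ Ω) (hu : IsRiemCauchy Ω gFS u) :
    ∃ K, IsCompact K ∧ K ⊆ psrHypersurface h U ∧
      IsTrap Ω gFS u {p | radialProj h (imR p.1) ∈ K} := by
  obtain ⟨x, hxH, hx⟩ := hcomplete (fun k => radialProj h (imR (u k).1))
    (fun k => radialProj_mem hpsr (huΩ k).1) (by
      intro ε hε
      obtain ⟨k₀, hk₀⟩ := hu (ε / 2) (ENNReal.half_pos hε.ne')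
      refine ⟨k₀, fun k hk l hl => ?_⟩
      obtain ⟨γ, h1, h2, h3, h4, h5⟩ := exists_curve_of_riemDist_lt (hk₀ k hk l hl)
      obtain ⟨a1, a2, a3⟩ := curveLength_radialProj_le hpsr hc h1 h2
      refine (riemDist_le_curveLength a1 a2 (by rw [h3]) (by rw [h4])).trans_lt (a3.trans_lt ?_)
      rw [mul_comm]
      exact ENNReal.mul_lt_of_lt_div h5)
  obtain ⟨χ, C, hχU, hC, hb⟩ := exists_bump_bound hpsr hxH.1
  have key : ∀ y : ℝ → Fin n → ℝ, ContDiffOn ℝ 1 y (Set.Icc 0 1) →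
      Set.MapsTo y (Set.Icc 0 1) (psrHypersurface h U) →
      curveLength (psrMetric h) y ≤ ENNReal.ofReal (1 / (4 * (C + 1))) →
      ∀ t ∈ Set.Icc (0 : ℝ) 1, |χ (y t) - χ (y 0)| ≤ 1 / 4 := by
    intro y h1 h2 h3 t ht
    have h4 := enorm_comp_sub_le (g := psrMetric h) (f := χ) h1 (fun t _ => χ.contDiffAt) hC
      (fun t ht => hb _ (h2 ht) _ (tri_deriv_eq_zero hpsr h1 h2 ht)) ht
    have h5 := h4.trans (mul_le_mul_right h3 _)
    rw [← ENNReal.ofReal_mul hC, ← ofReal_norm, ENNReal.ofReal_le_ofReal_iff (by positivity)] at h5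
    refine h5.trans ?_
    rw [mul_one_div, div_le_iff₀ (by positivity)]
    linarith
  have hδ : 0 < ENNReal.ofReal (1 / (4 * (C + 1))) := ENNReal.ofReal_pos.2 (by positivity)
  -- The ball lies in U, so cutting it with the closed level set h = 1 gives a compact part of ℋ.
  refine ⟨Metric.closedBall x χ.rOut ∩ {y | MvPolynomial.eval y h = 1},
    (isCompact_closedBall _ _).inter_right (isClosed_eq (MvPolynomial.continuous_eval h)
      continuous_const), fun y hy => ⟨hχU hy.1, hy.2⟩, ?_⟩
  obtain ⟨k₀, hk₀⟩ := Filter.eventually_atTop.1 (hx.eventually (gt_mem_nhds hδ))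
  refine ⟨ENNReal.ofReal (1 / (4 * (C + 1))) / 2, ENNReal.half_pos hδ.ne', k₀,
    fun k hk γ h1 h2 h3 h4 t ht => ?_⟩
  obtain ⟨a1, a2, a3⟩ := curveLength_radialProj_le hpsr hc h1 h2
  have h5 := key _ a1 a2 (a3.trans (by
    rw [mul_comm]; exact (ENNReal.mul_lt_of_lt_div h4).le)) t ht
  obtain ⟨σ, s1, s2, s3, s4, s5⟩ := exists_curve_of_riemDist_lt (hk₀ k hk)
  have h6 := key σ s1 s2 s5.le 1 ⟨zero_le_one, le_rfl⟩
  have hone : χ x = 1 := χ.one_of_mem_closedBall (Metric.mem_closedBall_self χ.rIn_pos.le)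
  rw [s3, s4, hone] at h6
  simp only [h3] at h5
  refine ⟨?_, (a2 ht).2⟩
  have hpos : χ (radialProj h (imR (γ t).1)) ≠ 0 := by
    have := (abs_le.1 h5).1
    have := (abs_le.1 h6).2
    intro h0
    linarith
  have : radialProj h (imR (γ t).1) ∈ Function.support χ := hpos
  rw [χ.support_eq] at this
  exact Metric.ball_subset_closedBall this

/-- Im X is its radial projection times h^{1/3}, and 𝒦 = -log 8h is Lipschitz by `sq_le_logForm`, so
the scale is confined as well. -/
theorem exists_isTrap_imR (hpsr : IsProjectiveSpecialReal h U)
    (hcomplete : IsCompleteRiemannian (psrHypersurface h U) (psrMetric h)) (hc : 0 ≤ c)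
    (huΩ : ∀ k, u k ∈ Ω) (hu : IsRiemCauchy Ω gFS u) :
    ∃ K, IsCompact K ∧ K ⊆ U ∧ IsTrap Ω gFS u {p | imR p.1 ∈ K} := by
  obtain ⟨K, hK, hKH, htrap⟩ := exists_isTrap_radialProj hpsr hcomplete hc huΩ hu
  have hh := hpsr.cubic
  have hΩ : IsOpen Ω := isOpen_cMapDomain (isOpen_rMapDomain hpsr.isOpen)
  obtain ⟨a, -, ha⟩ := htrap.exists_limit hu (f := fun p => rMapPotential h p.1) (C := 4)
    (fun p hp => ((contDiffOn_rMapPotential hh).contDiffAt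
      (isOpen_positiveRegion.mem_nhds (mem_positiveRegion hpsr hp).1)).of_le (by simp))
    (by norm_num) (fun p hp _ v => by
      have hX := hpsr.isHyperbolicPoint hp.1
      change IsHyperbolicPoint h (imR p.1) at hX
      have hd : fderiv ℝ (fun p : CMapSpace n => rMapPotential h p.1) p v
          = fderiv ℝ (rMapPotential h) p.1 v.1 := by
        have := ((differentiableAt_rMapPotential hh hX.pos).hasFDerivAt.comp p
          (hasFDerivAt_fst (𝕜 := ℝ) (p := p))).fderiv
        exact congrArg (fun A : CMapSpace n →L[ℝ] ℝ => A v) this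
      have h1 := hX.sq_le_logForm (imR v.1)
      have h2 := le_oneLoopMetric hh hc hX hp.2 v
      have h3 := hX.logForm_nonneg (reR v.1)
      have h4 : 0 ≤ (v.2.1 / p.2.1) ^ 2 / 4 := by positivity
      rw [hd, fderiv_rMapPotential hh hX.pos, norm_neg, Real.norm_eq_abs]
      -- The constant √12 from `sq_le_logForm` is rounded up to 4.
      have e : (4 : ℝ) = √16 := by
        rw [show (16 : ℝ) = 4 ^ 2 by norm_num, Real.sqrt_sq (by norm_num)]
      rw [e, ← Real.sqrt_mul (by norm_num)]
      have h5 := hX.logForm_nonneg (imR v.1)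
      exact Real.abs_le_sqrt (by linarith))
  -- On the smaller trap 𝒦 = -log 8 - log h lies within 1 of its limit a. Solving for log h and
  -- dividing by 3 bounds h^{1/3}.
  set b₀ := Real.exp ((-a - 1 - Real.log 8) / 3)
  set b₁ := Real.exp ((-a + 1 - Real.log 8) / 3)
  refine ⟨(fun z : ℝ × (Fin n → ℝ) => z.1 • z.2) '' (Set.Icc b₀ b₁ ×ˢ K),
    (isCompact_Icc.prod hK).image (by fun_prop), ?_, (ha 1 one_pos).mono ?_⟩
  · rintro _ ⟨⟨r, y⟩, ⟨hr, hy⟩, rfl⟩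
    exact hpsr.smul_mem _ (hKH hy).1 _ ((Real.exp_pos _).trans_le hr.1)
  · rintro p ⟨hpK, hpa⟩ hp
    have h0 := hpsr.pos _ hp.1
    change 0 < MvPolynomial.eval (imR p.1) h at h0
    have hl : rMapPotential h p.1 = -(Real.log 8 + Real.log (MvPolynomial.eval (imR p.1) h)) := by
      rw [← Real.log_mul (by norm_num) h0.ne']; rfl
    have hpa' : |rMapPotential h p.1 - a| < 1 := hpa
    rw [hl, abs_lt] at hpa'
    refine ⟨(Real.exp (Real.log (MvPolynomial.eval (imR p.1) h) / 3), radialProj h (imR p.1)),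
      ⟨⟨Real.exp_le_exp.2 ?_, Real.exp_le_exp.2 ?_⟩, hpK⟩, ?_⟩
    · linarith [hpa'.2]
    · linarith [hpa'.1]
    · simp only [radialProj]
      rw [smul_smul, ← Real.exp_add, neg_div, add_neg_cancel, Real.exp_zero, one_smul]

/-- The term dρ²/(4ρ²) makes log ρ Lipschitz with constant 2. Once Im X lies in a compact subset of
U, the metric bounds |dX| uniformly, so X converges and its real part is confined too. -/
theorem exists_isTrap_base (hpsr : IsProjectiveSpecialReal h U)
    (hcomplete : IsCompleteRiemannian (psrHypersurface h U) (psrMetric h)) (hc : 0 ≤ c)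
    (huΩ : ∀ k, u k ∈ Ω) (hu : IsRiemCauchy Ω gFS u) :
    ∃ K : Set ((Fin n → ℂ) × ℝ), IsCompact K ∧ (∀ z ∈ K, z.1 ∈ rMapDomain U ∧ 0 < z.2) ∧
      IsTrap Ω gFS u {p | (p.1, p.2.1) ∈ K} := by
  obtain ⟨K, hK, hKU, htrap⟩ := exists_isTrap_imR hpsr hcomplete hc huΩ hu
  have hh := hpsr.cubic
  obtain ⟨a, -, ha⟩ := htrap.exists_limit hu (f := fun p => Real.log p.2.1) (C := 2)
    (fun p hp => (contDiff_fst.comp contDiff_snd).contDiffAt.log hp.2.ne')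
    (by norm_num) (fun p hp _ v => by
      have hX := hpsr.isHyperbolicPoint hp.1
      change IsHyperbolicPoint h (imR p.1) at hX
      have hd : fderiv ℝ (fun p : CMapSpace n => Real.log p.2.1) p v = v.2.1 / p.2.1 := by
        have := (((dRho (n := n)).hasFDerivAt (x := p)).log hp.2.ne').fderiv
        refine (congrArg (fun A : CMapSpace n →L[ℝ] ℝ => A v) this).trans ?_
        simp [dRho, div_eq_inv_mul]
      have h2 := le_oneLoopMetric hh hc hX hp.2 v
      have h3 := hX.logForm_nonneg (reR v.1)
      have h5 := hX.logForm_nonneg (imR v.1)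
      rw [hd, Real.norm_eq_abs]
      have e : (2 : ℝ) = √4 := by
        rw [show (4 : ℝ) = 2 ^ 2 by norm_num, Real.sqrt_sq (by norm_num)]
      rw [e, ← Real.sqrt_mul (by norm_num)]
      exact Real.abs_le_sqrt (by linarith))
  obtain ⟨C, hC, hb⟩ := exists_norm_le_sqrt_logForm hpsr hK hKU
  obtain ⟨b, -, hb⟩ := (ha 1 one_pos).exists_limit hu (f := fun p => p.1) (C := 2 * C)
    (fun p hp => contDiff_fst.contDiffAt) (by positivity) (fun p hp hpK v => by
      have hX := hpsr.isHyperbolicPoint hp.1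
      change IsHyperbolicPoint h (imR p.1) at hX
      have h2 := le_oneLoopMetric hh hc hX hp.2 v
      have h3 := hX.logForm_nonneg (reR v.1)
      have h5 := hX.logForm_nonneg (imR v.1)
      have h4 : 0 ≤ (v.2.1 / p.2.1) ^ 2 / 4 := by positivity
      have h6 := hb _ hpK.1 (reR v.1)
      have h7 := hb _ hpK.1 (imR v.1)
      have h8 : √(logForm h (imR p.1) (reR v.1)) ≤ √(gFS p v v) :=
        Real.sqrt_le_sqrt (by linarith)
      have h9 : √(logForm h (imR p.1) (imR v.1)) ≤ √(gFS p v v) :=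
        Real.sqrt_le_sqrt (by linarith)
      have hd : fderiv ℝ (fun p : CMapSpace n => p.1) p v = v.1 := by
        rw [fderiv_fst]; rfl
      rw [hd]
      refine (pi_norm_le_iff_of_nonneg (by positivity)).2 fun μ => ?_
      refine (Complex.norm_le_abs_re_add_abs_im _).trans ?_
      have e1 : |(v.1 μ).re| ≤ ‖reR v.1‖ := norm_le_pi_norm (reR v.1) μ
      have e2 : |(v.1 μ).im| ≤ ‖imR v.1‖ := norm_le_pi_norm (imR v.1) μ
      have e3 := mul_le_mul_of_nonneg_left h8 hC
      have e4 := mul_le_mul_of_nonneg_left h9 hC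
      linarith)
  refine ⟨(Metric.closedBall b 1 ∩ imR ⁻¹' K) ×ˢ Set.Icc (Real.exp (a - 1)) (Real.exp (a + 1)),
    ((isCompact_closedBall _ _).inter_right
      (hK.isClosed.preimage (contDiff_imR (m := 0)).continuous)).prod isCompact_Icc,
    fun z hz => ⟨hKU hz.1.2, (Real.exp_pos _).trans_le hz.2.1⟩, (hb 1 one_pos).mono ?_⟩
  rintro p ⟨⟨hpK, hpa⟩, hpb⟩ hp
  have hpa' : |Real.log p.2.1 - a| < 1 := hpa
  rw [abs_lt] at hpa'
  refine ⟨⟨Metric.mem_closedBall.2 (le_of_lt hpb), hpK⟩, ?_, ?_⟩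
  · rw [← Real.le_log_iff_exp_le hp.2]; linarith
  · rw [← Real.log_le_iff_le_exp hp.2]; linarith

/-- The differential at `p` of the Heisenberg translation that takes `p` to `(X, ρ, 0, 0, 0)`. -/
def heisenbergDiff (p v : CMapSpace n) : CMapSpace n := (v.1, v.2.1, contactForm p v, v.2.2.2)

/-- Apart from X and ρ, the point enters the metric only through the contact form, which Heisenberg
translations preserve. Estimates over the base are thus needed only at φ̃ = 0, ζ̃ = ζ = 0. -/
theorem oneLoopMetric_heisenbergDiff (hh : h.IsHomogeneous 3) (hc : 0 ≤ c) {p : CMapSpace n}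
    (hX : IsHyperbolicPoint h (imR p.1)) (hρ : 0 < p.2.1) (v : CMapSpace n) :
    gFS (p.1, p.2.1, 0) (heisenbergDiff p v) (heisenbergDiff p v) = gFS p v v := by
  rw [oneLoopMetric_apply hh hc hX hρ,
    oneLoopMetric_apply (p := (p.1, p.2.1, 0)) hh hc hX hρ]
  have e1 : connForm h c (p.1, p.2.1, 0) (heisenbergDiff p v) = connForm h c p v := by
    change contactForm (p.1, p.2.1, 0) (heisenbergDiff p v) + _ = contactForm p v + _
    rw [contactForm_apply (p.1, p.2.1, 0)]
    simp [heisenbergDiff, dX]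
  have e2 : periodForm (rMapPrepotential h) p.1 (heisenbergDiff p v)
      = periodForm (rMapPrepotential h) p.1 v := by
    simp [periodForm, heisenbergDiff, dZeta, dZetaT]
  rw [e1]
  simp only [e2]
  rfl

/-- The translation changes only the φ̃-component, by a term bilinear in (ζ̃, ζ) and (dζ̃, dζ). The
factor 2(n + 1) bounds two scalar products in the maximum norm. -/
theorem norm_le_heisenbergDiff (p v : CMapSpace n) :
    ‖v‖ ≤ (1 + 2 * (n + 1) * ‖p.2.2.2‖) * ‖heisenbergDiff p v‖ := by
  set w := heisenbergDiff p v with hw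
  have hdot : ∀ a b : Fin (n + 1) → ℝ, |a ⬝ᵥ b| ≤ (n + 1) * (‖a‖ * ‖b‖) := by
    intro a b
    refine (Finset.abs_sum_le_sum_abs _ _).trans ?_
    refine (Finset.sum_le_card_nsmul _ _ (‖a‖ * ‖b‖) fun i _ => ?_).trans (by simp)
    rw [abs_mul]
    exact mul_le_mul (norm_le_pi_norm a i) (norm_le_pi_norm b i) (abs_nonneg _) (norm_nonneg _)
  have w1 : ‖v.1‖ ≤ ‖w‖ := norm_fst_le w
  have w2 : ‖v.2.1‖ ≤ ‖w‖ := (norm_fst_le w.2).trans (norm_snd_le w)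
  have w3 : |contactForm p v| ≤ ‖w‖ :=
    (norm_fst_le w.2.2).trans ((norm_snd_le w.2).trans (norm_snd_le w))
  have w4 : ‖v.2.2.2‖ ≤ ‖w‖ :=
    (norm_snd_le w.2.2).trans ((norm_snd_le w.2).trans (norm_snd_le w))
  have hle : ‖w‖ ≤ (1 + 2 * (n + 1) * ‖p.2.2.2‖) * ‖w‖ :=
    le_mul_of_one_le_left (norm_nonneg _) (le_add_of_nonneg_right (by positivity))
  refine norm_prod_le_iff.2 ⟨w1.trans hle, norm_prod_le_iff.2 ⟨w2.trans hle,
    norm_prod_le_iff.2 ⟨?_, w4.trans hle⟩⟩⟩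
  have e : v.2.2.1 = contactForm p v
      - (p.2.2.2.2 ⬝ᵥ v.2.2.2.1 - p.2.2.2.1 ⬝ᵥ v.2.2.2.2) := by
    rw [contactForm_apply]; ring
  have d1 := (hdot p.2.2.2.2 v.2.2.2.1).trans (mul_le_mul_of_nonneg_left
    (mul_le_mul (norm_snd_le p.2.2.2) ((norm_fst_le v.2.2.2).trans w4) (norm_nonneg _)
      (norm_nonneg _)) (by positivity))
  have d2 := (hdot p.2.2.2.1 v.2.2.2.2).trans (mul_le_mul_of_nonneg_left
    (mul_le_mul (norm_fst_le p.2.2.2) ((norm_snd_le v.2.2.2).trans w4) (norm_nonneg _)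
      (norm_nonneg _)) (by positivity))
  rw [Real.norm_eq_abs, e]
  have t1 := abs_sub (contactForm p v) (p.2.2.2.2 ⬝ᵥ v.2.2.2.1 - p.2.2.2.1 ⬝ᵥ v.2.2.2.2)
  have t2 := abs_sub (p.2.2.2.2 ⬝ᵥ v.2.2.2.1) (p.2.2.2.1 ⬝ᵥ v.2.2.2.2)
  linarith

theorem isCompleteRiemannian_oneLoopMetric (hpsr : IsProjectiveSpecialReal h U)
    (hcomplete : IsCompleteRiemannian (psrHypersurface h U) (psrMetric h)) (hc : 0 ≤ c) :
    IsCompleteRiemannian Ω gFS := by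
  intro u huΩ hu
  have hu' : IsRiemCauchy Ω gFS u := hu
  have hh := hpsr.cubic
  have hΩ : IsOpen Ω := isOpen_cMapDomain (isOpen_rMapDomain hpsr.isOpen)
  have hg := isRiemannianMetricOn_oneLoopMetric hpsr hc
  obtain ⟨K, hK, hKΩ, htrap⟩ := exists_isTrap_base hpsr hcomplete hc huΩ hu'
  obtain ⟨C, hC, hb⟩ := exists_uniform_pos (F := CMapSpace n) hK
    (q := fun z v => gFS (z.1, z.2, 0) v v)
    (by
      have h1 : ContinuousOn (fun z : ((Fin n → ℂ) × ℝ) × CMapSpace n => gFS (z.1.1, z.1.2, 0))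
          (K ×ˢ Set.univ) :=
        hg.contDiffOn.continuousOn.comp (by fun_prop) fun z hz => hKΩ _ hz.1
      exact (h1.clm_apply continuousOn_snd).clm_apply continuousOn_snd)
    (fun z _ r v => by simp only [map_smul, smul_apply, smul_eq_mul]; ring)
    (fun z hz v hv => hg.pos _ (hKΩ z hz) v hv)
  have hb' : ∀ p ∈ Ω, (p.1, p.2.1) ∈ K → ∀ v, ‖heisenbergDiff p v‖ ≤ C * √(gFS p v v) := by
    intro p hp hpK v
    rw [← oneLoopMetric_heisenbergDiff hh hc (hpsr.isHyperbolicPoint hp.1) hp.2]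
    exact hb _ hpK _
  -- The components dζ̃ and dζ are untouched by the translation, so these coordinates converge
  -- first, with a constant independent of the fibre point.
  obtain ⟨a, -, ha⟩ := htrap.exists_limit hu' (f := fun p => p.2.2.2) (C := C)
    (fun p _ => (contDiff_snd.comp (contDiff_snd.comp contDiff_snd)).contDiffAt) hC
    (fun p hp hpK v => by
      have hd : fderiv ℝ (fun p : CMapSpace n => p.2.2.2) p v = v.2.2.2 := by
        rw [(hasFDerivAt_snd.snd.snd).fderiv]; rfl
      rw [hd]
      refine le_trans ?_ (hb' p hp hpK v)
      exact (norm_snd_le (heisenbergDiff p v).2.2).trans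
        ((norm_snd_le _).trans (norm_snd_le _)))
  -- With (ζ̃, ζ) bounded, `norm_le_heisenbergDiff` holds with a uniform constant, so the identity
  -- map is Lipschitz on the trap and the sequence itself converges.
  obtain ⟨x, hx, -⟩ := (ha 1 one_pos).exists_limit hu' (f := fun p => p)
    (C := (1 + 2 * (n + 1) * (‖a‖ + 1)) * C) (fun p _ => contDiffAt_id) (by positivity)
    (fun p hp hpK v => by
      have hd : fderiv ℝ (fun p : CMapSpace n => p) p v = v := by
        rw [fderiv_fun_id]; rfl
      have hpa : ‖p.2.2.2‖ ≤ ‖a‖ + 1 := by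
        have h1 : ‖p.2.2.2 - a‖ < 1 := by rw [← dist_eq_norm]; exact hpK.2
        have h2 := norm_le_norm_add_norm_sub' p.2.2.2 a
        linarith
      rw [hd, mul_assoc]
      refine (norm_le_heisenbergDiff p v).trans (mul_le_mul ?_ (hb' p hp hpK.1 v)
        (norm_nonneg _) (by positivity))
      gcongr)
  have hxK : (x.1, x.2.1) ∈ K := by
    have hcont : Continuous fun p : CMapSpace n => (p.1, p.2.1) := by fun_prop
    exact hK.isClosed.mem_of_tendsto ((hcont.tendsto x).comp hx) (htrap.eventually_mem hu')
  have hxΩ : x ∈ Ω := hKΩ _ hxK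
  exact ⟨x, hxΩ, tendsto_riemDist hΩ hg.contDiffOn.continuousOn hxΩ hx⟩

end OneLoopCompleteness

end

theorem mainTheorem3 {n : ℕ} (h : MvPolynomial (Fin n) ℝ) (U : Set (Fin n → ℝ))
    (hpsr : IsProjectiveSpecialReal h U)
    (hcomplete : IsCompleteRiemannian (psrHypersurface h U) (psrMetric h)) :
    IsProjectiveSpecialKahlerDomain (rMapCone U) (rMapPrepotential h) (rMapDomain U)
      (rMapMetric h) ∧
    (∀ c : ℝ, 0 ≤ c →
      IsQuaternionicKahler (cMapDomain (rMapDomain U))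
        (oneLoopMetric (rMapMetric h) (rMapPrepotential h) c) ∧
      IsCompleteRiemannian (cMapDomain (rMapDomain U))
        (oneLoopMetric (rMapMetric h) (rMapPrepotential h) c)) ∧
    (∀ p ∈ cMapDomain (rMapDomain U),
      oneLoopMetric (rMapMetric h) (rMapPrepotential h) 0 p = qMapMetric h p) := by
  exact ⟨isProjectiveSpecialKahlerDomain hpsr, fun c hc =>
    ⟨isQuaternionicKahler_oneLoopMetric hpsr hc,
      isCompleteRiemannian_oneLoopMetric hpsr hcomplete hc⟩,
    fun p hp => oneLoopMetric_zero hpsr.cubic hp.2⟩
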